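/- All systems are finite-dimensional, $\ln$ is the natural logarithm, $\gamma_A=e^{-\beta H_A}/\operatorname{tr}e^{-\beta H_A}$ is the thermal state of a system $A$ with Hamiltonian $H_A$, and $F(\rho,\sigma)=\|\sqrt\rho\sqrt\sigma\|_1$ with $\|A\|_1=\operatorname{tr}\sqrt{A^\dagger A}$. For $0<\eta<1$ and positive semidefinite $\rho,\sigma$ let $$D_H^{\eta}(\rho\|\sigma)=-\ln\min\{\operatorname{tr}[Q\sigma]:\ 0\le Q\le 1,\ \operatorname{tr}[Q\rho]\ge\eta\}.$$ A thermal operation on a system $S$ with Hamiltonian $H_S$ is a map of the form $\Phi_S(\cdot)=\operatorname{tr}_B[U((\cdot)\otimes\gamma_B)U^\dagger]$, for a system $B$ with some Hamiltonian $H_B$ and a unitary $U$ on $S\otimes B$ that commutes with $H_S+H_B$. An information battery is a system $W$ of some finite dimension $d$ with $H_W=0$; its battery states are $\tau_W=P_W/\operatorname{tr}P_W$ for nonzero orthogonal projectors $P_W$, with charge $w(\tau_W)=\ln d-\ln\operatorname{rank}P_W$. The effective work process of a thermal operation $\Phi_{XW}$ with battery states $(\tau_W,\tau_W')$ is $\mathcal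 T_{X\to X}(\cdot)=\operatorname{tr}_W[P_W'\,\Phi_{XW}((\cdot)\otimes\tau_W)]$, where $P_W'$ is the projector of $\tau_W'$. Corollary. Let $X$ be a system with Hamiltonian $H_X$, let $\beta\ge 0$, and let $\mathcal E_{X\to X}$ be a completely positive, trace-preserving map with $\mathcal E(e^{-iH_Xt}(\cdot)e^{iH_Xt})=e^{-iH_Xt}\mathcal E(\cdot)e^{iH_Xt}$ for all $t\in\mathbb R$. Let $\sigma_X$ be a state with $[\sigma_X,H_X]=0$, and let $0<\epsilon<1$. (1) $\mathcal E$ has a time-covariant Stinespring dilation: a system $E$ with a Hamiltonian $H_E$, a unit vector $|0\rangle_E$ with $H_E|0\rangle_E=0$, and a unitary $V$ on $E\otimes X$ that commutes with $H_E+H_X$, such that $\mathcal E(\cdot)=\operatorname{tr}_E[V(|0\rangle\langle 0|_E\otimes(\cdot))V^\dagger]$. (2) For every such dilation, with $\rho_{EX}=V(|0\rangle\langle 0|_E\otimes\sigma_X)V^\dagger$ and $\rho_X=\operatorname{tr}_E\rho_{EX}=\mathcal E(\sigma_X)$, there exist an information battery $W$, a thermal operation $\Phi_{XW}$ (for the Hamiltonian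 $H_X+H_W$, $H_W=0$) and battery states $\tau_W,\tau_W'$ such that: - the effective work process $\mathcal T_{X\to X}$ of $\Phi_{XW}$ and $(\tau_W,\tau_W')$ satisfies $$F\big(\mathcal T_{X\to X}(|\sigma\rangle\langle\sigma|_{XR}),\ \mathcal E_{X\to X}(|\sigma\rangle\langle\sigma|_{XR})\big)\ \ge\ 1-6\epsilon$$ for every purification $|\sigma\rangle_{XR}$ of $\sigma_X$ (the maps act as the identity on the reference $R$); - the work cost (in units of pure nats) satisfies $$w(\tau_W)-w(\tau_W')\ \le\ -D_H^{1-\epsilon}(\rho_{EX}\,\|\,\gamma_E\otimes\rho_X)+\ln\operatorname{tr}e^{-\beta H_E}+\ln(2/\epsilon).$$ -/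

import Mathlib

open scoped Matrix Kronecker ComplexOrder

/-! Finite-dimensional quantum systems are given by a finite index type (the standard basis);
operators are complex square matrices, kets are vectors, and `A × B` indexes the tensor product. -/

noncomputable section

namespace QThermo

/-- Density operators: positive semidefinite and of unit trace. -/
def IsState {S : Type*} [Fintype S] (ρ : Matrix S S ℂ) : Prop :=
  ρ.PosSemidef ∧ ρ.trace = 1

/-- The rank-one operator `|ψ⟩⟨ψ|`. -/
def ketbra {S : Type*} (ψ : S → ℂ) : Matrix S S ℂ :=
  Matrix.vecMulVec ψ (star ψ)

/-- Partial trace over the first tensor factor. -/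
def traceLeft {A B : Type*} [Fintype A] :
    Matrix (A × B) (A × B) ℂ →ₗ[ℂ] Matrix B B ℂ where
  toFun M := Matrix.of fun b b' => ∑ a, M (a, b) (a, b')
  map_add' M N := by ext; simp [Finset.sum_add_distrib]
  map_smul' c M := by ext; simp [Finset.mul_sum]

/-- Partial trace over the second tensor factor. -/
def traceRight {A B : Type*} [Fintype B] :
    Matrix (A × B) (A × B) ℂ →ₗ[ℂ] Matrix A A ℂ where
  toFun M := Matrix.of fun a a' => ∑ b, M (a, b) (a', b)
  map_add' M N := by ext; simp [Finset.sum_add_distrib]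
  map_smul' c M := by ext; simp [Finset.mul_sum]

/-- The map `T ⊗ id_R`: `T` is applied to each of the blocks labelled by the `R` indices. -/
def ampliate {X Y : Type*} (T : Matrix X X ℂ →ₗ[ℂ] Matrix Y Y ℂ) (R : Type*)
    (M : Matrix (X × R) (X × R) ℂ) : Matrix (Y × R) (Y × R) ℂ :=
  Matrix.of fun p q => T (Matrix.of fun x x' => M (x, p.2) (x', q.2)) p.1 q.1

/-- The non-normalized maximally entangled ket `∑ₖ |k⟩ ⊗ |k⟩`. -/
def maxEntangledKet (X : Type*) [DecidableEq X] : X × X → ℂ :=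
  fun p => if p.1 = p.2 then 1 else 0

/-- Complete positivity: Hermiticity is preserved and the Choi operator is positive. -/
def IsCompletelyPositive {X Y : Type*} [DecidableEq X]
    (T : Matrix X X ℂ →ₗ[ℂ] Matrix Y Y ℂ) : Prop :=
  (∀ A : Matrix X X ℂ, A.IsHermitian → (T A).IsHermitian) ∧
    (ampliate T X (ketbra (maxEntangledKet X))).PosSemidef

/-- Trace preservation. -/
def IsTracePreserving {X Y : Type*} [Fintype X] [Fintype Y]
    (T : Matrix X X ℂ →ₗ[ℂ] Matrix Y Y ℂ) : Prop :=
  ∀ A : Matrix X X ℂ, (T A).trace = A.trace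

/-- `T(e^{-iHt} A e^{iHt}) = e^{-iHt} T(A) e^{iHt}` for all real `t` and all operators `A`. -/
def IsTimeCovariant {X : Type*} [Fintype X] [DecidableEq X] (H : Matrix X X ℂ)
    (T : Matrix X X ℂ →ₗ[ℂ] Matrix X X ℂ) : Prop :=
  ∀ (t : ℝ) (A : Matrix X X ℂ),
    T (NormedSpace.exp (-(Complex.I * (t : ℂ)) • H) * A *
        NormedSpace.exp ((Complex.I * (t : ℂ)) • H)) =
      NormedSpace.exp (-(Complex.I * (t : ℂ)) • H) * T A *
        NormedSpace.exp ((Complex.I * (t : ℂ)) • H)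

/-- The Hamiltonian `H_A ⊗ 1 + 1 ⊗ H_B` of two noninteracting systems. -/
def totalHamiltonian {A B : Type*} [DecidableEq A] [DecidableEq B]
    (HA : Matrix A A ℂ) (HB : Matrix B B ℂ) : Matrix (A × B) (A × B) ℂ :=
  HA ⊗ₖ (1 : Matrix B B ℂ) + (1 : Matrix A A ℂ) ⊗ₖ HB

/-- The Gibbs weight `e^{-βH}`. -/
def gibbsWeight {S : Type*} [Fintype S] [DecidableEq S] (β : ℝ) (H : Matrix S S ℂ) :
    Matrix S S ℂ :=
  NormedSpace.exp (-(β : ℂ) • H)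

/-- The partition function `tr e^{-βH}` (a real number for Hermitian `H`). -/
def partitionFunction {S : Type*} [Fintype S] [DecidableEq S] (β : ℝ) (H : Matrix S S ℂ) : ℝ :=
  (gibbsWeight β H).trace.re

/-- The thermal state `e^{-βH} / tr e^{-βH}`. -/
def gibbsState {S : Type*} [Fintype S] [DecidableEq S] (β : ℝ) (H : Matrix S S ℂ) :
    Matrix S S ℂ :=
  (gibbsWeight β H).trace⁻¹ • gibbsWeight β H

/-- `Φ` is a thermal operation on a system with Hamiltonian `H`: it adds a (nonzero) bath `B` with
some Hamiltonian in its thermal state, applies a unitary that commutes with the total Hamiltonian,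
and discards the bath. -/
def IsThermalOperation {S : Type*} [Fintype S] [DecidableEq S] (β : ℝ) (H : Matrix S S ℂ)
    (Φ : Matrix S S ℂ →ₗ[ℂ] Matrix S S ℂ) : Prop :=
  ∃ (n : ℕ) (HB : Matrix (Fin n) (Fin n) ℂ) (U : Matrix (S × Fin n) (S × Fin n) ℂ),
    0 < n ∧ HB.IsHermitian ∧ U ∈ Matrix.unitaryGroup (S × Fin n) ℂ ∧
      Commute U (totalHamiltonian H HB) ∧
      ∀ ρ : Matrix S S ℂ, Φ ρ = traceRight (U * (ρ ⊗ₖ gibbsState β HB) * Uᴴ)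

/-- A state `P / tr P` of an information battery of dimension `d`, given by a nonzero orthogonal
projector `P`. -/
structure BatteryState (d : ℕ) where
  /-- the projector `P` -/
  proj : Matrix (Fin d) (Fin d) ℂ
  isHermitian : proj.IsHermitian
  idempotent : proj * proj = proj
  ne_zero : proj ≠ 0

/-- The density operator `P / tr P`. -/
def BatteryState.state {d : ℕ} (τ : BatteryState d) : Matrix (Fin d) (Fin d) ℂ :=
  τ.proj.trace⁻¹ • τ.proj

/-- The charge `w(τ) = ln d - m` in pure nats, where the rank of the projector is `e^m`. -/
def BatteryState.charge {d : ℕ} (τ : BatteryState d) : ℝ :=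
  Real.log d - Real.log τ.proj.rank

/-- The effective work process
`T(A) = tr_W [(1 ⊗ P') Φ(A ⊗ τ)]` of `Φ` and the battery states `(τ, τ')`. -/
def effectiveWorkProcess {X : Type*} [Fintype X] [DecidableEq X] {d : ℕ}
    (Φ : Matrix (X × Fin d) (X × Fin d) ℂ →ₗ[ℂ] Matrix (X × Fin d) (X × Fin d) ℂ)
    (τ τ' : BatteryState d) : Matrix X X ℂ →ₗ[ℂ] Matrix X X ℂ where
  toFun A := traceRight (((1 : Matrix X X ℂ) ⊗ₖ τ'.proj) * Φ (A ⊗ₖ τ.state))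
  map_add' A B := by simp [Matrix.add_kronecker, Matrix.mul_add]
  map_smul' c A := by simp [Matrix.smul_kronecker]

/-- The square root of a positive semidefinite matrix, by functional calculus. -/
def matrixSqrt {S : Type*} [Fintype S] [DecidableEq S] (A : Matrix S S ℂ) : Matrix S S ℂ :=
  cfc Real.sqrt A

/-- The one-norm `tr √(A† A)`. -/
def traceNorm {S : Type*} [Fintype S] [DecidableEq S] (A : Matrix S S ℂ) : ℝ :=
  (matrixSqrt (Aᴴ * A)).trace.re

/-- The fidelity `‖√ρ √σ‖₁` (not squared). -/
def fidelity {S : Type*} [Fintype S] [DecidableEq S] (ρ σ : Matrix S S ℂ) : ℝ :=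
  traceNorm (matrixSqrt ρ * matrixSqrt σ)

/-- The values `tr[Qσ]` of the tests `0 ≤ Q ≤ 1` with `tr[Qρ] ≥ η`. -/
def testValues {S : Type*} [Fintype S] [DecidableEq S] (η : ℝ) (ρ σ : Matrix S S ℂ) : Set ℝ :=
  {x | ∃ Q : Matrix S S ℂ, Q.PosSemidef ∧ (1 - Q).PosSemidef ∧
    η ≤ (Q * ρ).trace.re ∧ x = (Q * σ).trace.re}

/-- `exp(-D) = min η⁻¹ tr[Qσ]` over `0 ≤ Q ≤ 1` with `tr[Qρ] ≥ η`. -/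
def normalizedHypTestEntropy {S : Type*} [Fintype S] [DecidableEq S] (η : ℝ)
    (ρ σ : Matrix S S ℂ) : ℝ :=
  -Real.log (η⁻¹ * sInf (testValues η ρ σ))

/-- The hypothesis testing relative entropy, obtained from the normalized one by subtracting
`ln η`; thus `exp(-D) = min tr[Qσ]` over `0 ≤ Q ≤ 1` with `tr[Qρ] ≥ η`. -/
def hypTestEntropy {S : Type*} [Fintype S] [DecidableEq S] (η : ℝ) (ρ σ : Matrix S S ℂ) : ℝ :=
  normalizedHypTestEntropy η ρ σ - Real.log η

/-- The output `V (|e₀⟩⟨e₀| ⊗ A) V†` on `E ⊗ X`. -/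
def dilationOutput {E X : Type*} [Fintype E] [Fintype X] (e₀ : E → ℂ)
    (V : Matrix (E × X) (E × X) ℂ) (A : Matrix X X ℂ) : Matrix (E × X) (E × X) ℂ :=
  V * (ketbra e₀ ⊗ₖ A) * Vᴴ

/-- A time-covariant Stinespring dilation of `T`: `V` is a unitary on `E ⊗ X` that commutes with
`H_E + H_X`, the unit vector `e₀` is an eigenvector of `H_E` of eigenvalue zero, and
`T(A) = tr_E [V (|e₀⟩⟨e₀| ⊗ A) V†]`. -/
structure IsCovariantDilation {X E : Type*} [Fintype X] [DecidableEq X] [Fintype E]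
    [DecidableEq E] (HX : Matrix X X ℂ) (T : Matrix X X ℂ →ₗ[ℂ] Matrix X X ℂ)
    (HE : Matrix E E ℂ) (e₀ : E → ℂ) (V : Matrix (E × X) (E × X) ℂ) : Prop where
  isHermitian : HE.IsHermitian
  unit : star e₀ ⬝ᵥ e₀ = 1
  zero_energy : HE *ᵥ e₀ = 0
  unitary : V ∈ Matrix.unitaryGroup (E × X) ℂ
  commute : Commute V (totalHamiltonian HE HX)
  dilates : ∀ A : Matrix X X ℂ, T A = traceLeft (dilationOutput e₀ V A)

/-- `ψ` is a purification of `σ` with reference system `R`. -/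
def IsPurification {X R : Type*} [Fintype R] (σ : Matrix X X ℂ) (ψ : X × R → ℂ) : Prop :=
  traceRight (ketbra ψ) = σ

end QThermo

end

/-! Existence of the dilation. Covariance makes the Choi operator commute with H ⊗ 1 − 1 ⊗ Hᵀ, hence
also its square root, whose columns are Kraus operators. Commutation with H therefore mixes these
Kraus operators by a Hermitian matrix; minus its transpose serves as the environment Hamiltonian,
with one extra level of energy zero for the input (`kraus_commutator`). The resulting isometry maps
the input subspace into its orthogonal complement, so exchanging the subspace with its image and
fixing the rest is a covariant unitary.

Work cost. The protocol is position-based decoding in a bath of L·M copies of E. Since e₀ has energy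
zero, each thermal copy is in e₀ with probability z = 1/Z, independently, and the set J of such
copies is a classical record. If J has at least n elements, the initial battery level i among n
selects an element of J, injectively in i, and V acts on that copy and X. The selected site must
then be accounted for reversibly. The battery stores only its group l among L; the place within the
group of M sites is recovered from the bath and X by a pretty good measurement built from a test Q
of ρ_EX against γ ⊗ ρ_X, the latter being what X and an untouched site look like. By
`hayashi_nagaoka` the error is about 2ε + 4(M − 1)e^{-D}, so M close to ε/(2e^{-D}) is affordable.
As n can be taken close to LMz, the cost ln(L/n) is close to ln(Z/M), the asserted bound.

Rigour rests on three facts. The operators from initial to final battery levels form one contraction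
(`posSemidef_one_sub_protocol`), and a contraction commuting with the energy is a corner of an
energy-conserving unitary (`exists_unitary_of_contraction`). The fidelity is at least the overlap of
the actual Kraus operators with ideal ones that omit the decoder, and the ideal ones may implement
only a fraction of the channel (`re_sum_trace_le_fidelity`). Summed over configurations, the
conditioned bath becomes thermal again (`sum_configState_mem`), so the total error is that of a
single decoding problem; Chebyshev's inequality controls the event that J has fewer than n elements.
-/

noncomputable section

namespace QThermo

open scoped MatrixOrder

/-! ### Square roots, inverse square roots and support projectors -/

section FunctionalCalculus

variable {n : Type*} [Fintype n] [DecidableEq n]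

/-- The spectrum is finite, so the functional calculus applies to discontinuous functions such as
inverses and indicators. -/
lemma continuousOn_matrix_spectrum (A : Matrix n n ℂ) (f : ℝ → ℝ) :
    ContinuousOn f (spectrum ℝ A) :=
  (Matrix.finite_real_spectrum (A := A)).continuousOn f

/-- The inverse square root of a positive semidefinite matrix on its support. -/
def invSqrt (A : Matrix n n ℂ) : Matrix n n ℂ :=
  cfc (fun x : ℝ => (Real.sqrt x)⁻¹) A

/-- The projector onto the support of a positive semidefinite matrix. -/
def supportProj (A : Matrix n n ℂ) : Matrix n n ℂ :=
  cfc (fun x : ℝ => (Real.sqrt x)⁻¹ * Real.sqrt x) A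

lemma isHermitian_cfc (f : ℝ → ℝ) (A : Matrix n n ℂ) : (cfc f A).IsHermitian :=
  cfc_predicate f A

lemma cfc_mul_matrix (f g : ℝ → ℝ) (A : Matrix n n ℂ) :
    cfc (fun x => f x * g x) A = cfc f A * cfc g A :=
  cfc_mul f g A (continuousOn_matrix_spectrum A f) (continuousOn_matrix_spectrum A g)

lemma posSemidef_cfc {f : ℝ → ℝ} (hf : ∀ x, 0 ≤ f x) (A : Matrix n n ℂ) :
    (cfc f A).PosSemidef := by
  have h : cfc f A = (cfc (fun x => Real.sqrt (f x)) A)ᴴ * cfc (fun x => Real.sqrt (f x)) A := by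
    rw [(isHermitian_cfc _ A).eq, ← cfc_mul_matrix]
    simp only [Real.mul_self_sqrt (hf _)]
  rw [h]
  exact Matrix.posSemidef_conjTranspose_mul_self _

lemma posSemidef_matrixSqrt (A : Matrix n n ℂ) : (matrixSqrt A).PosSemidef :=
  posSemidef_cfc Real.sqrt_nonneg A

lemma isHermitian_matrixSqrt (A : Matrix n n ℂ) : (matrixSqrt A).IsHermitian :=
  isHermitian_cfc _ A

lemma isHermitian_invSqrt (A : Matrix n n ℂ) : (invSqrt A).IsHermitian :=
  isHermitian_cfc _ A

lemma spectrum_nonneg {A : Matrix n n ℂ} (hA : A.PosSemidef) {x : ℝ} (hx : x ∈ spectrum ℝ A) :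
    0 ≤ x := by
  have h := (Matrix.posSemidef_iff_isHermitian_and_spectrum_nonneg.1 hA).2
    (Set.mem_preimage.1 (by rwa [spectrum.preimage_algebraMap ℂ] : x ∈ algebraMap ℝ ℂ ⁻¹' _))
  simpa using h

lemma matrixSqrt_mul_self {A : Matrix n n ℂ} (hA : A.PosSemidef) :
    matrixSqrt A * matrixSqrt A = A := by
  rw [matrixSqrt, ← cfc_mul_matrix]
  conv_rhs => rw [← cfc_id' ℝ A hA.isHermitian.isSelfAdjoint]
  exact cfc_congr fun x hx => Real.mul_self_sqrt (spectrum_nonneg hA hx)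

lemma invSqrt_mul_matrixSqrt (A : Matrix n n ℂ) : invSqrt A * matrixSqrt A = supportProj A := by
  rw [matrixSqrt, invSqrt, supportProj, ← cfc_mul_matrix]

lemma matrixSqrt_mul_invSqrt (A : Matrix n n ℂ) : matrixSqrt A * invSqrt A = supportProj A := by
  rw [matrixSqrt, invSqrt, supportProj, ← cfc_mul_matrix]
  simp only [mul_comm]

lemma supportProj_mul_matrixSqrt (A : Matrix n n ℂ) :
    supportProj A * matrixSqrt A = matrixSqrt A := by
  rw [matrixSqrt, supportProj, ← cfc_mul_matrix]
  refine cfc_congr fun x _ => ?_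
  by_cases h : Real.sqrt x = 0
  · simp [h]
  · field_simp

lemma isHermitian_supportProj (A : Matrix n n ℂ) : (supportProj A).IsHermitian :=
  isHermitian_cfc _ A

lemma supportProj_mul_self (A : Matrix n n ℂ) : supportProj A * supportProj A = supportProj A := by
  conv_lhs => enter [2]; rw [← matrixSqrt_mul_invSqrt A]
  rw [← mul_assoc, supportProj_mul_matrixSqrt, matrixSqrt_mul_invSqrt]

lemma supportProj_mul {A : Matrix n n ℂ} (hA : A.PosSemidef) : supportProj A * A = A := by
  conv_lhs => enter [2]; rw [← matrixSqrt_mul_self hA]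
  rw [← mul_assoc, supportProj_mul_matrixSqrt, matrixSqrt_mul_self hA]

lemma posSemidef_one_sub_of_isIdempotent {P : Matrix n n ℂ} (hP : P.IsHermitian) (h : P * P = P) :
    (1 - P).PosSemidef := by
  have : 1 - P = (1 - P)ᴴ * (1 - P) := by
    rw [Matrix.conjTranspose_sub, hP.eq, Matrix.conjTranspose_one]
    simp [mul_sub, sub_mul, h]
  rw [this]
  exact Matrix.posSemidef_conjTranspose_mul_self _

lemma posSemidef_one_sub_supportProj (A : Matrix n n ℂ) : (1 - supportProj A).PosSemidef :=
  posSemidef_one_sub_of_isIdempotent (isHermitian_supportProj A) (supportProj_mul_self A)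

lemma invSqrt_mul_mul_invSqrt {A : Matrix n n ℂ} (hA : A.PosSemidef) :
    invSqrt A * A * invSqrt A = supportProj A := by
  conv_lhs => enter [1, 2]; rw [← matrixSqrt_mul_self hA]
  rw [← mul_assoc, mul_assoc, invSqrt_mul_matrixSqrt, matrixSqrt_mul_invSqrt, supportProj_mul_self]

lemma commute_matrixSqrt {A B : Matrix n n ℂ} (h : Commute A B) : Commute (matrixSqrt A) B :=
  h.cfc_real _

lemma commute_invSqrt {A B : Matrix n n ℂ} (h : Commute A B) : Commute (invSqrt A) B :=
  h.cfc_real _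

end FunctionalCalculus

/-! ### Contractions, the trace norm and the fidelity -/

section TraceNorm

variable {n m : Type*} [Fintype n] [DecidableEq n] [Fintype m] [DecidableEq m]

/-- Douglas' factorization: if `M M† ≤ C`, then `M = √C K` with a contraction `K`. -/
lemma exists_eq_matrixSqrt_mul {C : Matrix n n ℂ} (hC : C.PosSemidef) {M : Matrix n m ℂ}
    (h : (C - M * Mᴴ).PosSemidef) :
    ∃ K : Matrix n m ℂ, M = matrixSqrt C * K ∧ (1 - K * Kᴴ).PosSemidef := by
  refine ⟨invSqrt C * M, ?_, ?_⟩
  · rw [← Matrix.mul_assoc, matrixSqrt_mul_invSqrt]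
    set P := supportProj C with hP
    have hPh : P.IsHermitian := isHermitian_supportProj C
    -- Compressing M M† ≤ C by 1 − P, which annihilates C, leaves (1 − P) M with a nonpositive
    -- squared Hilbert–Schmidt norm.
    have h0 : (1 - P) * M = 0 := by
      rw [← Matrix.trace_mul_conjTranspose_self_eq_zero_iff]
      have h1 : ((1 - P) * M) * ((1 - P) * M)ᴴ = (1 - P) * (M * Mᴴ) * (1 - P) := by
        rw [Matrix.conjTranspose_mul, Matrix.conjTranspose_sub, hPh.eq, Matrix.conjTranspose_one]
        simp only [Matrix.mul_assoc]
      have h2 := (h.mul_mul_conjTranspose_same (1 - P)).trace_nonneg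
      have h3 : (1 - P) * C = 0 := by rw [sub_mul, one_mul, supportProj_mul hC, sub_self]
      rw [Matrix.conjTranspose_sub, hPh.eq, Matrix.conjTranspose_one, mul_sub (1 - P) C, h3,
        zero_sub, neg_mul, Matrix.trace_neg, ← h1] at h2
      exact le_antisymm (neg_nonneg.1 h2)
        (Matrix.posSemidef_self_mul_conjTranspose ((1 - P) * M)).trace_nonneg
    rw [Matrix.sub_mul, Matrix.one_mul, sub_eq_zero] at h0
    exact h0
  · have h1 := h.mul_mul_conjTranspose_same (invSqrt C)
    rw [(isHermitian_invSqrt C).eq, mul_sub, sub_mul, invSqrt_mul_mul_invSqrt hC] at h1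
    have h2 : 1 - invSqrt C * M * (invSqrt C * M)ᴴ = (1 - supportProj C) +
        (supportProj C - invSqrt C * (M * Mᴴ) * invSqrt C) := by
      rw [Matrix.conjTranspose_mul, (isHermitian_invSqrt C).eq]
      simp only [Matrix.mul_assoc]
      abel
    rw [h2]
    exact (posSemidef_one_sub_supportProj C).add h1

lemma trace_mul_re_nonneg {A B : Matrix n n ℂ} (hA : A.PosSemidef) (hB : B.PosSemidef) :
    0 ≤ (A * B).trace.re := by
  have h := (hB.conjTranspose_mul_mul_same (matrixSqrt A)).trace_nonneg
  rw [(isHermitian_matrixSqrt A).eq, Matrix.trace_mul_comm, ← mul_assoc,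
    matrixSqrt_mul_self hA] at h
  exact (Complex.le_def.1 h).1

lemma trace_mul_re_mono {A A' B : Matrix n n ℂ} (hA : (A' - A).PosSemidef) (hB : B.PosSemidef) :
    (A * B).trace.re ≤ (A' * B).trace.re := by
  have := trace_mul_re_nonneg hA hB
  rw [sub_mul, Matrix.trace_sub, Complex.sub_re] at this
  linarith

lemma trace_conjTranspose_re {k : Type*} [Fintype k] (A : Matrix k k ℂ) : Aᴴ.trace.re = A.trace.re := by
  rw [Matrix.trace_conjTranspose]
  simp

/-- Expand 0 ≤ tr (1 − L)(1 − L)† P and bound tr L L† P by tr P. -/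
lemma re_trace_mul_le_of_contraction {L P : Matrix n n ℂ} (hL : (1 - L * Lᴴ).PosSemidef)
    (hP : P.PosSemidef) : (L * P).trace.re ≤ P.trace.re := by
  have h1 := trace_mul_re_nonneg (Matrix.posSemidef_self_mul_conjTranspose (1 - L)) hP
  have h2 := trace_mul_re_mono hL hP
  have h2' : 0 ≤ ((1 - L * Lᴴ) * P).trace.re := trace_mul_re_nonneg hL hP
  have h3 : (Lᴴ * P).trace.re = (L * P).trace.re := by
    rw [← trace_conjTranspose_re, Matrix.conjTranspose_mul, Matrix.conjTranspose_conjTranspose,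
      hP.isHermitian.eq, Matrix.trace_mul_comm]
  rw [Matrix.conjTranspose_sub, Matrix.conjTranspose_one, sub_mul, one_mul, mul_sub, mul_one] at h1
  simp only [sub_mul, one_mul, Matrix.trace_sub, Complex.sub_re] at h1 h2'
  linarith

lemma posSemidef_one_sub_mul_conjTranspose {l : Type*} [Fintype l] [DecidableEq l]
    {A : Matrix n m ℂ} {B : Matrix m l ℂ}
    (hA : (1 - A * Aᴴ).PosSemidef) (hB : (1 - B * Bᴴ).PosSemidef) :
    (1 - (A * B) * (A * B)ᴴ).PosSemidef := by
  have h := hA.add (hB.mul_mul_conjTranspose_same A)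
  convert h using 1
  rw [Matrix.conjTranspose_mul, Matrix.mul_sub, Matrix.sub_mul, Matrix.mul_one]
  simp only [Matrix.mul_assoc]
  abel

/-- A matrix is a contraction if and only if its adjoint is. -/
lemma posSemidef_one_sub_conjTranspose_mul {A : Matrix n m ℂ} (hA : (1 - A * Aᴴ).PosSemidef) :
    (1 - Aᴴ * A).PosSemidef := by
  have : Invertible (1 : Matrix n n ℂ) := invertibleOne
  have : Invertible (1 : Matrix m m ℂ) := invertibleOne
  -- Both conditions are Schur complements of the block matrix with rows (1, A) and (A†, 1).
  have h1 := (Matrix.PosDef.fromBlocks₂₂ (1 : Matrix n n ℂ) A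
    (Matrix.PosDef.one : (1 : Matrix m m ℂ).PosDef)).2 (by simpa using hA)
  simpa using (Matrix.PosDef.fromBlocks₁₁ A (1 : Matrix m m ℂ)
    (Matrix.PosDef.one : (1 : Matrix n n ℂ).PosDef)).1 h1

/-- The half of the variational formula for the trace norm that lower bounds on the fidelity need.
Douglas' factorization of B† yields a polar decomposition B = L†|B| with L a contraction, which
reduces the claim to a positive operator. -/
lemma re_trace_mul_le_traceNorm {K B : Matrix n n ℂ} (hK : (1 - K * Kᴴ).PosSemidef) :
    (K * B).trace.re ≤ traceNorm B := by
  have hBB := Matrix.posSemidef_conjTranspose_mul_self B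
  set P := matrixSqrt (Bᴴ * B) with hPdef
  have hP : P.PosSemidef := posSemidef_matrixSqrt _
  obtain ⟨L, hL, hLc⟩ := exists_eq_matrixSqrt_mul (C := Bᴴ * B) hBB (M := Bᴴ)
    (by rw [Matrix.conjTranspose_conjTranspose, sub_self]; exact Matrix.PosSemidef.zero)
  have hB : B = Lᴴ * P := by
    rw [← Matrix.conjTranspose_conjTranspose B, hL, Matrix.conjTranspose_mul,
      (isHermitian_matrixSqrt _).eq]
  have hLc' : (1 - Lᴴ * Lᴴᴴ).PosSemidef := by
    rw [Matrix.conjTranspose_conjTranspose]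
    exact posSemidef_one_sub_conjTranspose_mul hLc
  have := re_trace_mul_le_of_contraction (posSemidef_one_sub_mul_conjTranspose hK hLc') hP
  rwa [mul_assoc, ← hB] at this

/-- A lower bound on the fidelity by the overlap of (partial) purifications. -/
lemma re_trace_le_fidelity {A C : Matrix n n ℂ} (hA : A.PosSemidef) (hC : C.PosSemidef)
    {M N : Matrix n m ℂ} (hM : (A - M * Mᴴ).PosSemidef) (hN : (C - N * Nᴴ).PosSemidef) :
    (Nᴴ * M).trace.re ≤ fidelity A C := by
  obtain ⟨K, hK, hKc⟩ := exists_eq_matrixSqrt_mul hA hM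
  obtain ⟨L, hL, hLc⟩ := exists_eq_matrixSqrt_mul hC hN
  have hKc' : (1 - Kᴴ * Kᴴᴴ).PosSemidef := by
    rw [Matrix.conjTranspose_conjTranspose]
    exact posSemidef_one_sub_conjTranspose_mul hKc
  have h := re_trace_mul_le_traceNorm (B := matrixSqrt A * matrixSqrt C)
    (posSemidef_one_sub_mul_conjTranspose hLc hKc')
  refine le_trans (le_of_eq ?_) h
  rw [← trace_conjTranspose_re, Matrix.conjTranspose_mul, Matrix.conjTranspose_conjTranspose]
  conv_lhs => rw [hK, hL, Matrix.conjTranspose_mul, (isHermitian_matrixSqrt A).eq,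
    ← Matrix.mul_assoc, Matrix.trace_mul_comm]
  simp only [Matrix.mul_assoc]

end TraceNorm

/-! ### Operator monotonicity of the square root and the Hayashi–Nagaoka inequality -/

section HayashiNagaoka

variable {n : Type*} [Fintype n] [DecidableEq n]

/-- Operator monotonicity of the square root, in the form `S² ≤ R² → S ≤ R`. -/
lemma le_of_mul_self_le_mul_self {S R : Matrix n n ℂ} (hS : S.PosSemidef) (hR : R.PosSemidef)
    (h : (R * R - S * S).PosSemidef) : (R - S).PosSemidef := by
  have hD : (R - S).IsHermitian := hR.isHermitian.sub hS.isHermitian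
  rw [hD.posSemidef_iff_eigenvalues_nonneg]
  intro i
  by_contra hneg
  have hneg : hD.eigenvalues i < 0 := by simpa using hneg
  set μ := hD.eigenvalues i
  set v : n → ℂ := (hD.eigenvectorBasis i : n → ℂ) with hv
  have hev : (R - S) *ᵥ v = (μ : ℂ) • v := by
    have := hD.mulVec_eigenvectorBasis i
    simpa [hv, μ] using this
  have hev' : star v ᵥ* (R - S) = (μ : ℂ) • star v := by
    have := congrArg star hev
    rw [Matrix.star_mulVec, hD.eq] at this
    simpa using this
  have hRv := hR.dotProduct_mulVec_nonneg v
  have hSv := hS.dotProduct_mulVec_nonneg v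
  -- On an eigenvector v of R − S with eigenvalue μ < 0, the symmetrized product gives ⟨v, (R² −
  -- S²)v⟩ = μ⟨v, (R + S)v⟩. Here ⟨v, Sv⟩ > ⟨v, Rv⟩ ≥ 0, so this value is negative, against the
  -- hypothesis.
  have hsum : R * R - S * S = (1 / 2 : ℂ) • ((R + S) * (R - S) + (R - S) * (R + S)) := by
    have : (R + S) * (R - S) + (R - S) * (R + S) = (2 : ℂ) • (R * R - S * S) := by
      rw [two_smul]; noncomm_ring
    rw [this, smul_smul]; norm_num
  have key : star v ⬝ᵥ ((R * R - S * S) *ᵥ v) = μ * (star v ⬝ᵥ (R *ᵥ v) + star v ⬝ᵥ (S *ᵥ v)) := by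
    rw [hsum, Matrix.smul_mulVec, Matrix.add_mulVec, dotProduct_smul, dotProduct_add,
      ← Matrix.mulVec_mulVec, hev, ← Matrix.mulVec_mulVec, Matrix.dotProduct_mulVec _ (R - S), hev',
      Matrix.mulVec_smul, dotProduct_smul, smul_dotProduct, Matrix.add_mulVec, dotProduct_add]
    simp only [smul_eq_mul]
    ring
  have hpos := h.dotProduct_mulVec_nonneg v
  rw [key] at hpos
  have hle : (μ : ℂ) * (star v ⬝ᵥ (R *ᵥ v)) = star v ⬝ᵥ (R *ᵥ v) * μ := mul_comm _ _
  have hdiff : star v ⬝ᵥ (R *ᵥ v) - star v ⬝ᵥ (S *ᵥ v) = μ * (star v ⬝ᵥ v) := by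
    rw [← dotProduct_sub, ← Matrix.sub_mulVec, hev, dotProduct_smul, smul_eq_mul]
  have hvv : star v ⬝ᵥ v = 1 := by
    have h1 := hD.eigenvectorBasis.orthonormal.1 i
    have h2 : inner ℂ (hD.eigenvectorBasis i) (hD.eigenvectorBasis i) = (1 : ℂ) := by
      rw [inner_self_eq_norm_sq_to_K, h1]; norm_num
    rw [EuclideanSpace.inner_eq_star_dotProduct] at h2
    rw [dotProduct_comm]
    exact h2
  rw [hvv, mul_one] at hdiff
  have a1 := (Complex.le_def.1 hRv).1
  have a2 := (Complex.le_def.1 hSv).1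
  have a3 := (Complex.le_def.1 hpos).1
  have a4 := congrArg Complex.re hdiff
  simp only [Complex.re_ofReal_mul, Complex.add_re, Complex.sub_re, Complex.ofReal_re,
    Complex.zero_re] at a1 a2 a3 a4
  nlinarith

/-- The difference equals √S (1 − S) √S. -/
lemma posSemidef_sub_mul_self {S : Matrix n n ℂ} (hS : S.PosSemidef) (hS1 : (1 - S).PosSemidef) :
    (S - S * S).PosSemidef := by
  have h := hS1.conjTranspose_mul_mul_same (matrixSqrt S)
  have h2 : (matrixSqrt S)ᴴ * (1 - S) * matrixSqrt S = S - S * S := by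
    rw [(isHermitian_matrixSqrt S).eq]
    conv_lhs => rw [mul_sub, mul_one, sub_mul, matrixSqrt_mul_self hS]
    congr 1
    have hc : Commute (matrixSqrt S) S := commute_matrixSqrt (Commute.refl S)
    rw [hc.eq, mul_assoc, matrixSqrt_mul_self hS]
  rwa [h2] at h

/-- The Hayashi–Nagaoka inequality. -/
lemma hayashi_nagaoka {S T : Matrix n n ℂ} (hS : S.PosSemidef) (hS1 : (1 - S).PosSemidef)
    (hT : T.PosSemidef) :
    ((2 : ℝ) • (1 - S) + (4 : ℝ) • T - (1 - invSqrt (S + T) * S * invSqrt (S + T))).PosSemidef := by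
  have hST := hS.add hT
  set K := invSqrt (S + T) with hK
  set R := matrixSqrt (S + T) with hR
  set P := supportProj (S + T) with hP
  have hKh : Kᴴ = K := (isHermitian_invSqrt _).eq
  have hRR : R * R = S + T := matrixSqrt_mul_self hST
  have hRpos : R.PosSemidef := posSemidef_matrixSqrt _
  have hKR : K * R = P := invSqrt_mul_matrixSqrt _
  have hRK : R * K = P := matrixSqrt_mul_invSqrt _
  have hPR : P * R = R := supportProj_mul_matrixSqrt _
  have hPK : K * S * K + K * T * K = P := by
    rw [← add_mul, ← mul_add]; exact invSqrt_mul_mul_invSqrt hST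
  have h1 : (1 - P).PosSemidef := posSemidef_one_sub_supportProj _
  -- S² ≤ S ≤ S + T = R², and the square root is operator monotone.
  have hRS : (R - S).PosSemidef := by
    refine le_of_mul_self_le_mul_self hS hRpos ?_
    have := (posSemidef_sub_mul_self hS hS1).add hT
    rw [hRR]
    convert this using 1
    abel
  have hA : ((2 - K) * T * (2 - K)).PosSemidef := by
    have := hT.conjTranspose_mul_mul_same (2 - K)
    rwa [Matrix.conjTranspose_sub, hKh, show (2 : Matrix n n ℂ)ᴴ = 2 by
      simp] at this
  have hB : ((K - 1) * S * (K - 1)).PosSemidef := by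
    have := hS.conjTranspose_mul_mul_same (K - 1)
    rwa [Matrix.conjTranspose_sub, hKh, Matrix.conjTranspose_one] at this
  have hRRK : (K - 1) * (S + T) * (K - 1) = P - (2 : ℝ) • R + (S + T) := by
    have e1 : K * (R * R) * K = P := by rw [hRR]; exact invSqrt_mul_mul_invSqrt hST
    have e2 : K * (R * R) = R := by rw [← mul_assoc, hKR, hPR]
    have e3 : (R * R) * K = R := by
      rw [mul_assoc, hRK, ← hKR, ← mul_assoc, hRK, hPR]
    rw [← hRR]
    calc (K - 1) * (R * R) * (K - 1) = K * (R * R) * K - K * (R * R) - (R * R) * K + R * R := by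
          noncomm_ring
      _ = _ := by rw [e1, e2, e3, two_smul]; abel
  -- Every term on the right is positive. The identity is algebra from K(S + T)K = P and the
  -- expansion of (K − 1)(S + T)(K − 1).
  have hfin : (2 : ℝ) • (1 - S) + (4 : ℝ) • T - (1 - K * S * K) =
      (1 - P) + (4 : ℝ) • (R - S) + (2 : ℝ) • ((K - 1) * S * (K - 1)) + (2 - K) * T * (2 - K) := by
    have e : (K - 1) * S * (K - 1) = P - (2 : ℝ) • R + (S + T) - (K - 1) * T * (K - 1) := by
      rw [← hRRK]; noncomm_ring
    have e' : K * S * K = P - K * T * K := by rw [← hPK]; abel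
    have e'' : (2 - K) * T * (2 - K) = (2 : ℝ) • T + (2 : ℝ) • ((K - 1) * T * (K - 1)) - K * T * K := by
      simp only [two_smul]; noncomm_ring
    rw [e, e', e'']
    module
  rw [hfin]
  exact ((h1.add (hRS.smul (by norm_num))).add (hB.smul (by norm_num))).add hA

end HayashiNagaoka

end QThermo

end

noncomputable section

namespace QThermo

/-! ### Covariant Stinespring dilations -/

section CovariantDilation

variable {X : Type*} [Fintype X] [DecidableEq X]

open scoped Matrix.Norms.Operator in
/-- Time covariance in its infinitesimal form. -/
lemma IsTimeCovariant.map_commutator {H : Matrix X X ℂ} {T : Matrix X X ℂ →ₗ[ℂ] Matrix X X ℂ}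
    (hcov : IsTimeCovariant H T) (A : Matrix X X ℂ) :
    T (H * A - A * H) = H * T A - T A * H := by
  -- Both sides of the covariance relation are differentiated at t = 0; the common factor −i is
  -- cancelled at the end.
  have h1 : ∀ B : Matrix X X ℂ, HasDerivAt (fun t : ℝ =>
      NormedSpace.exp (t • (-Complex.I • H)) * B * NormedSpace.exp (t • (Complex.I • H)))
      (-Complex.I • (H * B - B * H)) 0 := by
    intro B
    have ha := hasDerivAt_exp_smul_const (𝕂 := ℝ) (-Complex.I • H) (0 : ℝ)
    have hb := hasDerivAt_exp_smul_const (𝕂 := ℝ) (Complex.I • H) (0 : ℝ)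
    refine ((ha.mul_const B).mul hb).congr_deriv ?_
    simp only [zero_smul, NormedSpace.exp_zero, one_mul, mul_one, smul_sub, neg_smul,
      Matrix.smul_mul, Matrix.mul_smul, neg_mul]
    abel
  have e1 : ∀ t : ℝ, -(Complex.I * (t : ℂ)) • H = t • (-Complex.I • H) := by
    intro t
    ext i j
    simp only [Matrix.smul_apply, smul_eq_mul, Complex.real_smul]
    ring
  have e2 : ∀ t : ℝ, (Complex.I * (t : ℂ)) • H = t • (Complex.I • H) := by
    intro t
    ext i j
    simp only [Matrix.smul_apply, smul_eq_mul, Complex.real_smul]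
    ring
  have hT := (LinearMap.toContinuousLinearMap (T.restrictScalars ℝ)).hasFDerivAt.comp_hasDerivAt
    (0 : ℝ) (h1 A)
  have hR := h1 (T A)
  have heq : (fun t : ℝ => T (NormedSpace.exp (t • (-Complex.I • H)) * A *
      NormedSpace.exp (t • (Complex.I • H)))) = fun t : ℝ =>
      NormedSpace.exp (t • (-Complex.I • H)) * T A * NormedSpace.exp (t • (Complex.I • H)) := by
    funext t
    have := hcov t A
    rwa [e1, e2] at this
  rw [← heq] at hR
  have : T (-Complex.I • (H * A - A * H)) = -Complex.I • (H * T A - T A * H) := hT.unique hR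
  rw [map_smul] at this
  exact smul_right_injective _ (neg_ne_zero.2 Complex.I_ne_zero) this

/-- The Choi operator. -/
def choi (T : Matrix X X ℂ →ₗ[ℂ] Matrix X X ℂ) : Matrix (X × X) (X × X) ℂ :=
  ampliate T X (ketbra (maxEntangledKet X))

lemma choi_apply (T : Matrix X X ℂ →ₗ[ℂ] Matrix X X ℂ) (p q : X × X) :
    choi T p q = T (Matrix.single p.2 q.2 1) p.1 q.1 := by
  simp only [choi, ampliate, Matrix.of_apply]
  refine congrArg (fun M => T M p.1 q.1) ?_
  ext a a'
  simp only [ketbra, maxEntangledKet, Matrix.vecMulVec_apply, Matrix.single_apply, Matrix.of_apply,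
    Pi.star_apply, apply_ite star, star_one, star_zero, mul_ite, mul_one, mul_zero, ← ite_and]
  exact if_congr (by constructor <;> rintro ⟨h1, h2⟩ <;> simp [h1, h2]) rfl rfl

lemma map_apply_eq_sum (T : Matrix X X ℂ →ₗ[ℂ] Matrix X X ℂ) (A : Matrix X X ℂ) (y y' : X) :
    T A y y' = ∑ x, ∑ x', A x x' * T (Matrix.single x x' 1) y y' := by
  conv_lhs => rw [Matrix.matrix_eq_sum_single A]
  simp only [map_sum, Matrix.sum_apply]
  refine Finset.sum_congr rfl fun x _ => Finset.sum_congr rfl fun x' _ => ?_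
  rw [← mul_one (A x x'), ← smul_eq_mul, ← Matrix.smul_single, map_smul, Matrix.smul_apply,
    smul_eq_mul, smul_eq_mul, mul_one]

/-- The generator `H ⊗ 1 - 1 ⊗ Hᵀ` of the time evolution of Choi operators. -/
def choiGenerator (H : Matrix X X ℂ) : Matrix (X × X) (X × X) ℂ :=
  H ⊗ₖ (1 : Matrix X X ℂ) - (1 : Matrix X X ℂ) ⊗ₖ Hᵀ

/-- The entries of the Choi operator are those of T on matrix units, so this is infinitesimal
covariance on matrix units read entrywise; the transpose comes from H acting on the indices of the
unit. -/
lemma commute_choi {H : Matrix X X ℂ} {T : Matrix X X ℂ →ₗ[ℂ] Matrix X X ℂ}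
    (hcov : IsTimeCovariant H T) : Commute (choi T) (choiGenerator H) := by
  ext ⟨y, x⟩ ⟨y', x'⟩
  have h := congrFun (congrFun (hcov.map_commutator (Matrix.single x x' 1)) y) y'
  rw [map_sub, Matrix.sub_apply, Matrix.sub_apply, map_apply_eq_sum T (H * _),
    map_apply_eq_sum T (_ * H)] at h
  simp only [Matrix.mul_apply, Matrix.single_apply, mul_ite, mul_one, mul_zero, ite_mul, one_mul,
    zero_mul, ite_and, Finset.sum_ite_eq, Finset.mem_univ, if_true,
    Finset.sum_ite_irrel, Finset.sum_const_zero] at h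
  simp only [choiGenerator, Matrix.mul_apply, choi_apply, Fintype.sum_prod_type, Matrix.sub_apply,
    Matrix.kroneckerMap_apply, Matrix.one_apply, Matrix.transpose_apply, mul_sub, sub_mul,
    mul_ite, mul_one, mul_zero, ite_mul, one_mul, zero_mul, Finset.sum_sub_distrib,
    Finset.sum_ite_eq, Finset.sum_ite_eq', Finset.mem_univ, if_true,
    Finset.sum_ite_irrel, Finset.sum_const_zero]
  simp only [mul_comm (T _ _ _)] at h ⊢
  linear_combination h

/-- The canonical Kraus operators, read off from the square root of the Choi operator. -/
def kraus (T : Matrix X X ℂ →ₗ[ℂ] Matrix X X ℂ) (r : X × X) : Matrix X X ℂ :=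
  Matrix.of fun y x => matrixSqrt (choi T) (y, x) r

/-- The square root of the Choi operator is Hermitian, so its square is also a sum of columns times
their adjoints. -/
lemma kraus_sum {T : Matrix X X ℂ →ₗ[ℂ] Matrix X X ℂ} (hcp : IsCompletelyPositive T)
    (x x' y y' : X) :
    ∑ r, kraus T r y x * star (kraus T r y' x') = T (Matrix.single x x' 1) y y' := by
  have h := congrFun (congrFun (matrixSqrt_mul_self hcp.2) (y, x)) (y', x')
  rw [Matrix.mul_apply] at h
  refine Eq.trans ?_ (h.trans (choi_apply T (y, x) (y', x')))
  refine Finset.sum_congr rfl fun r _ => ?_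
  have h2 := congrFun (congrFun (isHermitian_matrixSqrt (choi T)).eq r) (y', x')
  rw [Matrix.conjTranspose_apply] at h2
  simp only [kraus, Matrix.of_apply, h2]
  rfl

/-- The square root of the Choi operator inherits the commutation with the generator, and this is
one column of that relation. It tells how the environment must compensate the energy change of each
Kraus operator. -/
lemma kraus_commutator {H : Matrix X X ℂ} {T : Matrix X X ℂ →ₗ[ℂ] Matrix X X ℂ}
    (hcov : IsTimeCovariant H T) (r : X × X) :
    ∑ s, choiGenerator H s r • kraus T s = H * kraus T r - kraus T r * H := by
  have h := commute_matrixSqrt (commute_choi hcov)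
  ext y x
  have h2 := congrFun (congrFun h.eq (y, x)) r
  rw [Matrix.mul_apply] at h2
  simp only [Matrix.sum_apply, Matrix.smul_apply, smul_eq_mul, kraus, Matrix.of_apply,
    Matrix.sub_apply]
  simp only [mul_comm (choiGenerator H _ _)]
  rw [h2]
  simp only [choiGenerator, Matrix.mul_apply, Fintype.sum_prod_type, Matrix.sub_apply,
    Matrix.kroneckerMap_apply, Matrix.one_apply, Matrix.transpose_apply, sub_mul,
    mul_ite, mul_one, mul_zero, ite_mul, one_mul, zero_mul, Finset.sum_sub_distrib,
    Finset.sum_ite_eq, Finset.mem_univ, if_true, Matrix.of_apply,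
    Finset.sum_ite_irrel, Finset.sum_const_zero]
  congr 1
  exact Finset.sum_congr rfl fun _ _ => mul_comm _ _

/-- The isometry `ψ ↦ ∑ᵣ |r⟩ ⊗ Kᵣ ψ` from `|none⟩ ⊗ X`, as a partial isometry. -/
def krausPartialIsometry (T : Matrix X X ℂ →ₗ[ℂ] Matrix X X ℂ) :
    Matrix (Option (X × X) × X) (Option (X × X) × X) ℂ :=
  Matrix.of fun p q => match p.1, q.1 with
    | some r, none => kraus T r p.2 q.2
    | _, _ => 0

/-- The Hamiltonian of the environment of the canonical covariant dilation. -/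
def krausHamiltonian (H : Matrix X X ℂ) : Matrix (Option (X × X)) (Option (X × X)) ℂ :=
  Matrix.of fun p q => match p, q with
    | some s, some r => -choiGenerator H r s
    | _, _ => 0

lemma isHermitian_choiGenerator {H : Matrix X X ℂ} (hH : H.IsHermitian) :
    (choiGenerator H).IsHermitian := by
  rw [Matrix.IsHermitian, choiGenerator, Matrix.conjTranspose_sub, Matrix.conjTranspose_kronecker,
    Matrix.conjTranspose_kronecker, hH.eq, Matrix.conjTranspose_one, hH.transpose.eq]

lemma isHermitian_krausHamiltonian {H : Matrix X X ℂ} (hH : H.IsHermitian) :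
    (krausHamiltonian H).IsHermitian := by
  ext (_ | s) (_ | r)
  · simp [krausHamiltonian]
  · simp [krausHamiltonian]
  · simp [krausHamiltonian]
  · have := (isHermitian_choiGenerator hH).apply r s
    simp [krausHamiltonian, ← this]

lemma isHermitian_totalHamiltonian {A B : Type*} [DecidableEq A] [DecidableEq B]
    {HA : Matrix A A ℂ} {HB : Matrix B B ℂ} (hA : HA.IsHermitian) (hB : HB.IsHermitian) :
    (totalHamiltonian HA HB).IsHermitian := by
  rw [Matrix.IsHermitian, totalHamiltonian, Matrix.conjTranspose_add,
    Matrix.conjTranspose_kronecker, Matrix.conjTranspose_kronecker, hA.eq, hB.eq,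
    Matrix.conjTranspose_one, Matrix.conjTranspose_one]

/-- The only nonzero blocks lead from `none` to `some r`. There the environment Hamiltonian, minus
the transposed generator, cancels the commutator in `kraus_commutator`, and `none` has energy zero.
-/
lemma commute_krausPartialIsometry {H : Matrix X X ℂ} {T : Matrix X X ℂ →ₗ[ℂ] Matrix X X ℂ}
    (hcov : IsTimeCovariant H T) :
    Commute (krausPartialIsometry T) (totalHamiltonian (krausHamiltonian H) H) := by
  ext ⟨p, y⟩ ⟨q, x⟩
  rcases p with _ | r <;> rcases q with _ | s
  · simp [krausPartialIsometry, totalHamiltonian, krausHamiltonian, Matrix.mul_apply,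
      Fintype.sum_prod_type, Matrix.one_apply]
  · simp [krausPartialIsometry, totalHamiltonian, krausHamiltonian, Matrix.mul_apply,
      Matrix.one_apply]
  · have h := congrFun (congrFun (kraus_commutator hcov r) y) x
    simp only [Matrix.sum_apply, Matrix.smul_apply, smul_eq_mul, Matrix.sub_apply,
      Matrix.mul_apply] at h
    rw [Fintype.sum_prod_type] at h
    simp [krausPartialIsometry, totalHamiltonian, krausHamiltonian, Matrix.mul_apply,
      Fintype.sum_prod_type, Matrix.one_apply, Finset.sum_add_distrib, add_mul]
    linear_combination h
  · simp [krausPartialIsometry, totalHamiltonian, krausHamiltonian, Matrix.mul_apply,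
      Fintype.sum_prod_type, Matrix.one_apply]

/-- Trace preservation on matrix units gives ∑ K†K = 1. -/
lemma krausPartialIsometry_isometry {T : Matrix X X ℂ →ₗ[ℂ] Matrix X X ℂ}
    (hcp : IsCompletelyPositive T) (htp : IsTracePreserving T) :
    (krausPartialIsometry T)ᴴ * krausPartialIsometry T =
      ketbra (Pi.single none 1) ⊗ₖ (1 : Matrix X X ℂ) := by
  ext ⟨p, x⟩ ⟨q, x'⟩
  rcases p with _ | r <;> rcases q with _ | s
  · have h1 : ∑ y, ∑ r, kraus T r y x' * star (kraus T r y x) = if x = x' then 1 else 0 := by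
      simp only [kraus_sum hcp]
      have := htp (Matrix.single x' x 1)
      rw [Matrix.trace] at this
      simp only [Matrix.diag_apply] at this
      rw [this]
      split_ifs with hx
      · subst hx; simp
      · rw [Matrix.trace_single_eq_of_ne _ _ _ (Ne.symm hx)]
    rw [Finset.sum_comm] at h1
    simp only [Fintype.sum_prod_type] at h1
    simp [krausPartialIsometry, ketbra, Matrix.mul_apply, Fintype.sum_prod_type, Matrix.one_apply,
      Matrix.vecMulVec_apply, ← h1, mul_comm]
  all_goals simp [krausPartialIsometry, ketbra, Matrix.mul_apply, Matrix.vecMulVec_apply]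

/-- A covariant isometry extends to a covariant unitary. -/
lemma exists_isCovariantDilation_option {H : Matrix X X ℂ} (hH : H.IsHermitian)
    {T : Matrix X X ℂ →ₗ[ℂ] Matrix X X ℂ} (hcp : IsCompletelyPositive T)
    (htp : IsTracePreserving T) (hcov : IsTimeCovariant H T) :
    ∃ V, IsCovariantDilation H T (krausHamiltonian H) (Pi.single none 1) V := by
  set S := krausPartialIsometry T with hSdef
  set p : Matrix (Option (X × X) × X) (Option (X × X) × X) ℂ :=
    ketbra (Pi.single none 1) ⊗ₖ (1 : Matrix X X ℂ) with hp
  set G := totalHamiltonian (krausHamiltonian H) H with hG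
  have hGh : G.IsHermitian := isHermitian_totalHamiltonian (isHermitian_krausHamiltonian hH) hH
  have hS : Sᴴ * S = p := krausPartialIsometry_isometry hcp htp
  have hSp : S * p = S := by
    ext ⟨a, x⟩ ⟨b, x'⟩
    rcases a with _ | r <;> rcases b with _ | s <;>
    simp [S, p, krausPartialIsometry, ketbra, Matrix.mul_apply, Fintype.sum_prod_type,
      Matrix.vecMulVec_apply, Matrix.one_apply]
  have hpS : p * S = 0 := by
    ext ⟨a, x⟩ ⟨b, x'⟩
    rcases a with _ | r <;> rcases b with _ | s <;>
    simp [S, p, krausPartialIsometry, ketbra, Matrix.mul_apply, Fintype.sum_prod_type,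
      Matrix.vecMulVec_apply]
  have hph : pᴴ = p := by rw [← hS]; simp
  have hSp' : p * Sᴴ = Sᴴ := by simpa [hph] using congrArg Matrix.conjTranspose hSp
  have hpS' : Sᴴ * p = 0 := by simpa [hph] using congrArg Matrix.conjTranspose hpS
  have hSS : S * S = 0 := by
    rw [← hSp, mul_assoc, ← mul_assoc p, hpS, zero_mul, mul_zero]
  have hSS' : Sᴴ * Sᴴ = 0 := by simpa using congrArg Matrix.conjTranspose hSS
  have hpp : p * p = p := by
    conv_lhs => enter [1]; rw [← hS]
    rw [mul_assoc, hSp, hS]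
  have hSG : Commute S G := commute_krausPartialIsometry hcov
  have hSG' : Commute Sᴴ G := by
    have := congrArg Matrix.conjTranspose hSG.eq
    rw [Matrix.conjTranspose_mul, Matrix.conjTranspose_mul, hGh.eq] at this
    exact this.symm
  -- S maps the range of p isometrically into its orthogonal complement. So S + S† exchanges the two
  -- subspaces, its square is the projector onto their sum, and K + 1 − K² is a Hermitian unitary
  -- that acts trivially on the rest. As a polynomial in S and S† it commutes with G.
  set K := S + Sᴴ with hK
  have hKh : Kᴴ = K := by simp [K, add_comm]
  have hKK : K * K = S * Sᴴ + p := by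
    simp only [K, add_mul, mul_add, hSS, hSS', hS]; abel
  have hKp : K * p = S := by rw [hK, add_mul, hSp, hpS', add_zero]
  have hKKK : K * (K * K) = K := by
    rw [hKK, mul_add, hKp, hK, add_mul, ← mul_assoc S, hSS, ← mul_assoc, hS, hSp']
    simp [add_comm]
  have hKKKK : K * K * (K * K) = K * K := by rw [mul_assoc, hKKK]
  have hVp : (K + 1 - K * K) * p = S := by
    rw [sub_mul, add_mul, one_mul, hKp, hKK, add_mul, mul_assoc, hpS', hpp]
    simp
  have hVh : (K + 1 - K * K)ᴴ = K + 1 - K * K := by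
    rw [Matrix.conjTranspose_sub, Matrix.conjTranspose_add, Matrix.conjTranspose_mul, hKh,
      Matrix.conjTranspose_one]
  refine ⟨K + 1 - K * K, isHermitian_krausHamiltonian hH, by simp, ?_, ?_, ?_, ?_⟩
  · ext (_ | s) <;> simp [krausHamiltonian]
  · rw [Matrix.mem_unitaryGroup_iff, Matrix.star_eq_conjTranspose, hVh]
    have : K * K * K = K := by rw [mul_assoc, hKKK]
    simp only [sub_mul, mul_sub, add_mul, mul_add, one_mul, mul_one, hKKKK, this, hKKK]
    abel
  · have hKG : Commute K G := hSG.add_left hSG'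
    exact (hKG.add_left (Commute.one_left _)).sub_left (hKG.mul_left hKG)
  · intro A
    have hA : ketbra (Pi.single none 1) ⊗ₖ A = p * (ketbra (Pi.single none 1) ⊗ₖ A) * p := by
      have h1 : ketbra (Pi.single (none : Option (X × X)) (1 : ℂ)) *
          ketbra (Pi.single none 1) = ketbra (Pi.single none 1) := by
        ext a b
        simp [ketbra, Matrix.mul_apply, Matrix.vecMulVec_apply, Pi.single_apply]
      rw [hp, ← Matrix.mul_kronecker_mul, ← Matrix.mul_kronecker_mul, h1, h1, one_mul, mul_one]
    have hout : dilationOutput (Pi.single none 1) (K + 1 - K * K) A =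
        S * (ketbra (Pi.single none 1) ⊗ₖ A) * Sᴴ := by
      rw [dilationOutput, hA]
      conv_rhs => rw [← hVp, Matrix.conjTranspose_mul, hph]
      rw [← hA]
      conv_lhs => rw [hA]
      simp only [mul_assoc]
    rw [hout]
    ext y y'
    rw [map_apply_eq_sum]
    simp only [← kraus_sum hcp]
    have h1 : ∀ q : Option (X × X) × X, ∀ p : Option (X × X) × X,
        (ketbra (Pi.single none 1) ⊗ₖ A) p q = if p.1 = none ∧ q.1 = none then A p.2 q.2 else 0 := by
      intro q p
      simp only [ketbra, Matrix.kroneckerMap_apply, Matrix.vecMulVec_apply, Pi.single_apply,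
        Pi.star_apply, apply_ite star, star_one, star_zero]
      by_cases hp : p.1 = none <;> by_cases hq : q.1 = none <;> simp [hp, hq]
    simp only [traceLeft, LinearMap.coe_mk, AddHom.coe_mk, Matrix.of_apply, Fintype.sum_option,
      Matrix.mul_apply, S, krausPartialIsometry, Matrix.conjTranspose_apply,
      Fintype.sum_prod_type, h1]
    simp only [zero_mul, mul_zero, star_zero, Finset.sum_const_zero, add_zero, zero_add, and_true,
      if_true, reduceCtorEq, and_false, if_false]
    simp only [Finset.mul_sum, Finset.sum_mul]
    conv_lhs => enter [2, x]; rw [Finset.sum_comm]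
    rw [Finset.sum_comm]
    refine Finset.sum_congr rfl fun a _ => ?_
    conv_lhs => enter [2, x]; rw [Finset.sum_comm]
    rw [Finset.sum_comm]
    refine Finset.sum_congr rfl fun b _ => ?_
    rw [Finset.sum_comm]
    exact Finset.sum_congr rfl fun x' _ => Finset.sum_congr rfl fun x _ => by ring

lemma IsCovariantDilation.reindex {E F : Type*} [Fintype E] [DecidableEq E] [Fintype F]
    [DecidableEq F] {H : Matrix X X ℂ} {T : Matrix X X ℂ →ₗ[ℂ] Matrix X X ℂ}
    {HE : Matrix E E ℂ} {e₀ : E → ℂ} {V : Matrix (E × X) (E × X) ℂ}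
    (h : IsCovariantDilation H T HE e₀ V) (f : F ≃ E) :
    IsCovariantDilation H T (HE.submatrix f f) (e₀ ∘ f)
      (V.submatrix (f.prodCongr (Equiv.refl X)) (f.prodCongr (Equiv.refl X))) := by
  set g := f.prodCongr (Equiv.refl X) with hg
  have htot : totalHamiltonian (HE.submatrix f f) H = (totalHamiltonian HE H).submatrix g g := by
    ext ⟨a, x⟩ ⟨b, y⟩
    simp [totalHamiltonian, g, Matrix.one_apply]
  have hket : ∀ A : Matrix X X ℂ,
      ketbra (e₀ ∘ f) ⊗ₖ A = (ketbra e₀ ⊗ₖ A).submatrix g g := by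
    intro A
    ext ⟨a, x⟩ ⟨b, y⟩
    simp [ketbra, g, Matrix.vecMulVec_apply]
  refine ⟨h.isHermitian.submatrix f, ?_, ?_, ?_, ?_, ?_⟩
  · rw [← h.unit]
    exact f.sum_comp (fun i => star (e₀ i) * e₀ i)
  · ext i
    have := congrFun h.zero_energy (f i)
    simp only [Matrix.mulVec, dotProduct, Matrix.submatrix_apply, Function.comp] at this ⊢
    rw [f.sum_comp (fun j => HE (f i) j * e₀ j)]
    exact this
  · have := Matrix.mem_unitaryGroup_iff.1 h.unitary
    rw [Matrix.mem_unitaryGroup_iff, Matrix.star_eq_conjTranspose, Matrix.conjTranspose_submatrix,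
      Matrix.submatrix_mul_equiv, ← Matrix.star_eq_conjTranspose, this, Matrix.submatrix_one_equiv]
  · rw [htot]
    change _ * _ = _ * _
    rw [Matrix.submatrix_mul_equiv, Matrix.submatrix_mul_equiv, h.commute.eq]
  · intro A
    rw [h.dilates A, dilationOutput.eq_1 (e₀ ∘ f), hket, Matrix.conjTranspose_submatrix,
      Matrix.submatrix_mul_equiv, Matrix.submatrix_mul_equiv]
    ext y y'
    simp only [traceLeft, LinearMap.coe_mk, AddHom.coe_mk, Matrix.of_apply, Matrix.submatrix_apply,
      g, Equiv.prodCongr_apply, Prod.map, Equiv.refl_apply]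
    exact (f.sum_comp fun a => dilationOutput e₀ V A (a, y) (a, y')).symm

/-- Every covariant channel has a covariant dilation. -/
lemma exists_isCovariantDilation {H : Matrix X X ℂ} (hH : H.IsHermitian)
    {T : Matrix X X ℂ →ₗ[ℂ] Matrix X X ℂ} (hcp : IsCompletelyPositive T)
    (htp : IsTracePreserving T) (hcov : IsTimeCovariant H T) :
    ∃ (k : ℕ) (HE : Matrix (Fin k) (Fin k) ℂ) (e₀ : Fin k → ℂ)
      (V : Matrix (Fin k × X) (Fin k × X) ℂ), IsCovariantDilation H T HE e₀ V := by
  obtain ⟨V, hV⟩ := exists_isCovariantDilation_option hH hcp htp hcov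
  exact ⟨_, _, _, _, hV.reindex (Fintype.equivFin (Option (X × X))).symm⟩

end CovariantDilation

end QThermo

end

noncomputable section

namespace QThermo

/-! ### From energy-conserving contractions to thermal operations -/

section ThermalOperation

variable {X B : Type*} [Fintype X] [DecidableEq X] [Fintype B] [DecidableEq B]

open scoped Matrix.Norms.Operator in
lemma gibbsWeight_submatrix {C : Type*} [Fintype C] [DecidableEq C] (β : ℝ) (H : Matrix B B ℂ)
    (f : C ≃ B) : gibbsWeight β (H.submatrix f f) = (gibbsWeight β H).submatrix f f := by
  let φ : Matrix B B ℂ →+* Matrix C C ℂ := (Matrix.reindexRingEquiv ℂ f.symm).toRingHom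
  have hφ : ∀ M, φ M = M.submatrix f f := fun M => rfl
  have hcont : Continuous φ := by
    have : (φ : Matrix B B ℂ → Matrix C C ℂ) = fun M => M.submatrix f f := rfl
    rw [this]
    exact continuous_id.matrix_submatrix _ _
  have := NormedSpace.map_exp φ hcont (-(β : ℂ) • H)
  rw [hφ, hφ, Matrix.submatrix_smul] at this
  exact this.symm

lemma gibbsState_submatrix {C : Type*} [Fintype C] [DecidableEq C] (β : ℝ) (H : Matrix B B ℂ)
    (f : C ≃ B) : gibbsState β (H.submatrix f f) = (gibbsState β H).submatrix f f := by
  rw [gibbsState, gibbsWeight_submatrix, gibbsState, Matrix.submatrix_smul]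
  congr 2
  simp only [Matrix.trace, Matrix.diag_apply, Matrix.submatrix_apply]
  exact f.sum_comp fun b => gibbsWeight β H b b

/-- The unitary dilation `K + i √(1 - K²)` of the Hermitian contraction `K` built from a
contraction `C`. -/
lemma exists_unitary_of_contraction {m n : Type*} [Fintype m] [DecidableEq m] [Fintype n]
    [DecidableEq n] {C : Matrix m n ℂ} (hC : (1 - C * Cᴴ).PosSemidef)
    {Hn : Matrix n n ℂ} {Hm : Matrix m m ℂ} (hn : Hn.IsHermitian) (hm : Hm.IsHermitian)
    (hcomm : C * Hn = Hm * C) :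
    ∃ U : Matrix (n ⊕ m) (n ⊕ m) ℂ, U ∈ Matrix.unitaryGroup (n ⊕ m) ℂ ∧
      Commute U (Matrix.fromBlocks Hn 0 0 Hm) ∧ U.toBlocks₂₁ = C := by
  set K : Matrix (n ⊕ m) (n ⊕ m) ℂ := Matrix.fromBlocks 0 Cᴴ C 0 with hK
  have hKK : 1 - K * K = Matrix.fromBlocks (1 - Cᴴ * C) 0 0 (1 - C * Cᴴ) := by
    rw [hK, Matrix.fromBlocks_multiply, ← Matrix.fromBlocks_one, sub_eq_add_neg,
      Matrix.fromBlocks_neg, Matrix.fromBlocks_add]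
    simp [sub_eq_add_neg]
  have hKh : Kᴴ = K := by simp [hK, Matrix.fromBlocks_conjTranspose]
  have hpos : (1 - K * K).PosSemidef := by
    obtain ⟨A, hA⟩ : ∃ A, 1 - Cᴴ * C = Aᴴ * A := ⟨matrixSqrt (1 - Cᴴ * C), by
      rw [(isHermitian_matrixSqrt _).eq,
        matrixSqrt_mul_self (posSemidef_one_sub_conjTranspose_mul hC)]⟩
    obtain ⟨D, hD⟩ : ∃ D, 1 - C * Cᴴ = Dᴴ * D := ⟨matrixSqrt (1 - C * Cᴴ), by
      rw [(isHermitian_matrixSqrt _).eq, matrixSqrt_mul_self hC]⟩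
    have : 1 - K * K = (Matrix.fromBlocks A 0 0 D)ᴴ * Matrix.fromBlocks A 0 0 D := by
      rw [hKK, hA, hD, Matrix.fromBlocks_conjTranspose, Matrix.fromBlocks_multiply]
      simp
    rw [this]
    exact Matrix.posSemidef_conjTranspose_mul_self _
  set R := matrixSqrt (1 - K * K) with hR
  have hRh : Rᴴ = R := isHermitian_matrixSqrt _
  have hRR : R * R = 1 - K * K := matrixSqrt_mul_self hpos
  have hRK : Commute R K :=
    commute_matrixSqrt ((Commute.one_left K).sub_left ((Commute.refl K).mul_left (Commute.refl K)))
  have hKH : Commute K (Matrix.fromBlocks Hn 0 0 Hm) := by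
    have h2 : Cᴴ * Hm = Hn * Cᴴ := by
      have := congrArg Matrix.conjTranspose hcomm
      rw [Matrix.conjTranspose_mul, Matrix.conjTranspose_mul, hn.eq, hm.eq] at this
      exact this.symm
    change K * _ = _ * K
    rw [hK, Matrix.fromBlocks_multiply, Matrix.fromBlocks_multiply]
    simp [hcomm, h2]
  refine ⟨K + Complex.I • R, ?_, ?_, ?_⟩
  · rw [Matrix.mem_unitaryGroup_iff, Matrix.star_eq_conjTranspose, Matrix.conjTranspose_add,
      Matrix.conjTranspose_smul, hKh, hRh]
    simp only [mul_add, add_mul, Matrix.smul_mul, Matrix.mul_smul, smul_smul, hRR, hRK.eq,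
      Complex.star_def, Complex.conj_I, mul_neg, Complex.I_mul_I, neg_smul, one_smul, smul_sub]
    module
  · refine hKH.add_left (Commute.smul_left ?_ _)
    exact commute_matrixSqrt ((Commute.one_left _).sub_left (hKH.mul_left hKH))
  -- R is a function of the block-diagonal 1 − K², so it commutes with the grading and has no
  -- off-diagonal block; the lower left corner of the unitary comes from K alone.
  · set G : Matrix (n ⊕ m) (n ⊕ m) ℂ := Matrix.fromBlocks 1 0 0 (-1) with hG
    have hRG : Commute R G := by
      refine commute_matrixSqrt ?_
      change (1 - K * K) * G = G * (1 - K * K)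
      rw [hKK, hG, Matrix.fromBlocks_multiply, Matrix.fromBlocks_multiply]
      simp
    have h0 : R.toBlocks₂₁ = 0 := by
      have := congrArg Matrix.toBlocks₂₁ hRG.eq
      rw [← Matrix.fromBlocks_toBlocks R, hG, Matrix.fromBlocks_multiply,
        Matrix.fromBlocks_multiply, Matrix.toBlocks_fromBlocks₂₁,
        Matrix.toBlocks_fromBlocks₂₁] at this
      simp only [Matrix.mul_one, Matrix.mul_zero, add_zero, Matrix.zero_mul, zero_add,
        Matrix.neg_mul, Matrix.one_mul] at this
      ext i j
      have hij := congrFun (congrFun this i) j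
      rw [Matrix.neg_apply] at hij
      exact self_eq_neg.1 hij
    ext i j
    have := congrFun (congrFun h0 i) j
    simp only [Matrix.toBlocks₂₁, Matrix.of_apply, Matrix.zero_apply] at this
    simp [Matrix.toBlocks₂₁, hK, this]

/-- The rank and the trace of the diagonal projector on `s` are both the cardinality of `s`. -/
lemma rank_and_trace_diagonal_indicator {ι : Type*} [Fintype ι] [DecidableEq ι] (s : Finset ι) :
    (Matrix.diagonal fun i => if i ∈ s then (1 : ℂ) else 0).rank = s.card ∧
      (Matrix.diagonal fun i => if i ∈ s then (1 : ℂ) else 0).trace = s.card := by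
  classical
  constructor
  · rw [Matrix.rank_diagonal, Fintype.card_subtype]
    congr 1
    ext i
    simp
  · simp [Matrix.trace]

/-- The battery state that is uniform on a set of basis vectors. -/
def indicatorBattery {d : ℕ} (s : Finset (Fin d)) (hs : s.Nonempty) : BatteryState d where
  proj := Matrix.diagonal fun i => if i ∈ s then (1 : ℂ) else 0
  isHermitian := by
    rw [Matrix.IsHermitian, Matrix.diagonal_conjTranspose]
    congr 1
    ext i
    simp only [Pi.star_apply]
    split_ifs <;> simp
  idempotent := by simp [Matrix.diagonal_mul_diagonal]
  ne_zero := by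
    obtain ⟨i, hi⟩ := hs
    intro h
    have := congrFun (congrFun h i) i
    simp [hi] at this

lemma charge_indicatorBattery {d : ℕ} (s : Finset (Fin d)) (hs : s.Nonempty) :
    (indicatorBattery s hs).charge = Real.log d - Real.log s.card := by
  rw [BatteryState.charge, indicatorBattery, (rank_and_trace_diagonal_indicator s).1]

lemma state_indicatorBattery {d : ℕ} (s : Finset (Fin d)) (hs : s.Nonempty) :
    (indicatorBattery s hs).state =
      Matrix.diagonal fun i => if i ∈ s then ((s.card : ℂ))⁻¹ else 0 := by
  rw [BatteryState.state, indicatorBattery, (rank_and_trace_diagonal_indicator s).2]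
  ext i j
  simp only [Matrix.smul_apply, Matrix.diagonal_apply, smul_eq_mul]
  split_ifs <;> simp

/-- Arrangement of the tensor factors of system, battery and bath into battery blocks. -/
def blockEquiv (X : Type*) {B B' : Type*} (f : B' ≃ B) (n L : ℕ) :
    (X × Fin (n + L)) × B' ≃ (Fin n × (B × X)) ⊕ (Fin L × (B × X)) where
  toFun p := (finSumFinEquiv.symm p.1.2).map (fun i => (i, (f p.2, p.1.1)))
    (fun l => (l, (f p.2, p.1.1)))
  invFun q := q.elim (fun r => ((r.2.2, Fin.castAdd L r.1), f.symm r.2.1))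
    (fun r => ((r.2.2, Fin.natAdd n r.1), f.symm r.2.1))
  left_inv := by
    rintro ⟨⟨x, w⟩, b⟩
    refine Fin.addCases (fun i => ?_) (fun l => ?_) w <;> simp
  right_inv := by rintro (⟨i, b, x⟩ | ⟨l, b, x⟩) <;> simp

lemma blockEquiv_castAdd {B' : Type*} (f : B' ≃ B) (n L : ℕ) (x : X) (i : Fin n) (b : B') :
    blockEquiv X f n L ((x, Fin.castAdd L i), b) = Sum.inl (i, (f b, x)) := by
  simp [blockEquiv]

lemma blockEquiv_natAdd {B' : Type*} (f : B' ≃ B) (n L : ℕ) (x : X) (l : Fin L) (b : B') :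
    blockEquiv X f n L ((x, Fin.natAdd n l), b) = Sum.inr (l, (f b, x)) := by
  simp [blockEquiv]

/-- The battery carries no energy, so every battery level sees the same Hamiltonian and energy
conservation can be checked block by block. -/
lemma totalHamiltonian_eq_submatrix {B' : Type*} [DecidableEq B'] (HX : Matrix X X ℂ)
    (HB : Matrix B B ℂ) (f : B' ≃ B) (n L : ℕ) :
    totalHamiltonian (totalHamiltonian HX (0 : Matrix (Fin (n + L)) (Fin (n + L)) ℂ))
      (HB.submatrix f f) =
      (Matrix.fromBlocks ((1 : Matrix (Fin n) (Fin n) ℂ) ⊗ₖ totalHamiltonian HB HX) 0 0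
        ((1 : Matrix (Fin L) (Fin L) ℂ) ⊗ₖ totalHamiltonian HB HX)).submatrix
        (blockEquiv X f n L) (blockEquiv X f n L) := by
  ext ⟨⟨x, w⟩, b⟩ ⟨⟨x', w'⟩, b'⟩
  refine Fin.addCases (fun i => ?_) (fun l => ?_) w <;>
  refine Fin.addCases (fun i' => ?_) (fun l' => ?_) w' <;>
  simp only [Matrix.submatrix_apply, blockEquiv_castAdd, blockEquiv_natAdd,
    Matrix.fromBlocks_apply₁₁, Matrix.fromBlocks_apply₁₂, Matrix.fromBlocks_apply₂₁,
    Matrix.fromBlocks_apply₂₂, totalHamiltonian, Matrix.add_apply, Matrix.kroneckerMap_apply,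
    Matrix.one_apply, Prod.mk.injEq, Matrix.zero_apply, f.injective.eq_iff,
    (Fin.castAdd_injective n L).eq_iff, (Fin.natAdd_injective L n).eq_iff]
  · by_cases h1 : i = i' <;> by_cases h2 : b = b' <;> by_cases h3 : x = x' <;>
      simp [h1, h2, h3, add_comm]
  · have : Fin.castAdd L i ≠ Fin.natAdd n l' := by
      simp [Fin.ext_iff]; omega
    simp [this]
  · have : Fin.natAdd n l ≠ Fin.castAdd L i' := by
      simp [Fin.ext_iff]; omega
    simp [this]
  · by_cases h1 : l = l' <;> by_cases h2 : b = b' <;> by_cases h3 : x = x' <;>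
      simp [h1, h2, h3, add_comm]

/-- A block contraction that commutes with the total Hamiltonian is the effective work process of
a thermal operation. -/
theorem exists_thermalOperation_of_contraction [Nonempty B] (β : ℝ) {HX : Matrix X X ℂ}
    {HB : Matrix B B ℂ} (hX : HX.IsHermitian) (hB : HB.IsHermitian) {n L : ℕ} (hn : 0 < n)
    (hL : 0 < L) (c : Fin L → Fin n → Matrix (B × X) (B × X) ℂ)
    (hcomm : ∀ l i, Commute (c l i) (totalHamiltonian HB HX))
    (hc : (1 - (Matrix.of fun (p : Fin L × (B × X)) (q : Fin n × (B × X)) =>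
      c p.1 q.1 p.2 q.2) * (Matrix.of fun (p : Fin L × (B × X)) (q : Fin n × (B × X)) =>
      c p.1 q.1 p.2 q.2)ᴴ).PosSemidef) :
    ∃ (d : ℕ) (Φ : Matrix (X × Fin d) (X × Fin d) ℂ →ₗ[ℂ] Matrix (X × Fin d) (X × Fin d) ℂ)
      (τ τ' : BatteryState d),
      IsThermalOperation β (totalHamiltonian HX (0 : Matrix (Fin d) (Fin d) ℂ)) Φ ∧
      τ.charge - τ'.charge = Real.log L - Real.log n ∧
      ∀ A, effectiveWorkProcess Φ τ τ' A =
        ∑ l, ∑ i, traceLeft (c l i * (((n : ℂ)⁻¹ • gibbsState β HB) ⊗ₖ A) * (c l i)ᴴ) := by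
  classical
  set C : Matrix (Fin L × (B × X)) (Fin n × (B × X)) ℂ :=
    Matrix.of fun p q => c p.1 q.1 p.2 q.2 with hCdef
  set H := totalHamiltonian HB HX with hH
  have hHh : H.IsHermitian := isHermitian_totalHamiltonian hB hX
  have hone : ∀ k : ℕ, ((1 : Matrix (Fin k) (Fin k) ℂ) ⊗ₖ H).IsHermitian := by
    intro k
    rw [Matrix.IsHermitian, Matrix.conjTranspose_kronecker, hHh.eq, Matrix.conjTranspose_one]
  have hCH : C * ((1 : Matrix (Fin n) (Fin n) ℂ) ⊗ₖ H) =
      ((1 : Matrix (Fin L) (Fin L) ℂ) ⊗ₖ H) * C := by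
    ext ⟨l, p⟩ ⟨i, q⟩
    have := congrFun (congrFun (hcomm l i).eq p) q
    simp only [Matrix.mul_apply] at this
    simp only [Matrix.mul_apply, Fintype.sum_prod_type (α₁ := Fin n),
      Fintype.sum_prod_type (α₁ := Fin L), C, Matrix.of_apply, Matrix.kroneckerMap_apply,
      Matrix.one_apply, ite_mul, mul_ite, one_mul, zero_mul, mul_zero, Finset.sum_ite_irrel,
      Finset.sum_const_zero, Finset.sum_ite_eq, Finset.sum_ite_eq', Finset.mem_univ, if_true]
    exact this
  obtain ⟨U, hU, hUH, hUC⟩ := exists_unitary_of_contraction hc (hone n) (hone L) hCH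
  set f := (Fintype.equivFin B).symm with hf
  set g := blockEquiv X f n L with hg
  set V := U.submatrix g g with hV
  let Φ : Matrix (X × Fin (n + L)) (X × Fin (n + L)) ℂ →ₗ[ℂ]
      Matrix (X × Fin (n + L)) (X × Fin (n + L)) ℂ :=
    { toFun := fun ρ => traceRight (V * (ρ ⊗ₖ gibbsState β (HB.submatrix f f)) * Vᴴ)
      map_add' := fun ρ ρ' => by
        rw [Matrix.add_kronecker, Matrix.mul_add, Matrix.add_mul, map_add]
      map_smul' := fun a ρ => by
        rw [Matrix.smul_kronecker, Matrix.mul_smul, Matrix.smul_mul, map_smul]; rfl }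
  -- The first n battery levels hold the initial state and the last L the final one, so the corner C
  -- of U leads from one to the other. The dimension n + L cancels in the charge difference.
  set s : Finset (Fin (n + L)) := Finset.univ.map (Fin.castAddEmb L) with hs
  set s' : Finset (Fin (n + L)) := Finset.univ.map (Fin.natAddEmb n) with hs'
  have hsne : s.Nonempty := by
    have : Nonempty (Fin n) := ⟨⟨0, hn⟩⟩
    simp [hs, Finset.univ_nonempty]
  have hsne' : s'.Nonempty := by
    have : Nonempty (Fin L) := ⟨⟨0, hL⟩⟩
    simp [hs', Finset.univ_nonempty]
  have hscard : s.card = n := by simp [hs]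
  have hscard' : s'.card = L := by simp [hs']
  refine ⟨n + L, Φ, indicatorBattery s hsne, indicatorBattery s' hsne', ?_, ?_, ?_⟩
  · refine ⟨Fintype.card B, HB.submatrix f f, V, Fintype.card_pos, hB.submatrix _, ?_, ?_,
      fun ρ => rfl⟩
    · have := Matrix.mem_unitaryGroup_iff.1 hU
      rw [Matrix.mem_unitaryGroup_iff, Matrix.star_eq_conjTranspose, Matrix.conjTranspose_submatrix,
        Matrix.submatrix_mul_equiv, ← Matrix.star_eq_conjTranspose, this,
        Matrix.submatrix_one_equiv]
    · rw [totalHamiltonian_eq_submatrix]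
      change _ * _ = _ * _
      rw [Matrix.submatrix_mul_equiv, Matrix.submatrix_mul_equiv, hUH.eq]
  · rw [charge_indicatorBattery, charge_indicatorBattery, hscard, hscard']
    ring
  · intro A
    set M : Matrix (B × X) (B × X) ℂ := ((n : ℂ)⁻¹ • gibbsState β HB) ⊗ₖ A with hM
    set D : Matrix (Fin n × (B × X)) (Fin n × (B × X)) ℂ :=
      (1 : Matrix (Fin n) (Fin n) ℂ) ⊗ₖ M with hD
    set N : Matrix ((Fin n × (B × X)) ⊕ (Fin L × (B × X))) ((Fin n × (B × X)) ⊕ (Fin L × (B × X)))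
      ℂ := Matrix.fromBlocks D 0 0 0 with hN
    have hin : (A ⊗ₖ (indicatorBattery s hsne).state) ⊗ₖ gibbsState β (HB.submatrix f f) =
        N.submatrix g g := by
      rw [state_indicatorBattery, gibbsState_submatrix, hscard]
      ext ⟨⟨x, w⟩, b⟩ ⟨⟨x', w'⟩, b'⟩
      refine Fin.addCases (fun i => ?_) (fun l => ?_) w <;>
      refine Fin.addCases (fun i' => ?_) (fun l' => ?_) w' <;>
      simp only [Matrix.submatrix_apply, g, blockEquiv_castAdd, blockEquiv_natAdd,
        Matrix.fromBlocks_apply₁₁, Matrix.fromBlocks_apply₁₂, Matrix.fromBlocks_apply₂₁,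
        Matrix.fromBlocks_apply₂₂, Matrix.kroneckerMap_apply, Matrix.diagonal_apply,
        Matrix.one_apply, Matrix.zero_apply, N, D, M, Matrix.smul_apply, smul_eq_mul, hs,
        (Fin.castAdd_injective n L).eq_iff]
      · by_cases h : i = i' <;> simp [h]; ring
      · have : Fin.castAdd L i ≠ Fin.natAdd n l' := by
          simp [Fin.ext_iff]; omega
        simp [this]
      · have : Fin.natAdd n l ≠ Fin.castAdd L i' := by
          simp [Fin.ext_iff]; omega
        simp [this]
      · have : ∀ j : Fin n, Fin.castAdd L j ≠ Fin.natAdd n l := by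
          intro j; simp [Fin.ext_iff]; omega
        simp [this]
    have hΦ : Φ (A ⊗ₖ (indicatorBattery s hsne).state) = traceRight
        ((U * N * Uᴴ).submatrix g g) := by
      change traceRight (V * (_ ⊗ₖ gibbsState β (HB.submatrix f f)) * Vᴴ) = _
      rw [hin, hV, Matrix.conjTranspose_submatrix, Matrix.submatrix_mul_equiv,
        Matrix.submatrix_mul_equiv]
    -- The input lives in the first block and the final projector selects the second, so only the
    -- corner C contributes; the uniform battery input makes the sum over i incoherent.
    have hblock : ∀ l p q, (U * N * Uᴴ) (Sum.inr (l, p)) (Sum.inr (l, q)) = ∑ i, (c l i * M * (c l i)ᴴ) p q := by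
      intro l p q
      have h1 : U * N * Uᴴ =
          Matrix.fromBlocks (U.toBlocks₁₁ * D * U.toBlocks₁₁ᴴ)
            (U.toBlocks₁₁ * D * Cᴴ) (C * D * U.toBlocks₁₁ᴴ) (C * D * Cᴴ) := by
        conv_lhs => rw [← Matrix.fromBlocks_toBlocks U, hUC, Matrix.fromBlocks_conjTranspose,
          Matrix.fromBlocks_multiply, Matrix.fromBlocks_multiply]
        simp
      rw [h1, Matrix.fromBlocks_apply₂₂]
      simp only [Matrix.mul_apply, Fintype.sum_prod_type (α₁ := Fin n), C, D, Matrix.of_apply,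
        Matrix.kroneckerMap_apply, Matrix.one_apply, ite_mul, mul_ite, one_mul, zero_mul, mul_zero,
        Finset.sum_ite_irrel, Finset.sum_const_zero, Finset.sum_ite_eq', Finset.mem_univ,
        if_true, Matrix.conjTranspose_apply]
    ext x x'
    have hproj : ∀ N : Matrix (X × Fin (n + L)) (X × Fin (n + L)) ℂ,
        traceRight (((1 : Matrix X X ℂ) ⊗ₖ (indicatorBattery s' hsne').proj) * N) x x' =
          ∑ l : Fin L, N (x, Fin.natAdd n l) (x', Fin.natAdd n l) := by
      intro N
      have h0 : ∀ i : Fin n, ∀ l : Fin L, Fin.natAdd n l ≠ Fin.castAdd L i := by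
        intro i l; simp [Fin.ext_iff]; omega
      simp [traceRight, Matrix.mul_apply, Fintype.sum_prod_type, Matrix.one_apply,
        indicatorBattery, Matrix.diagonal_apply, Fin.sum_univ_add, hs', h0]
    change traceRight (((1 : Matrix X X ℂ) ⊗ₖ (indicatorBattery s' hsne').proj) *
      Φ (A ⊗ₖ (indicatorBattery s hsne).state)) x x' = _
    rw [hproj, hΦ]
    simp only [Matrix.sum_apply]
    refine Finset.sum_congr rfl fun l _ => ?_
    simp only [traceRight, traceLeft, LinearMap.coe_mk, AddHom.coe_mk, Matrix.of_apply,
      Matrix.submatrix_apply, g, blockEquiv_natAdd]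
    simp only [hblock]
    rw [Finset.sum_comm]
    refine Finset.sum_congr rfl fun i _ => ?_
    exact f.sum_comp fun b => (c l i * M * (c l i)ᴴ) (b, x) (b, x')

end ThermalOperation

end QThermo

end

noncomputable section

namespace QThermo

/-! ### Tensor products over many sites -/

section Sites

variable {ι E X : Type*} [Fintype ι] [DecidableEq ι] [Fintype E] [DecidableEq E] [Fintype X]
  [DecidableEq X]

/-- The tensor product of a family of operators. -/
def prodOp (f : ι → Matrix E E ℂ) : Matrix (ι → E) (ι → E) ℂ :=
  Matrix.of fun k k' => ∏ i, f i (k i) (k' i)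

lemma prodOp_mul (f g : ι → Matrix E E ℂ) : prodOp f * prodOp g = prodOp (f * g) := by
  ext k k'
  simp only [Matrix.mul_apply, prodOp, Matrix.of_apply, Pi.mul_apply, ← Finset.prod_mul_distrib]
  rw [Finset.prod_univ_sum, Fintype.piFinset_univ]

lemma prodOp_one : prodOp (1 : ι → Matrix E E ℂ) = 1 := by
  ext k k'
  simp only [prodOp, Matrix.of_apply, Pi.one_apply, Matrix.one_apply]
  split_ifs with h
  · simp [h]
  · obtain ⟨i, hi⟩ := Function.ne_iff.1 h
    exact Finset.prod_eq_zero (Finset.mem_univ i) (if_neg hi)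

lemma prodOp_conjTranspose (f : ι → Matrix E E ℂ) : (prodOp f)ᴴ = prodOp fun i => (f i)ᴴ := by
  ext k k'
  simp [prodOp, Matrix.conjTranspose_apply]

lemma trace_prodOp (f : ι → Matrix E E ℂ) : (prodOp f).trace = ∏ i, (f i).trace := by
  simp only [Matrix.trace, Matrix.diag_apply, prodOp, Matrix.of_apply]
  rw [Finset.prod_univ_sum, Fintype.piFinset_univ]

lemma posSemidef_prodOp {f : ι → Matrix E E ℂ} (hf : ∀ i, (f i).PosSemidef) :
    (prodOp f).PosSemidef := by
  have : prodOp f = (prodOp fun i => matrixSqrt (f i))ᴴ * prodOp fun i => matrixSqrt (f i) := by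
    rw [prodOp_conjTranspose, prodOp_mul]
    congr 1
    funext i
    rw [Pi.mul_apply, (isHermitian_matrixSqrt _).eq, matrixSqrt_mul_self (hf i)]
  rw [this]
  exact Matrix.posSemidef_conjTranspose_mul_self _

lemma sum_prodOp_ite (f g : ι → Matrix E E ℂ) :
    ∑ J : Finset ι, prodOp (fun i => if i ∈ J then f i else g i) = prodOp (f + g) := by
  ext k k'
  simp only [Matrix.sum_apply, prodOp, Matrix.of_apply, Pi.add_apply, Matrix.add_apply]
  rw [Finset.prod_add, Finset.powerset_univ]
  refine Finset.sum_congr rfl fun J _ => ?_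
  have h : ∀ i, (if i ∈ J then f i else g i) (k i) (k' i) =
      if i ∈ J then f i (k i) (k' i) else g i (k i) (k' i) := fun i => by split_ifs <;> rfl
  simp only [h]
  rw [Finset.prod_ite]
  congr 1
  · congr 1; ext; simp
  · congr 1; ext; simp

lemma prodOp_update_apply (f : ι → Matrix E E ℂ) (j : ι) (A : Matrix E E ℂ) (k k' : ι → E) :
    prodOp (Function.update f j A) k k' =
      A (k j) (k' j) * ∏ i ∈ Finset.univ.erase j, f i (k i) (k' i) := by
  rw [prodOp, Matrix.of_apply, ← Finset.mul_prod_erase _ _ (Finset.mem_univ j)]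
  congr 1
  · simp
  · refine Finset.prod_congr rfl fun i hi => ?_
    rw [Function.update_of_ne (Finset.ne_of_mem_erase hi)]

/-- The operator `M` on the `j`-th site and `X`, tensored with `f i` on the other sites. -/
def placed (j : ι) (M : Matrix (E × X) (E × X) ℂ) (f : ι → Matrix E E ℂ) :
    Matrix ((ι → E) × X) ((ι → E) × X) ℂ :=
  Matrix.of fun p q => M (p.1 j, p.2) (q.1 j, q.2) *
    ∏ i ∈ Finset.univ.erase j, f i (p.1 i) (q.1 i)

lemma placed_add (j : ι) (M N : Matrix (E × X) (E × X) ℂ) (f : ι → Matrix E E ℂ) :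
    placed j (M + N) f = placed j M f + placed j N f := by
  ext; simp [placed, add_mul]

lemma placed_sub (j : ι) (M N : Matrix (E × X) (E × X) ℂ) (f : ι → Matrix E E ℂ) :
    placed j (M - N) f = placed j M f - placed j N f := by
  ext; simp [placed, sub_mul]

lemma placed_zero (j : ι) (f : ι → Matrix E E ℂ) :
    placed j (0 : Matrix (E × X) (E × X) ℂ) f = 0 := by
  ext; simp [placed]

lemma placed_kronecker (j : ι) (A : Matrix E E ℂ) (C : Matrix X X ℂ) (f : ι → Matrix E E ℂ) :
    placed j (A ⊗ₖ C) f = prodOp (Function.update f j A) ⊗ₖ C := by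
  ext p q
  rw [Matrix.kroneckerMap_apply, prodOp_update_apply]
  simp only [placed, Matrix.of_apply, Matrix.kroneckerMap_apply]
  ring

/-- Identities linear in an operator on E ⊗ X need only be checked on product operators, for which
`placed` is an ordinary tensor product. -/
lemma kronecker_induction {p : Matrix (E × X) (E × X) ℂ → Prop} (h0 : p 0)
    (hadd : ∀ M N, p M → p N → p (M + N)) (hk : ∀ A C, p (A ⊗ₖ C)) (M : Matrix (E × X) (E × X) ℂ) :
    p M := by
  refine Matrix.induction_on' M h0 hadd fun i j x => ?_
  have : Matrix.single i j x = Matrix.single i.1 j.1 x ⊗ₖ Matrix.single i.2 j.2 1 := by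
    rw [Matrix.single_kronecker_single, mul_one]
  rw [this]
  exact hk _ _

lemma update_mul_update (f g : ι → Matrix E E ℂ) (j : ι) (A C : Matrix E E ℂ) :
    Function.update f j A * Function.update g j C = Function.update (f * g) j (A * C) := by
  ext1 i
  by_cases h : i = j
  · subst h; simp
  · simp [Function.update_of_ne h]

lemma placed_mul (j : ι) (M N : Matrix (E × X) (E × X) ℂ) (f g : ι → Matrix E E ℂ) :
    placed j M f * placed j N g = placed j (M * N) (f * g) := by
  induction M using kronecker_induction with
  | h0 => simp [placed_zero]
  | hadd M M' h h' => rw [placed_add, add_mul, h, h', ← placed_add, add_mul]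
  | hk A C =>
    induction N using kronecker_induction with
    | h0 => simp [placed_zero]
    | hadd N N' h h' => rw [placed_add, mul_add, h, h', ← placed_add, mul_add]
    | hk A' C' =>
      rw [placed_kronecker, placed_kronecker, ← Matrix.mul_kronecker_mul, prodOp_mul,
        ← Matrix.mul_kronecker_mul, placed_kronecker, update_mul_update]

lemma placed_conjTranspose (j : ι) (M : Matrix (E × X) (E × X) ℂ) (f : ι → Matrix E E ℂ) :
    (placed j M f)ᴴ = placed j Mᴴ fun i => (f i)ᴴ := by
  ext
  simp [placed, Matrix.conjTranspose_apply]

lemma placed_one_conjTranspose (j : ι) (M : Matrix (E × X) (E × X) ℂ) :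
    (placed j M 1)ᴴ = placed j Mᴴ 1 := by
  rw [placed_conjTranspose]
  congr 1
  funext i
  simp

lemma prodOp_kronecker (j : ι) (f : ι → Matrix E E ℂ) (C : Matrix X X ℂ) :
    prodOp f ⊗ₖ C = placed j (f j ⊗ₖ C) f := by
  rw [placed_kronecker, Function.update_eq_self]

lemma placed_one (j : ι) : placed j (1 : Matrix (E × X) (E × X) ℂ) 1 = 1 := by
  have := prodOp_kronecker j (1 : ι → Matrix E E ℂ) (1 : Matrix X X ℂ)
  rw [prodOp_one, Matrix.one_kronecker_one, Pi.one_apply, Matrix.one_kronecker_one] at this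
  exact this.symm

lemma trace_prodOp_update (f : ι → Matrix E E ℂ) (j : ι) (A : Matrix E E ℂ) :
    (prodOp (Function.update f j A)).trace =
      A.trace * ∏ i ∈ Finset.univ.erase j, (f i).trace := by
  rw [trace_prodOp, ← Finset.mul_prod_erase _ _ (Finset.mem_univ j)]
  congr 1
  · simp
  · refine Finset.prod_congr rfl fun i hi => ?_
    rw [Function.update_of_ne (Finset.ne_of_mem_erase hi)]

lemma traceLeft_kronecker {A C : Type*} [Fintype A] (M : Matrix A A ℂ) (N : Matrix C C ℂ) :
    traceLeft (M ⊗ₖ N) = M.trace • N := by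
  ext
  simp [traceLeft, Matrix.trace, Finset.sum_mul]

lemma trace_traceLeft {A C : Type*} [Fintype A] [Fintype C] (M : Matrix (A × C) (A × C) ℂ) :
    (traceLeft M).trace = M.trace := by
  simp only [Matrix.trace, traceLeft, LinearMap.coe_mk, AddHom.coe_mk, Matrix.diag_apply,
    Matrix.of_apply, Fintype.sum_prod_type]
  exact Finset.sum_comm

lemma traceLeft_placed (j : ι) (M : Matrix (E × X) (E × X) ℂ) (f : ι → Matrix E E ℂ) :
    traceLeft (placed j M f) = (∏ i ∈ Finset.univ.erase j, (f i).trace) • traceLeft M := by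
  induction M using kronecker_induction with
  | h0 => simp [placed_zero]
  | hadd M M' h h' => rw [placed_add, map_add, h, h', map_add, smul_add]
  | hk A C =>
    rw [placed_kronecker, traceLeft_kronecker, traceLeft_kronecker, trace_prodOp_update, smul_smul,
      mul_comm]

lemma trace_placed (j : ι) (M : Matrix (E × X) (E × X) ℂ) {f : ι → Matrix E E ℂ}
    (hf : ∀ i, (f i).trace = 1) : (placed j M f).trace = M.trace := by
  rw [← trace_traceLeft, traceLeft_placed, Finset.prod_eq_one fun i _ => hf i, one_smul,
    trace_traceLeft]

/-- A site j' other than j is uncorrelated with X, so a test there sees f j' times the marginal of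
M. This is where the second state γ ⊗ ρ_X of the hypothesis test comes from. -/
lemma trace_placed_mul_placed {j j' : ι} (hj : j ≠ j') (Q M : Matrix (E × X) (E × X) ℂ)
    {f : ι → Matrix E E ℂ} (hf : ∀ i, (f i).trace = 1) :
    (placed j' Q 1 * placed j M f).trace = (Q * (f j' ⊗ₖ traceLeft M)).trace := by
  induction M using kronecker_induction with
  | h0 => simp [placed_zero]
  | hadd M M' h h' =>
    rw [placed_add, mul_add, Matrix.trace_add, h, h', map_add, Matrix.kronecker_add, mul_add,
      Matrix.trace_add]
  | hk A C =>
    induction Q using kronecker_induction with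
    | h0 => simp [placed_zero]
    | hadd Q Q' h h' =>
      rw [placed_add, add_mul, Matrix.trace_add, h, h', add_mul, Matrix.trace_add]
    | hk A' C' =>
      rw [placed_kronecker, placed_kronecker, traceLeft_kronecker, ← Matrix.mul_kronecker_mul,
        prodOp_mul, ← Matrix.mul_kronecker_mul, Matrix.trace_kronecker, Matrix.trace_kronecker,
        trace_prodOp, ← Finset.mul_prod_erase _ _ (Finset.mem_univ j'),
        ← Finset.mul_prod_erase _ _ (Finset.mem_erase.2 ⟨hj, Finset.mem_univ j⟩),
        Finset.prod_eq_one]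
      · simp only [Pi.mul_apply, Function.update_self, Function.update_of_ne hj,
          Function.update_of_ne hj.symm, Pi.one_apply, one_mul, mul_one, Matrix.mul_smul,
          Matrix.trace_smul, smul_eq_mul]
        ring
      · intro i hi
        have h1 := Finset.ne_of_mem_erase hi
        have h2 := Finset.ne_of_mem_erase (Finset.mem_of_mem_erase hi)
        simp [Function.update_of_ne h1, Function.update_of_ne h2, hf]

lemma posSemidef_placed_one (j : ι) {M : Matrix (E × X) (E × X) ℂ} (hM : M.PosSemidef) :
    (placed j M 1).PosSemidef := by
  have : placed j M 1 = (placed j (matrixSqrt M) 1)ᴴ * placed j (matrixSqrt M) 1 := by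
    rw [placed_one_conjTranspose, placed_mul, (isHermitian_matrixSqrt M).eq,
      matrixSqrt_mul_self hM, mul_one]
  rw [this]
  exact Matrix.posSemidef_conjTranspose_mul_self _

lemma placed_mem_unitaryGroup (j : ι) {V : Matrix (E × X) (E × X) ℂ}
    (hV : V ∈ Matrix.unitaryGroup (E × X) ℂ) :
    placed j V 1 ∈ Matrix.unitaryGroup ((ι → E) × X) ℂ := by
  rw [Matrix.mem_unitaryGroup_iff, Matrix.star_eq_conjTranspose] at hV ⊢
  rw [placed_one_conjTranspose, placed_mul, hV, mul_one, placed_one]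

/-- The Hamiltonian of noninteracting copies of a system with Hamiltonian `H`. -/
def bathHamiltonian (ι : Type*) [Fintype ι] [DecidableEq ι] (H : Matrix E E ℂ) :
    Matrix (ι → E) (ι → E) ℂ :=
  ∑ i, prodOp (Function.update 1 i H)

lemma isHermitian_bathHamiltonian {H : Matrix E E ℂ} (hH : H.IsHermitian) :
    (bathHamiltonian ι H).IsHermitian := by
  rw [Matrix.IsHermitian, bathHamiltonian, Matrix.conjTranspose_sum]
  refine Finset.sum_congr rfl fun i _ => ?_
  rw [prodOp_conjTranspose]
  congr 1
  funext j
  by_cases h : j = i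
  · subst h; simp [hH.eq]
  · simp [Function.update_of_ne h]

lemma prodOp_kronecker_one_of_eq_one {j : ι} {f : ι → Matrix E E ℂ} (hf : f j = 1) :
    prodOp f ⊗ₖ (1 : Matrix X X ℂ) = placed j 1 f := by
  rw [prodOp_kronecker j, hf, Matrix.one_kronecker_one]

/-- The Hamiltonian is that of site j and X plus terms supported on the other sites. -/
lemma commute_placed (j : ι) {M : Matrix (E × X) (E × X) ℂ} {HE : Matrix E E ℂ}
    {HX : Matrix X X ℂ} (h : Commute M (totalHamiltonian HE HX)) :
    Commute (placed j M 1) (totalHamiltonian (bathHamiltonian ι HE) HX) := by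
  have h1 : totalHamiltonian (bathHamiltonian ι HE) HX = placed j (totalHamiltonian HE HX) 1 +
      ∑ i ∈ Finset.univ.erase j, prodOp (Function.update 1 i HE) ⊗ₖ (1 : Matrix X X ℂ) := by
    rw [totalHamiltonian, bathHamiltonian, ← Finset.add_sum_erase _ _ (Finset.mem_univ j),
      Matrix.add_kronecker, totalHamiltonian, placed_add, placed_kronecker, placed_kronecker,
      show Function.update (1 : ι → Matrix E E ℂ) j 1 = 1 from Function.update_eq_self _ _,
      prodOp_one]
    have : (∑ i ∈ Finset.univ.erase j, prodOp (Function.update 1 i HE)) ⊗ₖ (1 : Matrix X X ℂ) =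
      ∑ i ∈ Finset.univ.erase j, prodOp (Function.update 1 i HE) ⊗ₖ (1 : Matrix X X ℂ) := by
      ext p q
      simp only [Matrix.kroneckerMap_apply, Matrix.sum_apply, Finset.sum_mul]
    rw [this]
    abel
  rw [h1]
  refine Commute.add_right ?_ (Commute.sum_right _ _ _ fun i hi => ?_)
  · change _ * _ = _ * _
    rw [placed_mul, placed_mul, h.eq]
  · rw [prodOp_kronecker_one_of_eq_one (j := j)
      (by rw [Function.update_of_ne (Finset.ne_of_mem_erase hi).symm]; rfl)]
    change _ * _ = _ * _
    rw [placed_mul, placed_mul, mul_one, one_mul, mul_one, one_mul]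

lemma commute_prodOp {f : ι → Matrix E E ℂ} {HE : Matrix E E ℂ} (HX : Matrix X X ℂ)
    (h : ∀ i, Commute (f i) HE) :
    Commute (prodOp f ⊗ₖ (1 : Matrix X X ℂ)) (totalHamiltonian (bathHamiltonian ι HE) HX) := by
  refine Commute.add_right ?_ ?_
  · change _ * _ = _ * _
    rw [← Matrix.mul_kronecker_mul, ← Matrix.mul_kronecker_mul]
    congr 1
    refine Commute.sum_right _ _ _ fun i _ => ?_
    change _ * _ = _ * _
    rw [prodOp_mul, prodOp_mul]
    congr 1
    funext j
    by_cases hj : j = i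
    · subst hj; simp [(h j).eq]
    · simp [Function.update_of_ne hj]
  · change _ * _ = _ * _
    rw [← Matrix.mul_kronecker_mul, ← Matrix.mul_kronecker_mul]
    simp

/-- The operator `A` on the `j`-th site. -/
def siteHom (j : ι) : Matrix E E ℂ →+* Matrix (ι → E) (ι → E) ℂ where
  toFun A := prodOp (Function.update 1 j A)
  map_one' := by
    rw [show Function.update (1 : ι → Matrix E E ℂ) j 1 = 1 from Function.update_eq_self _ _,
      prodOp_one]
  map_mul' A C := by rw [prodOp_mul, update_mul_update, mul_one]
  map_zero' := by ext; simp [prodOp_update_apply]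
  map_add' A C := by ext; simp [prodOp_update_apply, add_mul]

lemma continuous_siteHom (j : ι) : Continuous (siteHom (E := E) j) := by
  refine continuous_matrix fun k k' => ?_
  change Continuous fun A : Matrix E E ℂ => prodOp (Function.update 1 j A) k k'
  simp only [prodOp_update_apply]
  fun_prop

open scoped Matrix.Norms.Operator in
lemma exp_siteHom (j : ι) (A : Matrix E E ℂ) :
    NormedSpace.exp (siteHom j A) = siteHom j (NormedSpace.exp A) :=
  (NormedSpace.map_exp (siteHom j) (continuous_siteHom j) A).symm

/-- The site Hamiltonians commute, so the exponential factorizes one site at a time; this makes the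
thermal state of the bath a product. -/
lemma exp_sum_siteHom (A : Matrix E E ℂ) (s : Finset ι) :
    NormedSpace.exp (∑ j ∈ s, siteHom j A) =
      prodOp fun j => if j ∈ s then NormedSpace.exp A else 1 := by
  induction s using Finset.induction_on with
  | empty =>
    simp only [Finset.sum_empty, NormedSpace.exp_zero, Finset.notMem_empty, if_false]
    exact prodOp_one.symm
  | insert i s hi ih =>
    have hcomm : Commute (siteHom i A) (∑ j ∈ s, siteHom j A) := by
      refine Commute.sum_right _ _ _ fun j hj => ?_
      have hij : j ≠ i := fun h => hi (h ▸ hj)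
      change prodOp _ * prodOp _ = prodOp _ * prodOp _
      rw [prodOp_mul, prodOp_mul]
      congr 1
      funext k
      by_cases h1 : k = i
      · subst h1; simp [Function.update_of_ne hij.symm]
      · simp [Function.update_of_ne h1]
    rw [Finset.sum_insert hi, Matrix.exp_add_of_commute _ _ hcomm, ih, exp_siteHom]
    change prodOp _ * prodOp _ = _
    rw [prodOp_mul]
    congr 1
    funext k
    by_cases h1 : k = i
    · subst h1; simp [hi]
    · simp [h1]

lemma gibbsState_bathHamiltonian (β : ℝ) (H : Matrix E E ℂ) :
    gibbsState β (bathHamiltonian ι H) = prodOp fun _ => gibbsState β H := by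
  have hw : gibbsWeight β (bathHamiltonian ι H) = prodOp fun _ => gibbsWeight β H := by
    have h1 : -(β : ℂ) • bathHamiltonian ι H = ∑ j, siteHom j (-(β : ℂ) • H) := by
      rw [bathHamiltonian, Finset.smul_sum]
      refine Finset.sum_congr rfl fun j _ => ?_
      ext k k'
      change _ = prodOp (Function.update 1 j (-(β : ℂ) • H)) k k'
      rw [Matrix.smul_apply, prodOp_update_apply, prodOp_update_apply, Matrix.smul_apply,
        smul_eq_mul, smul_eq_mul, mul_assoc]
    rw [gibbsWeight, h1, exp_sum_siteHom]
    simp [gibbsWeight]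
  rw [gibbsState, hw, trace_prodOp]
  ext k k'
  simp [prodOp, gibbsState, Finset.prod_mul_distrib]

end Sites

end QThermo

end

noncomputable section

namespace QThermo

/-! ### Fidelity from overlaps of Kraus operators -/

section KrausFidelity

variable {X : Type*} [Fintype X] [DecidableEq X]

/-- The columns `(Sₖ ⊗ 1) ψ`. -/
def krausColumns {K R : Type*} (S : K → Matrix X X ℂ) (ψ : X × R → ℂ) : Matrix (X × R) K ℂ :=
  Matrix.of fun p k => ∑ x, S k p.1 x * ψ (x, p.2)

/-- The Kraus index plays the role of a purifying system, which puts the output into the form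
required by `re_trace_le_fidelity`. -/
lemma ampliate_eq_krausColumns {K R : Type*} [Fintype K] (S : K → Matrix X X ℂ)
    (ψ : X × R → ℂ) {T : Matrix X X ℂ →ₗ[ℂ] Matrix X X ℂ}
    (hT : ∀ A, T A = ∑ k, S k * A * (S k)ᴴ) :
    ampliate T R (ketbra ψ) = krausColumns S ψ * (krausColumns S ψ)ᴴ := by
  ext ⟨x, r⟩ ⟨x', r'⟩
  simp only [ampliate, hT, Matrix.of_apply, Matrix.sum_apply, Matrix.mul_apply,
    Matrix.conjTranspose_apply, krausColumns, ketbra, Matrix.vecMulVec_apply, Pi.star_apply,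
    star_sum, star_mul']
  refine Finset.sum_congr rfl fun k _ => ?_
  rw [Finset.sum_mul_sum, Finset.sum_comm]
  simp only [Finset.sum_mul]
  exact Finset.sum_congr rfl fun _ _ => Finset.sum_congr rfl fun _ _ => by ring

/-- The overlap depends on ψ only through σ, which makes the final bound uniform in the reference
and the purification. -/
lemma trace_krausColumns {K R : Type*} [Fintype K] [Fintype R] (S S' : K → Matrix X X ℂ)
    {σ : Matrix X X ℂ} {ψ : X × R → ℂ} (hψ : IsPurification σ ψ) :
    ((krausColumns S' ψ)ᴴ * krausColumns S ψ).trace = ∑ k, ((S' k)ᴴ * S k * σ).trace := by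
  have hσ : ∀ x x', σ x x' = ∑ r, ψ (x, r) * star (ψ (x', r)) := by
    intro x x'
    rw [← hψ]
    simp [traceRight, ketbra, Matrix.vecMulVec_apply]
  simp only [Matrix.trace, Matrix.diag_apply]
  refine Finset.sum_congr rfl fun k _ => ?_
  simp only [Matrix.mul_apply, Matrix.conjTranspose_apply, krausColumns, Matrix.of_apply, hσ,
    Fintype.sum_prod_type, star_sum, star_mul']
  simp only [Finset.sum_mul, Finset.mul_sum]
  calc _ = ∑ y, ∑ x₂, ∑ r, ∑ x₁,
        star (S' k y x₁) * star (ψ (x₁, r)) * (S k y x₂ * ψ (x₂, r)) :=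
        Finset.sum_congr rfl fun y _ => Finset.sum_comm
    _ = ∑ y, ∑ x₂, ∑ x₁, ∑ r,
        star (S' k y x₁) * star (ψ (x₁, r)) * (S k y x₂ * ψ (x₂, r)) :=
        Finset.sum_congr rfl fun y _ => Finset.sum_congr rfl fun x₂ _ => Finset.sum_comm
    _ = ∑ y, ∑ x₁, ∑ x₂, ∑ r,
        star (S' k y x₁) * star (ψ (x₁, r)) * (S k y x₂ * ψ (x₂, r)) :=
        Finset.sum_congr rfl fun y _ => Finset.sum_comm
    _ = ∑ x₁, ∑ y, ∑ x₂, ∑ r,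
        star (S' k y x₁) * star (ψ (x₁, r)) * (S k y x₂ * ψ (x₂, r)) := Finset.sum_comm
    _ = ∑ x₁, ∑ x₂, ∑ y, ∑ r,
        star (S' k y x₁) * star (ψ (x₁, r)) * (S k y x₂ * ψ (x₂, r)) :=
        Finset.sum_congr rfl fun x₁ _ => Finset.sum_comm
    _ = _ := by
      refine Finset.sum_congr rfl fun x₁ _ => Finset.sum_congr rfl fun x₂ _ => ?_
      rw [Finset.sum_comm]
      exact Finset.sum_congr rfl fun _ _ => Finset.sum_congr rfl fun _ _ => by ring

/-- Fidelity of two maps in Kraus form on a purification of `σ`; the second one may be only a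
fraction of the target. -/
lemma re_sum_trace_le_fidelity_ampliate {K K₀ R : Type*} [Fintype K] [DecidableEq K] [Fintype K₀]
    [Fintype R] [DecidableEq R] {S S' : K → Matrix X X ℂ} {S₀ : K₀ → Matrix X X ℂ}
    {T₁ T : Matrix X X ℂ →ₗ[ℂ] Matrix X X ℂ} (h₁ : ∀ A, T₁ A = ∑ k, S k * A * (S k)ᴴ)
    (h₀ : ∀ A, T A = ∑ k, S₀ k * A * (S₀ k)ᴴ) {w : ℝ} (hw : w ≤ 1)
    (h : ∀ A, ∑ k, S' k * A * (S' k)ᴴ = (w : ℂ) • T A)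
    {σ : Matrix X X ℂ} {ψ : X × R → ℂ} (hψ : IsPurification σ ψ) :
    (∑ k, ((S' k)ᴴ * S k * σ).trace).re ≤
      fidelity (ampliate T₁ R (ketbra ψ)) (ampliate T R (ketbra ψ)) := by
  have hpos : (ampliate T R (ketbra ψ)).PosSemidef := by
    rw [ampliate_eq_krausColumns S₀ ψ h₀]
    exact Matrix.posSemidef_self_mul_conjTranspose _
  have hpos₁ : (ampliate T₁ R (ketbra ψ)).PosSemidef := by
    rw [ampliate_eq_krausColumns S ψ h₁]
    exact Matrix.posSemidef_self_mul_conjTranspose _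
  rw [← trace_krausColumns S S' hψ]
  refine re_trace_le_fidelity hpos₁ hpos ?_ ?_
  · rw [ampliate_eq_krausColumns S ψ h₁, sub_self]
    exact Matrix.PosSemidef.zero
  -- The family S' realizes only the fraction w of T, so the columns satisfy an operator inequality
  -- instead of an equality.
  · rw [← ampliate_eq_krausColumns (T := (w : ℂ) • T) S' ψ (fun A => (h A).symm)]
    have : ampliate T R (ketbra ψ) - ampliate ((w : ℂ) • T) R (ketbra ψ) =
        (1 - w) • ampliate T R (ketbra ψ) := by
      ext p q
      simp [ampliate, sub_mul]
    rw [this]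
    exact hpos.smul (by linarith)

variable {B : Type*} [Fintype B] [DecidableEq B]

/-- The Kraus operators of `A ↦ tr_B [c (g ⊗ A) c†]`. -/
def bathKraus (c : Matrix (B × X) (B × X) ℂ) (g : Matrix B B ℂ) (b b' : B) : Matrix X X ℂ :=
  Matrix.of fun x x' => (c * (matrixSqrt g ⊗ₖ (1 : Matrix X X ℂ))) (b, x) (b', x')

/-- One factor √g is absorbed into the interaction on each side, leaving an identity on the bath to
be expanded in the standard basis. No normalization of g enters. -/
lemma traceLeft_eq_bathKraus (c : Matrix (B × X) (B × X) ℂ) {g : Matrix B B ℂ}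
    (hg : g.PosSemidef) (A : Matrix X X ℂ) :
    traceLeft (c * (g ⊗ₖ A) * cᴴ) =
      ∑ b, ∑ b', bathKraus c g b b' * A * (bathKraus c g b b')ᴴ := by
  have h : c * (g ⊗ₖ A) * cᴴ = (c * (matrixSqrt g ⊗ₖ (1 : Matrix X X ℂ))) *
      ((1 : Matrix B B ℂ) ⊗ₖ A) * (c * (matrixSqrt g ⊗ₖ (1 : Matrix X X ℂ)))ᴴ := by
    rw [Matrix.conjTranspose_mul, Matrix.conjTranspose_kronecker, (isHermitian_matrixSqrt g).eq,
      Matrix.conjTranspose_one]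
    conv_lhs => rw [← matrixSqrt_mul_self hg]
    simp only [mul_assoc]
    rw [← mul_assoc (matrixSqrt g ⊗ₖ (1 : Matrix X X ℂ)), ← Matrix.mul_kronecker_mul,
      ← mul_assoc (_ ⊗ₖ _) (_ ⊗ₖ _) cᴴ, ← Matrix.mul_kronecker_mul]
    simp
  rw [h]
  ext x x'
  simp only [traceLeft, LinearMap.coe_mk, AddHom.coe_mk, Matrix.of_apply, Matrix.sum_apply,
    bathKraus]
  refine Finset.sum_congr rfl fun b _ => ?_
  generalize c * (matrixSqrt g ⊗ₖ (1 : Matrix X X ℂ)) = D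
  simp only [Matrix.mul_apply, Fintype.sum_prod_type, Matrix.kroneckerMap_apply, Matrix.one_apply,
    ite_mul, mul_ite, one_mul, zero_mul, mul_zero, Finset.sum_ite_irrel, Finset.sum_const_zero,
    Finset.sum_ite_eq', Finset.mem_univ, if_true, Matrix.conjTranspose_apply, Matrix.of_apply]

lemma sum_trace_bathKraus (c d : Matrix (B × X) (B × X) ℂ) {g : Matrix B B ℂ}
    (hg : g.PosSemidef) (σ : Matrix X X ℂ) :
    ∑ b, ∑ b', ((bathKraus d g b b')ᴴ * bathKraus c g b b' * σ).trace =
      (dᴴ * c * (g ⊗ₖ σ)).trace := by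
  have h : (dᴴ * c * (g ⊗ₖ σ)).trace = ((d * (matrixSqrt g ⊗ₖ (1 : Matrix X X ℂ)))ᴴ *
      (c * (matrixSqrt g ⊗ₖ (1 : Matrix X X ℂ))) * ((1 : Matrix B B ℂ) ⊗ₖ σ)).trace := by
    rw [Matrix.conjTranspose_mul, Matrix.conjTranspose_kronecker, (isHermitian_matrixSqrt g).eq,
      Matrix.conjTranspose_one]
    conv_rhs => rw [mul_assoc, mul_assoc, Matrix.trace_mul_comm]
    conv_lhs => rw [← matrixSqrt_mul_self hg]
    simp only [mul_assoc]
    rw [← Matrix.mul_kronecker_mul, ← Matrix.mul_kronecker_mul]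
    simp
  rw [h]
  simp only [bathKraus]
  generalize c * (matrixSqrt g ⊗ₖ (1 : Matrix X X ℂ)) = C
  generalize d * (matrixSqrt g ⊗ₖ (1 : Matrix X X ℂ)) = D
  simp only [Matrix.trace, Matrix.diag_apply, Matrix.mul_apply, Fintype.sum_prod_type,
    Matrix.kroneckerMap_apply, Matrix.one_apply,
    ite_mul, mul_ite, one_mul, zero_mul, mul_zero, Finset.sum_ite_irrel, Finset.sum_const_zero,
    Finset.sum_ite_eq', Finset.mem_univ, if_true, Matrix.conjTranspose_apply, Matrix.of_apply,
    Finset.sum_mul]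
  rw [Finset.sum_comm]
  refine Finset.sum_congr rfl fun b' _ => ?_
  rw [Finset.sum_comm]
  refine Finset.sum_congr rfl fun x _ => ?_
  rw [Finset.sum_comm]

/-- Fidelity on a purification of `σ` of two maps that consist in interactions `c k`, `d k` with
baths in (non-normalized) states `g k`. -/
lemma re_sum_trace_le_fidelity {K R E : Type*} [Fintype K] [DecidableEq K] [Fintype R]
    [DecidableEq R] [Fintype E] [DecidableEq E] {c d : K → Matrix (B × X) (B × X) ℂ}
    {g : K → Matrix B B ℂ} (hg : ∀ k, (g k).PosSemidef) {V : Matrix (E × X) (E × X) ℂ}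
    {p : Matrix E E ℂ} (hp : p.PosSemidef)
    {T₁ T : Matrix X X ℂ →ₗ[ℂ] Matrix X X ℂ}
    (h₁ : ∀ A, T₁ A = ∑ k, traceLeft (c k * (g k ⊗ₖ A) * (c k)ᴴ))
    (h₀ : ∀ A, T A = traceLeft (V * (p ⊗ₖ A) * Vᴴ)) {w : ℝ} (hw : w ≤ 1)
    (h : ∀ A, ∑ k, traceLeft (d k * (g k ⊗ₖ A) * (d k)ᴴ) = (w : ℂ) • T A)
    {σ : Matrix X X ℂ} {ψ : X × R → ℂ} (hψ : IsPurification σ ψ) :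
    (∑ k, ((d k)ᴴ * c k * (g k ⊗ₖ σ)).trace).re ≤
      fidelity (ampliate T₁ R (ketbra ψ)) (ampliate T R (ketbra ψ)) := by
  have := re_sum_trace_le_fidelity_ampliate (K := K × B × B) (K₀ := E × E)
    (S := fun k => bathKraus (c k.1) (g k.1) k.2.1 k.2.2)
    (S' := fun k => bathKraus (d k.1) (g k.1) k.2.1 k.2.2)
    (S₀ := fun k => bathKraus V p k.1 k.2) (T₁ := T₁) (T := T)
    (fun A => by
      simp only [Fintype.sum_prod_type, h₁]
      exact Finset.sum_congr rfl fun k _ => traceLeft_eq_bathKraus _ (hg k) A)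
    (fun A => by
      simp only [Fintype.sum_prod_type, h₀]
      exact traceLeft_eq_bathKraus _ hp A) hw
    (fun A => by
      rw [← h A]
      simp only [Fintype.sum_prod_type]
      exact Finset.sum_congr rfl fun k _ => (traceLeft_eq_bathKraus _ (hg k) A).symm) hψ
  refine le_trans (le_of_eq ?_) this
  congr 1
  simp only [Fintype.sum_prod_type]
  exact Finset.sum_congr rfl fun k _ => (sum_trace_bathKraus _ _ (hg k) σ).symm

end KrausFidelity

/-! ### Energy-conserving tests -/

section Pinching

variable {n : Type*} [Fintype n] [DecidableEq n]

/-- A test can be replaced by one that commutes with the Hamiltonian, without affecting the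
outcome probabilities on states that commute with it. -/
lemma exists_commuting_test {G Q : Matrix n n ℂ} (hG : G.IsHermitian) (hQ : Q.PosSemidef)
    (hQ1 : (1 - Q).PosSemidef) :
    ∃ Q' : Matrix n n ℂ, Q'.PosSemidef ∧ (1 - Q').PosSemidef ∧ Commute Q' G ∧
      ∀ ρ, Commute ρ G → (Q' * ρ).trace = (Q * ρ).trace := by
  classical
  let s : Finset ℝ := (Matrix.finite_real_spectrum (A := G)).toFinset
  have hs : ∀ x ∈ spectrum ℝ G, x ∈ s := fun x hx => by simpa [s] using hx
  -- Spectral projectors of G; the new test is the pinching ∑ P Q P.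
  let P : ℝ → Matrix n n ℂ := fun a => cfc (fun x : ℝ => if x = a then (1 : ℝ) else 0) G
  have hPh : ∀ a, (P a)ᴴ = P a := fun a => isHermitian_cfc _ G
  have hPP : ∀ a, P a * P a = P a := by
    intro a
    change cfc _ G * cfc _ G = cfc _ G
    rw [← cfc_mul_matrix]
    congr 1
    funext x
    split_ifs <;> simp
  have hGP : ∀ a, G * P a = a • P a := by
    intro a
    conv_lhs => enter [1]; rw [← cfc_id' ℝ G hG.isSelfAdjoint]
    change cfc _ G * cfc _ G = a • cfc _ G
    rw [← cfc_mul_matrix, ← cfc_smul _ _ _ (continuousOn_matrix_spectrum G _)]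
    congr 1
    funext x
    split_ifs with h <;> simp [h]
  have hPG : ∀ a, P a * G = a • P a := by
    intro a
    have := congrArg Matrix.conjTranspose (hGP a)
    rw [Matrix.conjTranspose_mul, hPh, hG.eq, Matrix.conjTranspose_smul, hPh] at this
    simpa using this
  have hsum : ∑ a ∈ s, P a = 1 := by
    change ∑ a ∈ s, cfc _ G = 1
    rw [← cfc_sum _ _ _ (fun a _ => continuousOn_matrix_spectrum G _), ← cfc_one ℝ G
      hG.isSelfAdjoint]
    refine cfc_congr fun x hx => ?_
    simp [Finset.sum_ite_eq, hs x hx]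
  have hconj : ∀ A : Matrix n n ℂ, A.PosSemidef → (∑ a ∈ s, P a * A * P a).PosSemidef := by
    intro A hA
    refine Matrix.posSemidef_sum s fun a _ => ?_
    have := hA.mul_mul_conjTranspose_same (P a)
    rwa [hPh] at this
  refine ⟨∑ a ∈ s, P a * Q * P a, hconj Q hQ, ?_, ?_, ?_⟩
  · have : 1 - ∑ a ∈ s, P a * Q * P a = ∑ a ∈ s, P a * (1 - Q) * P a := by
      simp only [mul_sub, sub_mul, mul_one, hPP, Finset.sum_sub_distrib, hsum]
    rw [this]
    exact hconj _ hQ1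
  · refine Commute.sum_left _ _ _ fun a _ => ?_
    change _ * _ = _ * _
    rw [mul_assoc, hPG, ← mul_assoc, ← mul_assoc, hGP, Matrix.mul_smul, Matrix.smul_mul,
      Matrix.smul_mul]
  · intro ρ hρ
    have hc : ∀ a, P a * ρ = ρ * P a := fun a => (hρ.symm.cfc_real _).eq
    calc ((∑ a ∈ s, P a * Q * P a) * ρ).trace = ∑ a ∈ s, (P a * Q * P a * ρ).trace := by
          rw [Finset.sum_mul, Matrix.trace_sum]
      _ = ∑ a ∈ s, (Q * ρ * P a).trace := by
          refine Finset.sum_congr rfl fun a _ => ?_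
          rw [mul_assoc (P a), mul_assoc (P a), Matrix.trace_mul_comm, mul_assoc Q (P a), hc a,
            mul_assoc, mul_assoc, hPP, ← mul_assoc]
      _ = (Q * ρ).trace := by
          rw [← Matrix.trace_sum, ← Finset.mul_sum, hsum, mul_one]

end Pinching

/-! ### The lower tail of the binomial distribution -/

section Binomial

/-- Grouping the subsets by cardinality gives the variance identity for Bernstein polynomials. -/
lemma sum_binomial_variance {ι : Type*} [Fintype ι] [DecidableEq ι] (z : ℝ) :
    ∑ J : Finset ι, z ^ J.card * (1 - z) ^ (Fintype.card ι - J.card) *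
      ((J.card : ℝ) - Fintype.card ι * z) ^ 2 = Fintype.card ι * z * (1 - z) := by
  have h := congrArg (Polynomial.eval z) (bernsteinPolynomial.variance ℝ (Fintype.card ι))
  simp only [Polynomial.eval_finsetSum, bernsteinPolynomial, Polynomial.eval_mul,
    Polynomial.eval_pow, Polynomial.eval_sub, Polynomial.eval_X,
    Polynomial.eval_natCast, Polynomial.eval_one, nsmul_eq_mul] at h
  rw [← h, ← Finset.powerset_univ, Finset.sum_powerset_apply_card (fun m => z ^ m *
    (1 - z) ^ (Fintype.card ι - m) * ((m : ℝ) - Fintype.card ι * z) ^ 2), Finset.card_univ]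
  refine Finset.sum_congr rfl fun m _ => ?_
  rw [nsmul_eq_mul]
  ring

/-- Chebyshev's inequality for the lower tail of the binomial distribution, with the parameters
chosen large enough. -/
lemma exists_binomial_tail_le {z c δ : ℝ} (hz : 0 < z) (hz1 : z ≤ 1) (hc : 1 < c) (hδ : 0 < δ)
    {M : ℕ} (hM : 0 < M) :
    ∃ L n : ℕ, 0 < L ∧ 0 < n ∧ (L * M : ℝ) * z ≤ c * n ∧
      ∑ J : Finset (Fin L × Fin M), (if J.card < n then
        z ^ J.card * (1 - z) ^ (Fintype.card (Fin L × Fin M) - J.card) else 0) ≤ δ := by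
  have hc0 : 0 < c := by linarith
  set a : ℝ := 1 - c⁻¹ with ha
  have ha0 : 0 < a := by
    have := inv_lt_one_of_one_lt₀ hc
    linarith
  -- With n = ⌈Nz/c⌉, having fewer than n elements is a deviation of at least t = Nza from the mean
  -- Nz. Chebyshev bounds its probability by (1 − z)/(Nza²), which is at most δ because N ≥ L.
  obtain ⟨L, hL⟩ := exists_nat_gt (1 / (δ * z * a ^ 2))
  have hLpos : (0 : ℝ) < L := lt_trans (by positivity) hL
  have hMpos : (1 : ℝ) ≤ M := by exact_mod_cast hM
  set N : ℝ := L * M with hN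
  have hNpos : 0 < N := by positivity
  have hLN : (L : ℝ) ≤ N := by nlinarith
  refine ⟨L, ⌈N * z / c⌉₊, by exact_mod_cast hLpos, Nat.ceil_pos.2 (by positivity), ?_, ?_⟩
  · have := Nat.le_ceil (N * z / c)
    rw [div_le_iff₀ hc0] at this
    linarith
  · have hcard : ((Fintype.card (Fin L × Fin M) : ℕ) : ℝ) = N := by simp [hN]
    have hvar := sum_binomial_variance (ι := Fin L × Fin M) z
    rw [hcard] at hvar
    set t := N * z * a with ht
    have htpos : 0 < t := by positivity
    have h1z : 0 ≤ 1 - z := by linarith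
    have hle : ∀ J : Finset (Fin L × Fin M), (if J.card < ⌈N * z / c⌉₊ then
        z ^ J.card * (1 - z) ^ (Fintype.card (Fin L × Fin M) - J.card) else 0) ≤
        (z ^ J.card * (1 - z) ^ (Fintype.card (Fin L × Fin M) - J.card) *
          ((J.card : ℝ) - N * z) ^ 2) / t ^ 2 := by
      intro J
      have hw : 0 ≤ z ^ J.card * (1 - z) ^ (Fintype.card (Fin L × Fin M) - J.card) := by
        positivity
      split_ifs with h
      · rw [Nat.lt_ceil, div_eq_mul_inv] at h
        rw [le_div_iff₀ (by positivity)]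
        refine mul_le_mul_of_nonneg_left ?_ hw
        have h3 : t ≤ N * z - J.card := by rw [ht, ha]; nlinarith
        nlinarith
      · positivity
    refine (Finset.sum_le_sum fun J _ => hle J).trans ?_
    rw [← Finset.sum_div, hvar, div_le_iff₀ (by positivity)]
    have h4 : 1 ≤ N * (δ * z * a ^ 2) := by
      rw [div_lt_iff₀ (by positivity)] at hL
      nlinarith [show 0 < δ * z * a ^ 2 by positivity]
    have h5 : δ * t ^ 2 = N * z * (N * (δ * z * a ^ 2)) := by rw [ht]; ring
    rw [h5]
    have : 0 < N * z := by positivity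
    nlinarith

end Binomial

end QThermo

end

noncomputable section

namespace QThermo

/-! ### The zero-energy state inside the thermal state -/

section Gibbs

variable {E : Type*} [Fintype E] [DecidableEq E]

lemma isHermitian_gibbsWeight (β : ℝ) {H : Matrix E E ℂ} (hH : H.IsHermitian) :
    (gibbsWeight β H).IsHermitian := by
  rw [Matrix.IsHermitian, gibbsWeight, ← Matrix.exp_conjTranspose, Matrix.conjTranspose_smul, hH.eq]
  simp

lemma posSemidef_gibbsWeight (β : ℝ) {H : Matrix E E ℂ} (hH : H.IsHermitian) :
    (gibbsWeight β H).PosSemidef := by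
  have h : gibbsWeight β H = (gibbsWeight (β / 2) H)ᴴ * gibbsWeight (β / 2) H := by
    rw [(isHermitian_gibbsWeight _ hH).eq, gibbsWeight, gibbsWeight,
      ← Matrix.exp_add_of_commute _ _ (Commute.refl _), ← add_smul]
    congr 2
    push_cast
    ring
  rw [h]
  exact Matrix.posSemidef_conjTranspose_mul_self _

open scoped Matrix.Norms.Operator in
lemma commute_gibbsWeight (β : ℝ) (H : Matrix E E ℂ) : Commute (gibbsWeight β H) H :=
  ((Commute.refl H).smul_left _).exp_left

-- The derivative of exp(tA)p is exp(tA)Ap = 0, so the curve keeps its value p at t = 0.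
open scoped Matrix.Norms.Operator in
lemma gibbsWeight_mul_of_mul_eq_zero (β : ℝ) {H p : Matrix E E ℂ} (hp : H * p = 0) :
    gibbsWeight β H * p = p := by
  set A := -(β : ℂ) • H with hA
  have hAp : A * p = 0 := by rw [hA, Matrix.smul_mul, hp, smul_zero]
  have hd : ∀ t : ℝ, HasDerivAt (fun t : ℝ => NormedSpace.exp (t • A) * p) 0 t := by
    intro t
    refine ((hasDerivAt_exp_smul_const (𝕂 := ℝ) A t).mul_const p).congr_deriv ?_
    rw [mul_assoc, hAp, mul_zero]
  have h := is_const_of_deriv_eq_zero (fun t => (hd t).differentiableAt)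
    (fun t => (hd t).deriv) 1 0
  have h' : NormedSpace.exp A * p = p := by simpa using h
  exact h'

lemma partitionFunction_eq_trace (β : ℝ) {H : Matrix E E ℂ} (hH : H.IsHermitian) :
    (gibbsWeight β H).trace = (partitionFunction β H : ℂ) := by
  have := (posSemidef_gibbsWeight β hH).trace_nonneg
  rw [partitionFunction]
  exact Complex.ext rfl (Complex.le_def.1 this).2.symm

lemma isHermitian_ketbra {S : Type*} (ψ : S → ℂ) : (ketbra ψ).IsHermitian := by
  ext i j
  simp [ketbra, Matrix.vecMulVec_apply, mul_comm]

lemma ketbra_mul_self {e : E → ℂ} (he : star e ⬝ᵥ e = 1) : ketbra e * ketbra e = ketbra e := by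
  rw [ketbra, Matrix.vecMulVec_mul_vecMulVec, he, one_smul]

lemma trace_ketbra {e : E → ℂ} (he : star e ⬝ᵥ e = 1) : (ketbra e).trace = 1 := by
  rw [ketbra, Matrix.trace_vecMulVec, dotProduct_comm, he]

lemma mul_ketbra_eq_zero {H : Matrix E E ℂ} {e : E → ℂ} (he : H *ᵥ e = 0) : H * ketbra e = 0 := by
  rw [ketbra, Matrix.mul_vecMulVec, he, Matrix.zero_vecMulVec]

lemma ketbra_mul_eq_zero {H : Matrix E E ℂ} (hH : H.IsHermitian) {e : E → ℂ} (he : H *ᵥ e = 0) :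
    ketbra e * H = 0 := by
  have := congrArg Matrix.conjTranspose (mul_ketbra_eq_zero he)
  rwa [Matrix.conjTranspose_mul, (isHermitian_ketbra e).eq, hH.eq, Matrix.conjTranspose_zero] at this

lemma posSemidef_ketbra {S : Type*} [Fintype S] (ψ : S → ℂ) : (ketbra ψ).PosSemidef :=
  Matrix.posSemidef_vecMulVec_self_star ψ

/-- A reference state with respect to which the pure state `p` has weight `z`. -/
structure IsThermalReference (H p γ : Matrix E E ℂ) (z : ℝ) : Prop where
  herm_p : pᴴ = p
  idem : p * p = p
  trace_p : p.trace = 1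
  left_p : p * H = 0
  right_p : H * p = 0
  pos : γ.PosSemidef
  trace : γ.trace = 1
  comm : Commute γ H
  left : p * γ = (z : ℂ) • p
  right : γ * p = (z : ℂ) • p
  z_pos : 0 < z
  z_le_one : z ≤ 1

/-- A vector of energy zero has Gibbs weight 1, hence thermal probability 1/Z; this is the origin of
the term ln Z in the work cost. -/
lemma isThermalReference_gibbsState (β : ℝ) {H : Matrix E E ℂ} (hH : H.IsHermitian) {e : E → ℂ}
    (he : star e ⬝ᵥ e = 1) (hHe : H *ᵥ e = 0) :
    IsThermalReference H (ketbra e) (gibbsState β H) (partitionFunction β H)⁻¹ := by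
  have hw := posSemidef_gibbsWeight β hH
  have hp := (isHermitian_ketbra e).eq
  have hr : gibbsWeight β H * ketbra e = ketbra e :=
    gibbsWeight_mul_of_mul_eq_zero β (mul_ketbra_eq_zero hHe)
  have hl : ketbra e * gibbsWeight β H = ketbra e := by
    have := congrArg Matrix.conjTranspose hr
    rwa [Matrix.conjTranspose_mul, hp, (isHermitian_gibbsWeight β hH).eq] at this
  -- Compressed to the complement of e, the Gibbs weight is still positive and has trace Z − 1.
  have hZ : 1 ≤ partitionFunction β H := by
    have h1 := (hw.mul_mul_conjTranspose_same (1 - ketbra e)).trace_nonneg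
    have h2 : (1 - ketbra e) * gibbsWeight β H * (1 - ketbra e)ᴴ = gibbsWeight β H - ketbra e := by
      rw [Matrix.conjTranspose_sub, hp, Matrix.conjTranspose_one, sub_mul, hl, one_mul, mul_sub, mul_one,
        sub_mul, hr, ketbra_mul_self he]
      simp
    rw [h2, Matrix.trace_sub, trace_ketbra he, partitionFunction_eq_trace β hH] at h1
    have := (Complex.le_def.1 h1).1
    simp at this
    linarith
  have hZ0 : 0 < partitionFunction β H := by linarith
  have hZc : (partitionFunction β H : ℂ) ≠ 0 := by exact_mod_cast hZ0.ne'
  refine ⟨hp, ketbra_mul_self he, trace_ketbra he, ketbra_mul_eq_zero hH hHe,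
    mul_ketbra_eq_zero hHe, ?_, ?_, ?_, ?_, ?_, inv_pos.2 hZ0, inv_le_one_of_one_le₀ hZ⟩
  · rw [gibbsState, partitionFunction_eq_trace β hH]
    exact hw.smul (by rw [← Complex.ofReal_inv]; exact_mod_cast (inv_pos.2 hZ0).le)
  · rw [gibbsState, Matrix.trace_smul, partitionFunction_eq_trace β hH, smul_eq_mul,
      inv_mul_cancel₀ hZc]
  · exact (commute_gibbsWeight β H).smul_left _
  · rw [gibbsState, Matrix.mul_smul, hl, partitionFunction_eq_trace β hH, Complex.ofReal_inv]
  · rw [gibbsState, Matrix.smul_mul, hr, partitionFunction_eq_trace β hH, Complex.ofReal_inv]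

end Gibbs

/-! ### Configurations of sites in the zero-energy state -/

section Configurations

variable {ι E : Type*} [Fintype ι] [DecidableEq ι] [Fintype E] [DecidableEq E]
  {H p γ : Matrix E E ℂ} {z : ℝ}

/-- The projector onto the configurations in which exactly the sites in `J` are in state `p`. -/
def configProj (p : Matrix E E ℂ) (J : Finset ι) : Matrix (ι → E) (ι → E) ℂ :=
  prodOp fun i => if i ∈ J then p else 1 - p

/-- The (non-normalized) thermal state conditioned on a configuration. -/
def configState (p γ : Matrix E E ℂ) (z : ℝ) (J : Finset ι) : ι → Matrix E E ℂ :=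
  fun i => if i ∈ J then (z : ℂ) • p else (1 - p) * γ

namespace IsThermalReference

lemma compl_gamma_compl (h : IsThermalReference H p γ z) :
    (1 - p) * γ * (1 - p) = (1 - p) * γ := by
  rw [mul_sub, mul_one, mul_assoc (1 - p) γ p, h.right, Matrix.mul_smul, sub_mul 1 p p, h.idem]
  simp

lemma posSemidef_configState (h : IsThermalReference H p γ z) (J : Finset ι) (i : ι) :
    (configState p γ z J i).PosSemidef := by
  rw [configState]
  split_ifs
  · have : p = pᴴ * p := by rw [h.herm_p, h.idem]
    rw [this]
    exact (Matrix.posSemidef_conjTranspose_mul_self p).smul (by exact_mod_cast h.z_pos.le)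
  · have := h.pos.mul_mul_conjTranspose_same (1 - p)
    rwa [Matrix.conjTranspose_sub, h.herm_p, Matrix.conjTranspose_one, h.compl_gamma_compl] at this

lemma trace_configState (h : IsThermalReference H p γ z) (J : Finset ι) (i : ι) :
    (configState p γ z J i).trace = if i ∈ J then (z : ℂ) else 1 - z := by
  rw [configState]
  split_ifs
  · rw [Matrix.trace_smul, h.trace_p, smul_eq_mul, mul_one]
  · rw [sub_mul, one_mul, Matrix.trace_sub, h.left, Matrix.trace_smul, h.trace_p, h.trace,
      smul_eq_mul, mul_one]

lemma prod_trace_configState (h : IsThermalReference H p γ z) (J : Finset ι) :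
    ∏ i, (configState p γ z J i).trace =
      ((z ^ J.card * (1 - z) ^ (Fintype.card ι - J.card) : ℝ) : ℂ) := by
  simp only [h.trace_configState]
  rw [Finset.prod_ite, Finset.prod_const, Finset.prod_const, Finset.filter_mem_eq_inter,
    Finset.univ_inter, Finset.filter_notMem_eq_sdiff, ← Finset.compl_eq_univ_sdiff,
    Finset.card_compl]
  push_cast
  rfl

/-- Since γ commutes with p, the product thermal state is block diagonal with respect to
configurations. An operation controlled by the configuration thus acts on a classical record. -/
lemma configProj_mul_mul (h : IsThermalReference H p γ z) (J J' : Finset ι) :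
    configProj p J * (prodOp fun _ => γ) * configProj p J' =
      if J = J' then prodOp (configState p γ z J) else 0 := by
  rw [configProj, configProj, prodOp_mul, prodOp_mul]
  split_ifs with hJ
  · subst hJ
    congr 1
    funext i
    simp only [Pi.mul_apply, configState]
    split_ifs
    · rw [h.left, Matrix.smul_mul, h.idem]
    · exact h.compl_gamma_compl
  · obtain ⟨i, hi⟩ : ∃ i, ¬(i ∈ J ↔ i ∈ J') := by
      by_contra hcon
      push Not at hcon
      exact hJ (Finset.ext hcon)
    have hzero : (if i ∈ J then p else 1 - p) * γ * (if i ∈ J' then p else 1 - p) = 0 := by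
      by_cases h1 : i ∈ J <;> by_cases h2 : i ∈ J' <;> simp only [h1, h2, if_true, if_false]
      · exact absurd (by simp [h1, h2]) hi
      · rw [h.left, Matrix.smul_mul, mul_sub, h.idem]; simp
      · rw [mul_assoc, h.right, Matrix.mul_smul, sub_mul, h.idem]; simp
      · exact absurd (by simp [h1, h2]) hi
    ext k k'
    simp only [prodOp, Matrix.of_apply, Pi.mul_apply, Matrix.zero_apply]
    exact Finset.prod_eq_zero (Finset.mem_univ i) (by rw [hzero]; rfl)

lemma isHermitian_configProj (h : IsThermalReference H p γ z) (J : Finset ι) :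
    (configProj p J)ᴴ = configProj p J := by
  rw [configProj, prodOp_conjTranspose]
  congr 1
  funext i
  split_ifs
  · exact h.herm_p
  · rw [Matrix.conjTranspose_sub, h.herm_p, Matrix.conjTranspose_one]

lemma configProj_mul (h : IsThermalReference H p γ z) (J J' : Finset ι) :
    configProj p J * configProj p J' = if J = J' then configProj p J else 0 := by
  rw [configProj, configProj, prodOp_mul]
  split_ifs with hJ
  · subst hJ
    congr 1
    funext i
    simp only [Pi.mul_apply]
    split_ifs
    · exact h.idem
    · rw [mul_sub, sub_mul, sub_mul, h.idem]; simp
  · obtain ⟨i, hi⟩ : ∃ i, ¬(i ∈ J ↔ i ∈ J') := by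
      by_contra hcon
      push Not at hcon
      exact hJ (Finset.ext hcon)
    have hzero : (if i ∈ J then p else 1 - p) * (if i ∈ J' then p else 1 - p) = 0 := by
      by_cases h1 : i ∈ J <;> by_cases h2 : i ∈ J' <;> simp only [h1, h2, if_true, if_false]
      · exact absurd (by simp [h1, h2]) hi
      · rw [mul_sub, h.idem]; simp
      · rw [sub_mul, h.idem]; simp
      · exact absurd (by simp [h1, h2]) hi
    ext k k'
    simp only [prodOp, Matrix.of_apply, Pi.mul_apply, Matrix.zero_apply]
    exact Finset.prod_eq_zero (Finset.mem_univ i) (by rw [hzero]; rfl)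

lemma posSemidef_configProj (h : IsThermalReference H p γ z) (J : Finset ι) :
    (configProj p J).PosSemidef := by
  have : configProj p J = (configProj p J)ᴴ * configProj p J := by
    rw [h.isHermitian_configProj, h.configProj_mul, if_pos rfl]
  rw [this]
  exact Matrix.posSemidef_conjTranspose_mul_self _

lemma commute_configProj {X : Type*} [Fintype X] [DecidableEq X] (h : IsThermalReference H p γ z)
    (HX : Matrix X X ℂ) (J : Finset ι) :
    Commute (configProj p J ⊗ₖ (1 : Matrix X X ℂ))
      (totalHamiltonian (bathHamiltonian ι H) HX) := by
  have hp : Commute p H := by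
    change _ * _ = _ * _
    rw [h.left_p, h.right_p]
  refine commute_prodOp HX fun i => ?_
  split_ifs
  · exact hp
  · exact (Commute.one_left H).sub_left hp

end IsThermalReference

lemma sum_configProj (p : Matrix E E ℂ) : ∑ J : Finset ι, configProj p J = 1 := by
  have := sum_prodOp_ite (fun _ : ι => p) (fun _ => 1 - p)
  refine this.trans ?_
  rw [← prodOp_one]
  congr 1
  funext i
  simp

/-- At each site other than j the alternatives zp and (1 − p)γ add up to γ. Summing over the
configurations that contain j restores the unconditioned bath, for which the decoding error can be
computed. -/
lemma sum_configState_mem (h : IsThermalReference H p γ z) (j : ι) {X : Type*} [Fintype X]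
    [DecidableEq X] (M : Matrix (E × X) (E × X) ℂ) :
    ∑ J : Finset ι, (if j ∈ J then placed j M (configState p γ z J) else 0) =
      placed j M fun _ => γ := by
  induction M using kronecker_induction with
  | h0 => simp [placed_zero]
  | hadd M N hM hN =>
    rw [placed_add, ← hM, ← hN, ← Finset.sum_add_distrib]
    refine Finset.sum_congr rfl fun J _ => ?_
    rw [placed_add]
    split_ifs <;> simp
  | hk A C =>
    -- The operator 0 as the second alternative at site j encodes the restriction to j ∈ J in the
    -- product itself.
    have h1 : ∀ J : Finset ι, (if j ∈ J then placed j (A ⊗ₖ C) (configState p γ z J) else 0) =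
        prodOp (fun i => if i ∈ J then Function.update (fun _ => (z : ℂ) • p) j A i
          else Function.update (fun _ => (1 - p) * γ) j 0 i) ⊗ₖ C := by
      intro J
      split_ifs with hj
      · rw [placed_kronecker]
        congr 2
        funext i
        by_cases hi : i = j
        · subst hi; simp [hj]
        · simp [Function.update_of_ne hi, configState]
      · ext a b
        rw [Matrix.kroneckerMap_apply, prodOp, Matrix.of_apply,
          Finset.prod_eq_zero (Finset.mem_univ j) (by simp [hj])]
        simp
    have h2 : ∀ F : Finset ι → Matrix (ι → E) (ι → E) ℂ, ∑ J, F J ⊗ₖ C = (∑ J, F J) ⊗ₖ C := by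
      intro F
      ext a b
      simp only [Matrix.kroneckerMap_apply, Matrix.sum_apply, Finset.sum_mul]
    rw [Finset.sum_congr rfl fun J _ => h1 J, h2, sum_prodOp_ite, placed_kronecker]
    congr 2
    funext i
    by_cases hi : i = j
    · subst hi; simp
    · simp [Function.update_of_ne hi, sub_mul, h.left]

end Configurations

/-! ### The pretty good measurement of the position -/

section Decoder

variable {E X : Type*} [Fintype E] [DecidableEq E] [Fintype X] [DecidableEq X] {L M : ℕ}
  {Q : Matrix (E × X) (E × X) ℂ}

/-- The pretty good measurement for the position within the `l`-th group of sites. -/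
def decoder (Q : Matrix (E × X) (E × X) ℂ) (j : Fin L × Fin M) :
    Matrix ((Fin L × Fin M → E) × X) ((Fin L × Fin M → E) × X) ℂ :=
  invSqrt (∑ m, placed (j.1, m) Q 1) * placed j Q 1 * invSqrt (∑ m, placed (j.1, m) Q 1)

lemma posSemidef_sum_placed (hQ : Q.PosSemidef) (l : Fin L) :
    (∑ m : Fin M, placed (l, m) Q 1).PosSemidef :=
  Matrix.posSemidef_sum _ fun m _ => posSemidef_placed_one (l, m) hQ

lemma posSemidef_decoder (hQ : Q.PosSemidef) (j : Fin L × Fin M) : (decoder Q j).PosSemidef := by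
  have := (posSemidef_placed_one j hQ).mul_mul_conjTranspose_same
    (invSqrt (∑ m, placed (j.1, m) Q 1))
  rwa [(isHermitian_invSqrt _).eq] at this

/-- The normalization turns the sum of the tests in a group into its support projector. -/
lemma posSemidef_one_sub_sum_decoder (hQ : Q.PosSemidef) (l : Fin L) :
    (1 - ∑ m : Fin M, decoder Q (l, m)).PosSemidef := by
  have h : ∑ m : Fin M, decoder Q (l, m) = supportProj (∑ m : Fin M, placed (l, m) Q 1) := by
    rw [← invSqrt_mul_mul_invSqrt (posSemidef_sum_placed hQ l), Finset.mul_sum, Finset.sum_mul]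
    rfl
  rw [h]
  exact posSemidef_one_sub_supportProj _

lemma posSemidef_one_sub_decoder (hQ : Q.PosSemidef) (j : Fin L × Fin M) :
    (1 - decoder Q j).PosSemidef := by
  obtain ⟨l, m⟩ := j
  have h : 1 - decoder Q (l, m) = (1 - ∑ m : Fin M, decoder Q (l, m)) +
      ∑ m' ∈ Finset.univ.erase m, decoder Q (l, m') := by
    rw [← Finset.add_sum_erase _ _ (Finset.mem_univ m)]
    abel
  rw [h]
  exact (posSemidef_one_sub_sum_decoder hQ l).add
    (Matrix.posSemidef_sum _ fun m' _ => posSemidef_decoder hQ _)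

lemma commute_decoder {HE : Matrix E E ℂ} {HX : Matrix X X ℂ}
    (h : Commute Q (totalHamiltonian HE HX)) (j : Fin L × Fin M) :
    Commute (decoder Q j) (totalHamiltonian (bathHamiltonian (Fin L × Fin M) HE) HX) := by
  have h1 : Commute (∑ m, placed (j.1, m) Q 1)
      (totalHamiltonian (bathHamiltonian (Fin L × Fin M) HE) HX) :=
    Commute.sum_left _ _ _ fun m _ => commute_placed (j.1, m) h
  exact ((commute_invSqrt h1).mul_left (commute_placed j h)).mul_left (commute_invSqrt h1)

/-- The decoding error. -/
lemma re_trace_one_sub_decoder_le (hQ : Q.PosSemidef) (hQ1 : (1 - Q).PosSemidef)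
    {ρ : Matrix (E × X) (E × X) ℂ} {γ : Matrix E E ℂ} (hγ : γ.trace = 1)
    (j : Fin L × Fin M) (hρ : (placed j ρ fun _ => γ).PosSemidef) (hρ1 : ρ.trace = 1) :
    ((1 - decoder Q j) * placed j ρ fun _ => γ).trace.re ≤
      2 * (1 - (Q * ρ).trace.re) + 4 * ((M : ℝ) - 1) * (Q * (γ ⊗ₖ traceLeft ρ)).trace.re := by
  obtain ⟨l, m⟩ := j
  set Y := placed (l, m) ρ fun _ : Fin L × Fin M => γ with hY
  set S := placed (l, m) Q (1 : Fin L × Fin M → Matrix E E ℂ) with hS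
  set T := ∑ m' ∈ Finset.univ.erase m, placed (l, m') Q (1 : Fin L × Fin M → Matrix E E ℂ) with hT
  have hST : ∑ m' : Fin M, placed (l, m') Q (1 : Fin L × Fin M → Matrix E E ℂ) = S + T := by
    rw [← Finset.add_sum_erase _ _ (Finset.mem_univ m)]
  have hSpos : S.PosSemidef := posSemidef_placed_one _ hQ
  have hS1 : (1 - S).PosSemidef := by
    have := posSemidef_placed_one (ι := Fin L × Fin M) (l, m) hQ1
    rwa [placed_sub, placed_one] at this
  have hTpos : T.PosSemidef := Matrix.posSemidef_sum _ fun m' _ => posSemidef_placed_one _ hQ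
  have hdec : decoder Q (l, m) = invSqrt (S + T) * S * invSqrt (S + T) := by
    rw [decoder, hST]
  -- S is the test at the true position and T collects the M − 1 competing tests of the same group.
  have h := trace_mul_re_mono (hayashi_nagaoka hSpos hS1 hTpos) hρ
  rw [← hdec] at h
  refine h.trans (le_of_eq ?_)
  have hYtr : Y.trace = 1 := by rw [hY, trace_placed _ _ (fun _ => hγ), hρ1]
  have hSY : (S * Y).trace = (Q * ρ).trace := by
    rw [hS, hY, placed_mul, one_mul, trace_placed _ _ (fun _ => hγ)]
  have hTY : (T * Y).trace = ((M : ℂ) - 1) * (Q * (γ ⊗ₖ traceLeft ρ)).trace := by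
    rw [hT, Finset.sum_mul, Matrix.trace_sum]
    have : ∀ m' ∈ Finset.univ.erase m, (placed (l, m') Q 1 * Y).trace =
        (Q * (γ ⊗ₖ traceLeft ρ)).trace := by
      intro m' hm'
      exact trace_placed_mul_placed (fun h => Finset.ne_of_mem_erase hm' (by simpa using h.symm))
        Q ρ (fun _ => hγ)
    rw [Finset.sum_congr rfl this, Finset.sum_const, Finset.card_erase_of_mem (Finset.mem_univ m),
      Finset.card_univ, Fintype.card_fin, nsmul_eq_mul, Nat.cast_sub (by have := m.2; omega)]
    simp
  rw [add_mul, Matrix.smul_mul, Matrix.smul_mul, sub_mul, one_mul, Matrix.trace_add,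
    Matrix.trace_smul, Matrix.trace_smul, Matrix.trace_sub, hYtr, hSY, hTY, Complex.add_re,
    Complex.smul_re, Complex.smul_re, Complex.sub_re]
  simp
  ring

end Decoder

end QThermo

end

/-! ### The protocol and its contractivity -/

noncomputable section

namespace QThermo

lemma posSemidef_one_sub_block {κ n : Type*} [Fintype κ] [DecidableEq κ] [Fintype n]
    [DecidableEq n] {N : Matrix (κ × n) (κ × n) ℂ} {D : κ → Matrix n n ℂ}
    (hN : ∀ l l' p q, N (l, p) (l', q) = if l = l' then D l p q else 0)
    (hD : ∀ l, (1 - D l).PosSemidef) : (1 - N).PosSemidef := by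
  have h : 1 - N = ∑ l, Matrix.single l l (1 : ℂ) ⊗ₖ (1 - D l) := by
    ext ⟨l, p⟩ ⟨l', q⟩
    rw [Matrix.sub_apply, hN, Matrix.sum_apply]
    simp only [Matrix.kroneckerMap_apply, Matrix.single_apply, ite_mul, one_mul, zero_mul,
      Matrix.sub_apply, Matrix.one_apply, Prod.mk.injEq]
    by_cases hl : l = l'
    · subst hl
      simp
    · rw [Finset.sum_eq_zero]
      · simp [hl]
      · intro x _
        rw [if_neg]
        rintro ⟨rfl, rfl⟩
        exact hl rfl
  rw [h]
  refine Matrix.posSemidef_sum _ fun l _ => Matrix.PosSemidef.kronecker ?_ (hD l)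
  rw [← Matrix.diagonal_single]
  refine Matrix.PosSemidef.diagonal fun i => ?_
  by_cases hi : i = l
  · subst hi; simp
  · simp [hi]

section Protocol

variable {E X : Type*} [Fintype E] [DecidableEq E] [Fintype X] [DecidableEq X] {L M n : ℕ}
  {HE p γ : Matrix E E ℂ} {HX : Matrix X X ℂ} {z : ℝ} {V Q : Matrix (E × X) (E × X) ℂ}

/-- A choice of `n` distinct elements in each sufficiently large set. -/
lemma exists_pick (L M n : ℕ) [NeZero L] [NeZero M] :
    ∃ pick : Finset (Fin L × Fin M) → Fin n → Fin L × Fin M, ∀ J, n ≤ J.card →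
      Function.Injective (pick J) ∧ ∀ i, pick J i ∈ J := by
  have h : ∀ J : Finset (Fin L × Fin M), ∃ f : Fin n → Fin L × Fin M, n ≤ J.card →
      Function.Injective f ∧ ∀ i, f i ∈ J := by
    intro J
    by_cases hJ : n ≤ J.card
    · refine ⟨fun i => J.equivFin.symm (Fin.castLE hJ i), fun _ => ⟨fun i j hij => ?_, fun i => ?_⟩⟩
      · have := J.equivFin.symm.injective (Subtype.ext hij)
        exact Fin.castLE_injective hJ this
      · exact (J.equivFin.symm (Fin.castLE hJ i)).2
    · exact ⟨fun _ => (0, 0), fun h => absurd h hJ⟩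
  choose pick hpick using h
  exact ⟨pick, hpick⟩

/-- Decoding of the position after `V` has acted at position `j`. -/
def siteOp (V Q : Matrix (E × X) (E × X) ℂ) (j : Fin L × Fin M) :
    Matrix ((Fin L × Fin M → E) × X) ((Fin L × Fin M → E) × X) ℂ :=
  decoder Q j * placed j V 1

/-- The block of the protocol from the initial battery level `i` to the final level `l`. -/
def protocolBlock (p : Matrix E E ℂ) (V Q : Matrix (E × X) (E × X) ℂ)
    (pick : Finset (Fin L × Fin M) → Fin n → Fin L × Fin M) (l : Fin L) (i : Fin n) :
    Matrix ((Fin L × Fin M → E) × X) ((Fin L × Fin M → E) × X) ℂ :=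
  ∑ J : Finset (Fin L × Fin M), if n ≤ J.card ∧ (pick J i).1 = l then
    siteOp V Q (pick J i) * (configProj p J ⊗ₖ (1 : Matrix X X ℂ)) else 0

variable {pick : Finset (Fin L × Fin M) → Fin n → Fin L × Fin M}

lemma commute_protocolBlock (hr : IsThermalReference HE p γ z)
    (hV : Commute V (totalHamiltonian HE HX)) (hQ : Commute Q (totalHamiltonian HE HX))
    (l : Fin L) (i : Fin n) :
    Commute (protocolBlock p V Q pick l i)
      (totalHamiltonian (bathHamiltonian (Fin L × Fin M) HE) HX) := by
  refine Commute.sum_left _ _ _ fun J _ => ?_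
  split_ifs
  · exact ((commute_decoder hQ _).mul_left (commute_placed _ hV)).mul_left
      (hr.commute_configProj HX J)
  · exact Commute.zero_left _

/-- Sandwiching an operator of the bath and the system between blocks of the protocol leaves no
interference between different configurations. -/
lemma protocolBlock_mul_mul_conjTranspose (hr : IsThermalReference HE p γ z)
    {Y : Matrix ((Fin L × Fin M → E) × X) ((Fin L × Fin M → E) × X) ℂ}
    {y : Finset (Fin L × Fin M) →
      Matrix ((Fin L × Fin M → E) × X) ((Fin L × Fin M → E) × X) ℂ}
    (hY : ∀ J J', (configProj p J ⊗ₖ (1 : Matrix X X ℂ)) * Y *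
      (configProj p J' ⊗ₖ (1 : Matrix X X ℂ)) = if J = J' then y J else 0)
    (l l' : Fin L) (i : Fin n) :
    protocolBlock p V Q pick l i * Y * (protocolBlock p V Q pick l' i)ᴴ =
      if l = l' then ∑ J, (if n ≤ J.card ∧ (pick J i).1 = l then
        siteOp V Q (pick J i) * y J * (siteOp V Q (pick J i))ᴴ else 0) else 0 := by
  have hh : ∀ J : Finset (Fin L × Fin M), (configProj p J ⊗ₖ (1 : Matrix X X ℂ))ᴴ =
      configProj p J ⊗ₖ (1 : Matrix X X ℂ) := by
    intro J
    rw [Matrix.conjTranspose_kronecker, hr.isHermitian_configProj, Matrix.conjTranspose_one]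
  have h1 : ∀ J J' : Finset (Fin L × Fin M), (if n ≤ J.card ∧ (pick J i).1 = l then
        siteOp V Q (pick J i) * (configProj p J ⊗ₖ (1 : Matrix X X ℂ)) else 0) * Y *
      (if n ≤ J'.card ∧ (pick J' i).1 = l' then
        siteOp V Q (pick J' i) * (configProj p J' ⊗ₖ (1 : Matrix X X ℂ)) else 0)ᴴ =
      if J = J' then (if l = l' then (if n ≤ J.card ∧ (pick J i).1 = l then
        siteOp V Q (pick J i) * y J * (siteOp V Q (pick J i))ᴴ else 0) else 0) else 0 := by
    intro J J'
    by_cases hJ : n ≤ J.card ∧ (pick J i).1 = l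
    · by_cases hJ' : n ≤ J'.card ∧ (pick J' i).1 = l'
      · rw [if_pos hJ, if_pos hJ', Matrix.conjTranspose_mul, hh]
        have : siteOp V Q (pick J i) * (configProj p J ⊗ₖ (1 : Matrix X X ℂ)) * Y *
            ((configProj p J' ⊗ₖ (1 : Matrix X X ℂ)) * (siteOp V Q (pick J' i))ᴴ) =
            siteOp V Q (pick J i) * ((configProj p J ⊗ₖ (1 : Matrix X X ℂ)) * Y *
            (configProj p J' ⊗ₖ (1 : Matrix X X ℂ))) * (siteOp V Q (pick J' i))ᴴ := by
          simp only [mul_assoc]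
        rw [this, hY]
        by_cases hJJ : J = J'
        · subst hJJ
          -- For given i, a configuration determines the picked site and hence its group, so no
          -- coherence between distinct final levels arises.
          have hl : l = l' := hJ.2.symm.trans hJ'.2
          rw [if_pos rfl, if_pos rfl, if_pos hl, if_pos hJ]
        · rw [if_neg hJJ, if_neg hJJ, mul_zero, zero_mul]
      · rw [if_neg hJ', Matrix.conjTranspose_zero, mul_zero]
        by_cases hJJ : J = J'
        · subst hJJ
          by_cases hl : l = l'
          · exact absurd (hl ▸ hJ) hJ'
          · rw [if_pos rfl, if_neg hl]
        · rw [if_neg hJJ]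
    · rw [if_neg hJ, zero_mul, zero_mul]
      simp [hJ]
  rw [protocolBlock, protocolBlock, Matrix.conjTranspose_sum, Finset.sum_mul, Finset.sum_mul]
  simp only [Finset.mul_sum, h1, Finset.sum_ite_eq, Finset.mem_univ, if_true]
  split_ifs <;> simp

lemma placed_mul_conjTranspose_self (hV : V ∈ Matrix.unitaryGroup (E × X) ℂ)
    (j : Fin L × Fin M) : placed j V 1 * (placed j V 1)ᴴ = 1 := by
  have := placed_mem_unitaryGroup j hV
  rwa [Matrix.mem_unitaryGroup_iff, Matrix.star_eq_conjTranspose] at this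

/-- The product is block diagonal in the final level l. Since the picks are distinct, a
configuration is routed to a given site by at most one i, so the configurations routed to (l, m) add
up to some Y ≤ 1. With V unitary and Λ the decoder, block l is then at most ∑ Λ² ≤ ∑ Λ ≤ 1, summed
over m. -/
lemma posSemidef_one_sub_protocol (hr : IsThermalReference HE p γ z)
    (hV : V ∈ Matrix.unitaryGroup (E × X) ℂ) (hQ : Q.PosSemidef)
    (hpick : ∀ J, n ≤ J.card → Function.Injective (pick J) ∧ ∀ i, pick J i ∈ J) :
    (1 - (Matrix.of fun (a : Fin L × ((Fin L × Fin M → E) × X))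
        (b : Fin n × ((Fin L × Fin M → E) × X)) => protocolBlock p V Q pick a.1 b.1 a.2 b.2) *
      (Matrix.of fun (a : Fin L × ((Fin L × Fin M → E) × X))
        (b : Fin n × ((Fin L × Fin M → E) × X)) =>
          protocolBlock p V Q pick a.1 b.1 a.2 b.2)ᴴ).PosSemidef := by
  have hY : ∀ J J' : Finset (Fin L × Fin M), (configProj p J ⊗ₖ (1 : Matrix X X ℂ)) * 1 *
      (configProj p J' ⊗ₖ (1 : Matrix X X ℂ)) =
      if J = J' then configProj p J ⊗ₖ (1 : Matrix X X ℂ) else 0 := by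
    intro J J'
    rw [mul_one, ← Matrix.mul_kronecker_mul, hr.configProj_mul (ι := Fin L × Fin M), mul_one]
    split_ifs <;> simp
  refine posSemidef_one_sub_block (D := fun l => ∑ i, ∑ J, (if n ≤ J.card ∧ (pick J i).1 = l then
        siteOp V Q (pick J i) * (configProj p J ⊗ₖ (1 : Matrix X X ℂ)) *
          (siteOp V Q (pick J i))ᴴ else 0)) ?_ ?_
  · intro l l' a b
    have h := fun i => protocolBlock_mul_mul_conjTranspose (V := V) (Q := Q) (pick := pick) hr hY
      l l' i
    simp only [mul_one] at h
    have h2 : (∑ i, protocolBlock p V Q pick l i * (protocolBlock p V Q pick l' i)ᴴ) a b =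
        if l = l' then (∑ i, ∑ J, (if n ≤ J.card ∧ (pick J i).1 = l then
        siteOp V Q (pick J i) * (configProj p J ⊗ₖ (1 : Matrix X X ℂ)) *
          (siteOp V Q (pick J i))ᴴ else 0)) a b else 0 := by
      simp only [h]
      split_ifs <;> simp
    rw [← h2]
    simp only [Matrix.mul_apply, Matrix.sum_apply, Fintype.sum_prod_type (α₁ := Fin n),
      Matrix.of_apply, Matrix.conjTranspose_apply]
  · intro l
    -- the configurations that are routed to site `j`
    let W : Fin L × Fin M → Finset (Finset (Fin L × Fin M)) := fun j =>
      Finset.univ.filter fun J => n ≤ J.card ∧ ∃ i, pick J i = j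
    let Y : Fin L × Fin M → Matrix (Fin L × Fin M → E) (Fin L × Fin M → E) ℂ := fun j =>
      ∑ J ∈ W j, configProj p J
    have hY1 : ∀ j, (1 - Y j ⊗ₖ (1 : Matrix X X ℂ)).PosSemidef := by
      intro j
      have : (1 : Matrix ((Fin L × Fin M → E) × X) ((Fin L × Fin M → E) × X) ℂ) -
          Y j ⊗ₖ (1 : Matrix X X ℂ) =
          (∑ J ∈ (W j)ᶜ, configProj p J) ⊗ₖ (1 : Matrix X X ℂ) := by
        rw [sub_eq_iff_eq_add', ← Matrix.add_kronecker, Finset.sum_add_sum_compl, sum_configProj,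
          Matrix.one_kronecker_one]
      rw [this]
      exact (Matrix.posSemidef_sum _ fun J _ => hr.posSemidef_configProj J).kronecker
        Matrix.PosSemidef.one
    have hD : (∑ i, ∑ J, (if n ≤ J.card ∧ (pick J i).1 = l then
        siteOp V Q (pick J i) * (configProj p J ⊗ₖ (1 : Matrix X X ℂ)) *
          (siteOp V Q (pick J i))ᴴ else 0)) =
        ∑ m, siteOp V Q (l, m) * (Y (l, m) ⊗ₖ (1 : Matrix X X ℂ)) * (siteOp V Q (l, m))ᴴ := by
      have h1 : ∀ i J, (if n ≤ J.card ∧ (pick J i).1 = l then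
          siteOp V Q (pick J i) * (configProj p J ⊗ₖ (1 : Matrix X X ℂ)) *
          (siteOp V Q (pick J i))ᴴ else 0) = ∑ m, (if n ≤ J.card ∧ pick J i = (l, m) then
          siteOp V Q (l, m) * (configProj p J ⊗ₖ (1 : Matrix X X ℂ)) *
          (siteOp V Q (l, m))ᴴ else 0) := by
        intro i J
        by_cases hJ : n ≤ J.card ∧ (pick J i).1 = l
        · rw [if_pos hJ, Finset.sum_eq_single (pick J i).2]
          · have : pick J i = (l, (pick J i).2) := Prod.ext hJ.2 rfl
            rw [if_pos ⟨hJ.1, this⟩, ← this]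
          · intro m _ hm
            rw [if_neg]
            rintro ⟨_, h⟩
            exact hm (by rw [h])
          · simp
        · rw [if_neg hJ, Finset.sum_eq_zero]
          intro m _
          rw [if_neg]
          rintro ⟨h1, h2⟩
          exact hJ ⟨h1, by rw [h2]⟩
      have h2 : ∀ J m, (∑ i, (if n ≤ J.card ∧ pick J i = (l, m) then
          siteOp V Q (l, m) * (configProj p J ⊗ₖ (1 : Matrix X X ℂ)) *
          (siteOp V Q (l, m))ᴴ else 0)) = if J ∈ W (l, m) then
          siteOp V Q (l, m) * (configProj p J ⊗ₖ (1 : Matrix X X ℂ)) *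
          (siteOp V Q (l, m))ᴴ else 0 := by
        intro J m
        by_cases hJ : n ≤ J.card ∧ ∃ i, pick J i = (l, m)
        · obtain ⟨hJ1, i, hi⟩ := hJ
          rw [if_pos (by simp [W]; exact ⟨hJ1, i, hi⟩), Finset.sum_eq_single i]
          · rw [if_pos ⟨hJ1, hi⟩]
          · intro i' _ hii
            rw [if_neg]
            rintro ⟨_, h⟩
            exact hii ((hpick J hJ1).1 (h.trans hi.symm))
          · simp
        · rw [if_neg (by simpa [W] using hJ), Finset.sum_eq_zero]
          intro i _
          rw [if_neg]
          rintro ⟨h1, h2⟩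
          exact hJ ⟨h1, i, h2⟩
      simp only [h1]
      rw [Finset.sum_comm]
      conv_lhs => enter [2, J]; rw [Finset.sum_comm]
      simp only [h2]
      rw [Finset.sum_comm]
      refine Finset.sum_congr rfl fun m _ => ?_
      rw [← Finset.sum_filter, Finset.filter_mem_eq_inter, Finset.univ_inter]
      have h3 : Y (l, m) ⊗ₖ (1 : Matrix X X ℂ) =
          ∑ J ∈ W (l, m), configProj p J ⊗ₖ (1 : Matrix X X ℂ) := by
        ext a b
        simp only [Y, Matrix.kroneckerMap_apply, Matrix.sum_apply, Finset.sum_mul]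
      rw [h3, Finset.mul_sum, Finset.sum_mul]
    simp only [hD]
    have hsplit : 1 - ∑ m, siteOp V Q (l, m) * (Y (l, m) ⊗ₖ (1 : Matrix X X ℂ)) *
        (siteOp V Q (l, m))ᴴ = (1 - ∑ m : Fin M, decoder Q (l, m)) +
        ∑ m : Fin M, ((decoder Q (l, m) - decoder Q (l, m) * decoder Q (l, m)) +
          siteOp V Q (l, m) * (1 - Y (l, m) ⊗ₖ (1 : Matrix X X ℂ)) * (siteOp V Q (l, m))ᴴ) := by
      have : ∀ m : Fin M, siteOp V Q (l, m) * (1 - Y (l, m) ⊗ₖ (1 : Matrix X X ℂ)) *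
          (siteOp V Q (l, m))ᴴ = decoder Q (l, m) * decoder Q (l, m) -
          siteOp V Q (l, m) * (Y (l, m) ⊗ₖ (1 : Matrix X X ℂ)) * (siteOp V Q (l, m))ᴴ := by
        intro m
        have hs : siteOp V Q (l, m) * (siteOp V Q (l, m))ᴴ =
            decoder Q (l, m) * decoder Q (l, m) := by
          rw [siteOp, Matrix.conjTranspose_mul, (posSemidef_decoder hQ _).isHermitian.eq,
            mul_assoc, ← mul_assoc (placed (l, m) V 1), placed_mul_conjTranspose_self hV, one_mul]
        rw [mul_sub, mul_one, sub_mul, hs]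
      simp only [this, sub_add_sub_cancel, Finset.sum_sub_distrib]
    rw [hsplit]
    refine (posSemidef_one_sub_sum_decoder hQ l).add (Matrix.posSemidef_sum _ fun m _ => ?_)
    exact (posSemidef_sub_mul_self (posSemidef_decoder hQ _) (posSemidef_one_sub_decoder hQ _)).add
      ((hY1 _).mul_mul_conjTranspose_same _)

end Protocol

end QThermo

end

noncomputable section

namespace QThermo

/-! ### Decoding error and fidelity of the protocol -/

section ProtocolFidelity

variable {E X : Type*} [Fintype E] [DecidableEq E] [Fintype X] [DecidableEq X] {L M n : ℕ}
  {HE γ : Matrix E E ℂ} {HX : Matrix X X ℂ} {z : ℝ} {e₀ : E → ℂ}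
  {V Q : Matrix (E × X) (E × X) ℂ} {T : Matrix X X ℂ →ₗ[ℂ] Matrix X X ℂ}

lemma placed_mul_configState {j : Fin L × Fin M} {J : Finset (Fin L × Fin M)} (hj : j ∈ J)
    (A : Matrix X X ℂ) :
    placed j V 1 * (prodOp (configState (ketbra e₀) γ z J) ⊗ₖ A) * (placed j V 1)ᴴ =
      placed j ((z : ℂ) • dilationOutput e₀ V A) (configState (ketbra e₀) γ z J) := by
  rw [prodOp_kronecker j, placed_one_conjTranspose, placed_mul, placed_mul, one_mul, mul_one]
  congr 1
  rw [configState, if_pos hj, dilationOutput, Matrix.smul_kronecker, Matrix.mul_smul,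
    Matrix.smul_mul]

lemma posSemidef_dilationOutput {σ : Matrix X X ℂ} (hσ : σ.PosSemidef) :
    (dilationOutput e₀ V σ).PosSemidef :=
  ((posSemidef_ketbra e₀).kronecker hσ).mul_mul_conjTranspose_same V

lemma trace_dilationOutput (h : IsCovariantDilation HX T HE e₀ V) (σ : Matrix X X ℂ) :
    (dilationOutput e₀ V σ).trace = σ.trace := by
  have hV := Matrix.mem_unitaryGroup_iff'.1 h.unitary
  rw [Matrix.star_eq_conjTranspose] at hV
  rw [dilationOutput, Matrix.trace_mul_comm, ← mul_assoc, hV, one_mul, Matrix.trace_kronecker,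
    trace_ketbra h.unit, one_mul]

/-- Sites other than j contribute only their traces; with the factor z at j these multiply to the
binomial probability of J. -/
lemma traceLeft_placed_configState (h : IsCovariantDilation HX T HE e₀ V)
    (hr : IsThermalReference HE (ketbra e₀) γ z) {j : Fin L × Fin M}
    {J : Finset (Fin L × Fin M)} (hj : j ∈ J) (A : Matrix X X ℂ) :
    traceLeft (placed j ((z : ℂ) • dilationOutput e₀ V A) (configState (ketbra e₀) γ z J)) =
      ((z ^ J.card * (1 - z) ^ (Fintype.card (Fin L × Fin M) - J.card) : ℝ) : ℂ) • T A := by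
  rw [← hr.prod_trace_configState, traceLeft_placed, map_smul, smul_smul, ← h.dilates,
    ← Finset.mul_prod_erase _ _ (Finset.mem_univ j), hr.trace_configState, if_pos hj, mul_comm]

/-- The total decoding error of the protocol. -/
lemma sum_error_le (h : IsCovariantDilation HX T HE e₀ V)
    (hr : IsThermalReference HE (ketbra e₀) γ z) (hQ : Q.PosSemidef) (hQ1 : (1 - Q).PosSemidef)
    {σ : Matrix X X ℂ} (hσ : IsState σ)
    {pick : Finset (Fin L × Fin M) → Fin n → Fin L × Fin M}
    (hpick : ∀ J, n ≤ J.card → Function.Injective (pick J) ∧ ∀ i, pick J i ∈ J) :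
    ∑ J : Finset (Fin L × Fin M), (if n ≤ J.card then ∑ i, ((1 - decoder Q (pick J i)) *
      placed (pick J i) ((z : ℂ) • dilationOutput e₀ V σ)
        (configState (ketbra e₀) γ z J)).trace.re else 0) ≤
      L * M * z * (2 * (1 - (Q * dilationOutput e₀ V σ).trace.re) + 4 * ((M : ℝ) - 1) *
        (Q * (γ ⊗ₖ traceLeft (dilationOutput e₀ V σ))).trace.re) := by
  set ρ := dilationOutput e₀ V σ with hρ
  have hρpos : ρ.PosSemidef := posSemidef_dilationOutput hσ.1
  have hρ1 : ρ.trace = 1 := by rw [hρ, trace_dilationOutput h, hσ.2]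
  let F : Finset (Fin L × Fin M) → Fin L × Fin M → ℝ := fun J j => ((1 - decoder Q j) *
      placed j ((z : ℂ) • ρ) (configState (ketbra e₀) γ z J)).trace.re
  have hF : ∀ J j, j ∈ J → 0 ≤ F J j := by
    intro J j hj
    refine trace_mul_re_nonneg (posSemidef_one_sub_decoder hQ j) ?_
    rw [hρ, ← placed_mul_configState hj]
    exact ((posSemidef_prodOp fun i => hr.posSemidef_configState J i).kronecker
      hσ.1).mul_mul_conjTranspose_same _
  -- The error terms are nonnegative, so the n picked sites may be enlarged to all of J. The bound
  -- no longer depends on the picks, and for fixed j the sum over J is accessible.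
  have h1 : ∀ J, (if n ≤ J.card then ∑ i, F J (pick J i) else 0) ≤
      ∑ j, if j ∈ J then F J j else 0 := by
    intro J
    have hsum : ∑ j, (if j ∈ J then F J j else 0) = ∑ j ∈ J, F J j := by
      rw [← Finset.sum_filter, Finset.filter_mem_eq_inter, Finset.univ_inter]
    rw [hsum]
    split_ifs with hJ
    · obtain ⟨hinj, hmem⟩ := hpick J hJ
      rw [← Finset.sum_image (f := F J) (s := Finset.univ) (g := pick J) (fun a _ b _ hab => hinj hab)]
      refine Finset.sum_le_sum_of_subset_of_nonneg ?_ fun j hj _ => hF J j hj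
      intro j hj
      obtain ⟨i, _, rfl⟩ := Finset.mem_image.1 hj
      exact hmem i
    · exact Finset.sum_nonneg fun j hj => hF J j hj
  refine (Finset.sum_le_sum fun J _ => h1 J).trans ?_
  rw [Finset.sum_comm]
  have h2 : ∀ j, (∑ J, if j ∈ J then F J j else 0) ≤
      z * (2 * (1 - (Q * ρ).trace.re) + 4 * ((M : ℝ) - 1) *
        (Q * (γ ⊗ₖ traceLeft ρ)).trace.re) := by
    intro j
    have h3 : (∑ J, if j ∈ J then F J j else 0) =
        z * ((1 - decoder Q j) * placed j ρ fun _ => γ).trace.re := by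
      have h4 : ∀ J, (if j ∈ J then F J j else 0) = ((1 - decoder Q j) *
          (if j ∈ J then placed j ((z : ℂ) • ρ) (configState (ketbra e₀) γ z J) else 0)).trace.re := by
        intro J
        split_ifs
        · rfl
        · simp
      rw [Finset.sum_congr rfl fun J _ => h4 J, ← Complex.re_sum, ← Matrix.trace_sum,
        ← Finset.mul_sum, sum_configState_mem hr]
      have h5 : placed j ((z : ℂ) • ρ) (fun _ : Fin L × Fin M => γ) =
          (z : ℂ) • placed j ρ fun _ => γ := by
        ext a b
        simp [placed, mul_assoc]
      rw [h5, Matrix.mul_smul, Matrix.trace_smul, smul_eq_mul, Complex.re_ofReal_mul]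
    rw [h3]
    refine mul_le_mul_of_nonneg_left ?_ hr.z_pos.le
    refine re_trace_one_sub_decoder_le hQ hQ1 hr.trace j ?_ hρ1
    have h6 : placed j ρ (fun _ : Fin L × Fin M => γ) =
        placed j (matrixSqrt ρ) (fun _ => matrixSqrt γ) *
          (placed j (matrixSqrt ρ) (fun _ => matrixSqrt γ))ᴴ := by
      rw [placed_conjTranspose, placed_mul, (isHermitian_matrixSqrt _).eq,
        matrixSqrt_mul_self hρpos]
      congr 1
      funext i
      rw [Pi.mul_apply, (isHermitian_matrixSqrt _).eq, matrixSqrt_mul_self hr.pos]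
    rw [h6]
    exact Matrix.posSemidef_self_mul_conjTranspose _
  refine (Finset.sum_le_sum fun j _ => h2 j).trans (le_of_eq ?_)
  rw [Finset.sum_const, Finset.card_univ, nsmul_eq_mul, Fintype.card_prod, Fintype.card_fin,
    Fintype.card_fin]
  push_cast
  ring

/-- The protocol: create `|e₀⟩` at a random site, apply `V` there, and decode the position. -/
theorem exists_protocol (hX : HX.IsHermitian) (β : ℝ) (h : IsCovariantDilation HX T HE e₀ V)
    (hr : IsThermalReference HE (ketbra e₀) (gibbsState β HE) z) (hQ : Q.PosSemidef)
    (hQ1 : (1 - Q).PosSemidef) (hQc : Commute Q (totalHamiltonian HE HX))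
    {σ : Matrix X X ℂ} (hσ : IsState σ) (hL : 0 < L) (hM : 0 < M) (hn : 0 < n) :
    ∃ (d : ℕ) (Φ : Matrix (X × Fin d) (X × Fin d) ℂ →ₗ[ℂ] Matrix (X × Fin d) (X × Fin d) ℂ)
      (τ τ' : BatteryState d),
      IsThermalOperation β (totalHamiltonian HX (0 : Matrix (Fin d) (Fin d) ℂ)) Φ ∧
      τ.charge - τ'.charge = Real.log L - Real.log n ∧
      ∀ (R : Type*) [Fintype R] [DecidableEq R] (ψ : X × R → ℂ), IsPurification σ ψ →
        (∑ J : Finset (Fin L × Fin M), if n ≤ J.card then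
          z ^ J.card * (1 - z) ^ (Fintype.card (Fin L × Fin M) - J.card) else 0) -
        (n : ℝ)⁻¹ * (L * M * z * (2 * (1 - (Q * dilationOutput e₀ V σ).trace.re) +
          4 * ((M : ℝ) - 1) *
          (Q * (gibbsState β HE ⊗ₖ traceLeft (dilationOutput e₀ V σ))).trace.re)) ≤
        fidelity (ampliate (effectiveWorkProcess Φ τ τ') R (ketbra ψ))
          (ampliate T R (ketbra ψ)) := by
  have : NeZero L := ⟨hL.ne'⟩
  have : NeZero M := ⟨hM.ne'⟩
  have hE : Nonempty E := by
    by_contra hne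
    rw [not_nonempty_iff] at hne
    have := h.unit
    simp [dotProduct] at this
  obtain ⟨pick, hpick⟩ := exists_pick L M n
  set γ := gibbsState β HE with hγ
  set p := ketbra e₀ with hp
  obtain ⟨d, Φ, τ, τ', hth, hcharge, heff⟩ := exists_thermalOperation_of_contraction β hX
    (isHermitian_bathHamiltonian (ι := Fin L × Fin M) h.isHermitian) hn hL
    (protocolBlock p V Q pick) (commute_protocolBlock hr h.commute hQc)
    (posSemidef_one_sub_protocol hr h.unitary hQ hpick)
  refine ⟨d, Φ, τ, τ', hth, hcharge, ?_⟩
  intro R _ _ ψ hψ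
  set w : Finset (Fin L × Fin M) → ℝ := fun J =>
    z ^ J.card * (1 - z) ^ (Fintype.card (Fin L × Fin M) - J.card) with hw
  -- The pairs (J, i) label incoherent branches: g is the weighted bath state of a branch, dropped
  -- when J is too small, c the actual interaction, and D the ideal one without decoder.
  let g : Finset (Fin L × Fin M) × Fin n → Matrix (Fin L × Fin M → E) (Fin L × Fin M → E) ℂ :=
    fun k => if n ≤ k.1.card then (n : ℂ)⁻¹ • prodOp (configState p γ z k.1) else 0
  let c : Finset (Fin L × Fin M) × Fin n → Matrix ((Fin L × Fin M → E) × X)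
      ((Fin L × Fin M → E) × X) ℂ := fun k => siteOp V Q (pick k.1 k.2)
  let D : Finset (Fin L × Fin M) × Fin n → Matrix ((Fin L × Fin M → E) × X)
      ((Fin L × Fin M → E) × X) ℂ := fun k => placed (pick k.1 k.2) V 1
  have hninv : (0 : ℂ) ≤ (n : ℂ)⁻¹ := by
    rw [← Complex.ofReal_natCast, ← Complex.ofReal_inv]
    exact_mod_cast (inv_nonneg.2 (Nat.cast_nonneg n) : (0 : ℝ) ≤ (n : ℝ)⁻¹)
  have hnne : (n : ℂ) ≠ 0 := by exact_mod_cast hn.ne'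
  have hg : ∀ k, (g k).PosSemidef := by
    intro k
    simp only [g]
    split_ifs
    · exact (posSemidef_prodOp fun i => hr.posSemidef_configState k.1 i).smul hninv
    · exact Matrix.PosSemidef.zero
  have h₁ : ∀ A, effectiveWorkProcess Φ τ τ' A = ∑ k, traceLeft (c k * (g k ⊗ₖ A) * (c k)ᴴ) := by
    intro A
    rw [heff A, gibbsState_bathHamiltonian, ← hγ]
    have hY : ∀ J J' : Finset (Fin L × Fin M), (configProj p J ⊗ₖ (1 : Matrix X X ℂ)) *
        (((n : ℂ)⁻¹ • prodOp fun _ => γ) ⊗ₖ A) * (configProj p J' ⊗ₖ (1 : Matrix X X ℂ)) =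
        if J = J' then ((n : ℂ)⁻¹ • prodOp (configState p γ z J)) ⊗ₖ A else 0 := by
      intro J J'
      rw [← Matrix.mul_kronecker_mul, ← Matrix.mul_kronecker_mul, one_mul, mul_one,
        Matrix.mul_smul, Matrix.smul_mul, hr.configProj_mul_mul]
      split_ifs <;> simp
    have h2 := fun l i => protocolBlock_mul_mul_conjTranspose (V := V) (Q := Q) (pick := pick)
      hr hY l l i
    simp only [↓reduceIte] at h2
    simp only [h2, map_sum]
    rw [Fintype.sum_prod_type, Finset.sum_comm]
    conv_lhs => enter [2, i]; rw [Finset.sum_comm]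
    rw [Finset.sum_comm]
    refine Finset.sum_congr rfl fun J _ => Finset.sum_congr rfl fun i _ => ?_
    by_cases hJ : n ≤ J.card
    · simp only [hJ, true_and, if_true, c, g]
      rw [Finset.sum_eq_single (pick J i).1 (fun l _ hl => by rw [if_neg hl.symm, map_zero])
        (fun hl => absurd (Finset.mem_univ _) hl), if_pos rfl]
    · simp [hJ, c, g]
  have hRk : ∀ (A : Matrix X X ℂ) (J : Finset (Fin L × Fin M)) (i : Fin n),
      D (J, i) * (g (J, i) ⊗ₖ A) * (D (J, i))ᴴ = if n ≤ J.card then (n : ℂ)⁻¹ •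
        placed (pick J i) ((z : ℂ) • dilationOutput e₀ V A) (configState p γ z J) else 0 := by
    intro A J i
    by_cases hJ : n ≤ J.card
    · simp only [D, g, if_pos hJ]
      rw [Matrix.smul_kronecker, Matrix.mul_smul, Matrix.smul_mul,
        placed_mul_configState ((hpick J hJ).2 i)]
    · simp [g, hJ]
  -- Without the decoder every branch implements T exactly, so the ideal family misses T only by the
  -- binomial tail.
  have h₂ : ∀ A, ∑ k, traceLeft (D k * (g k ⊗ₖ A) * (D k)ᴴ) =
      ((∑ J, if n ≤ J.card then w J else 0 : ℝ) : ℂ) • T A := by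
    intro A
    rw [Fintype.sum_prod_type, Complex.ofReal_sum, Finset.sum_smul]
    refine Finset.sum_congr rfl fun J _ => ?_
    simp only [hRk]
    split_ifs with hJ
    · have h3 : ∀ i, traceLeft ((n : ℂ)⁻¹ • placed (pick J i) ((z : ℂ) • dilationOutput e₀ V A)
          (configState p γ z J)) = (n : ℂ)⁻¹ • ((w J : ℂ) • T A) := by
        intro i
        rw [map_smul, traceLeft_placed_configState h hr ((hpick J hJ).2 i)]
      rw [Finset.sum_congr rfl fun i _ => h3 i, Finset.sum_const, Finset.card_univ,
        Fintype.card_fin, ← Nat.cast_smul_eq_nsmul ℂ, smul_smul, mul_inv_cancel₀ hnne, one_smul]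
    · simp
  have hw0 : ∀ J, 0 ≤ w J := fun J =>
    mul_nonneg (pow_nonneg hr.z_pos.le _) (pow_nonneg (by linarith [hr.z_le_one]) _)
  have hw1 : (∑ J, if n ≤ J.card then w J else 0 : ℝ) ≤ 1 := by
    have h3 : ∑ J, w J = 1 := by
      have := Fintype.sum_pow_mul_eq_add_pow (Fin L × Fin M) z (1 - z)
      rw [this]
      simp
    rw [← h3]
    exact Finset.sum_le_sum fun J _ => by split_ifs; exacts [le_rfl, hw0 J]
  refine le_trans ?_ (re_sum_trace_le_fidelity hg (posSemidef_ketbra e₀) h₁ h.dilates hw1 h₂ hψ)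
  have htr : ∀ J i, ((D (J, i))ᴴ * c (J, i) * (g (J, i) ⊗ₖ σ)).trace.re =
      (traceLeft (D (J, i) * (g (J, i) ⊗ₖ σ) * (D (J, i))ᴴ)).trace.re -
      (if n ≤ J.card then (n : ℝ)⁻¹ * ((1 - decoder Q (pick J i)) *
      placed (pick J i) ((z : ℂ) • dilationOutput e₀ V σ)
        (configState p γ z J)).trace.re else 0) := by
    intro J i
    -- The Kraus operator contains the decoder itself and not its square root, so the overlap is the
    -- expectation of the decoder after V, and its deficit is a decoding error.
    have h3 : ((D (J, i))ᴴ * c (J, i) * (g (J, i) ⊗ₖ σ)).trace =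
        (decoder Q (pick J i) * (D (J, i) * (g (J, i) ⊗ₖ σ) * (D (J, i))ᴴ)).trace := by
      simp only [c, siteOp, D]
      rw [mul_assoc, Matrix.trace_mul_comm]
      simp only [mul_assoc]
    rw [h3, trace_traceLeft, hRk]
    split_ifs
    · rw [sub_mul, one_mul, Matrix.trace_sub, Matrix.mul_smul, Matrix.trace_smul,
        Matrix.trace_smul, ← Complex.ofReal_natCast, ← Complex.ofReal_inv, smul_eq_mul,
        smul_eq_mul, Complex.re_ofReal_mul, Complex.re_ofReal_mul, Complex.sub_re]
      ring
    · simp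
  have htot : (∑ k, (traceLeft (D k * (g k ⊗ₖ σ) * (D k)ᴴ)).trace.re) =
      ∑ J, if n ≤ J.card then w J else 0 := by
    have hT1 : (T σ).trace = 1 := by
      rw [h.dilates, trace_traceLeft, trace_dilationOutput h, hσ.2]
    rw [← Complex.re_sum, ← Matrix.trace_sum, h₂, Matrix.trace_smul, hT1, smul_eq_mul, mul_one,
      Complex.ofReal_re]
  rw [Complex.re_sum, Fintype.sum_prod_type]
  simp only [htr, Finset.sum_sub_distrib]
  rw [← Fintype.sum_prod_type
    (fun k => (traceLeft (D k * (g k ⊗ₖ σ) * (D k)ᴴ)).trace.re), htot]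
  refine sub_le_sub_left ?_ _
  have herr := mul_le_mul_of_nonneg_left (sum_error_le (n := n) h hr hQ hQ1 hσ hpick)
    (inv_nonneg.2 (Nat.cast_nonneg n) : (0 : ℝ) ≤ (n : ℝ)⁻¹)
  refine le_trans (le_of_eq ?_) herr
  rw [Finset.mul_sum]
  refine Finset.sum_congr rfl fun J _ => ?_
  split_ifs
  · rw [Finset.mul_sum]
  · simp

end ProtocolFidelity

/-! ### Near-optimal tests -/

section HypothesisTesting

variable {S : Type*} [Fintype S] [DecidableEq S]

/-- The slack factor c makes it unnecessary to know that the infimum is attained. -/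
lemma exists_test_lt {η : ℝ} (hη : 0 < η) (hη1 : η ≤ 1) {ρ : Matrix S S ℂ} (hρ : ρ.trace = 1)
    (σ : Matrix S S ℂ) {c : ℝ} (hc : 1 < c) :
    ∃ Q : Matrix S S ℂ, Q.PosSemidef ∧ (1 - Q).PosSemidef ∧ η ≤ (Q * ρ).trace.re ∧
      (Q * σ).trace.re < c * Real.exp (-hypTestEntropy η ρ σ) := by
  set s := sInf (testValues η ρ σ) with hs
  have hle : s ≤ Real.exp (-hypTestEntropy η ρ σ) := by
    -- If the infimum vanishes, the entropy takes a finite default value through `Real.log 0 = 0`.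
    -- The exponential is positive anyway, so it still dominates the infimum.
    rcases le_or_gt s 0 with h | h
    · exact h.trans (Real.exp_pos _).le
    · rw [hypTestEntropy, normalizedHypTestEntropy, ← hs,
        Real.log_mul (inv_ne_zero hη.ne') h.ne', Real.log_inv]
      refine le_of_eq ?_
      rw [show -(-(-Real.log η + Real.log s) - Real.log η) = Real.log s by ring, Real.exp_log h]
  have hlt : s < c * Real.exp (-hypTestEntropy η ρ σ) := by
    have := Real.exp_pos (-hypTestEntropy η ρ σ)
    nlinarith
  have hne : (testValues η ρ σ).Nonempty :=
    ⟨_, 1, Matrix.PosSemidef.one, by rw [sub_self]; exact Matrix.PosSemidef.zero, by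
      rw [one_mul, hρ]; simpa using hη1, rfl⟩
  obtain ⟨x, ⟨Q, h1, h2, h3, rfl⟩, hx⟩ := exists_lt_of_csInf_lt hne hlt
  exact ⟨Q, h1, h2, h3, hx⟩

end HypothesisTesting

/-! ### Choice of parameters -/

section Main

variable {E X : Type*} [Fintype E] [DecidableEq E] [Fintype X] [DecidableEq X]
  {HE γ : Matrix E E ℂ} {HX : Matrix X X ℂ} {z : ℝ} {e₀ : E → ℂ}
  {V : Matrix (E × X) (E × X) ℂ} {T : Matrix X X ℂ →ₗ[ℂ] Matrix X X ℂ}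

/-- Stationarity of this state and of γ ⊗ ρ_X is what lets the test be pinched without changing its
outcome probabilities. -/
lemma commute_dilationOutput (hX : HX.IsHermitian) (h : IsCovariantDilation HX T HE e₀ V)
    {σ : Matrix X X ℂ} (hσ : Commute σ HX) :
    Commute (dilationOutput e₀ V σ) (totalHamiltonian HE HX) := by
  have hG := isHermitian_totalHamiltonian h.isHermitian hX
  have hV' : Commute Vᴴ (totalHamiltonian HE HX) := by
    have := congrArg Matrix.conjTranspose h.commute.eq
    rw [Matrix.conjTranspose_mul, Matrix.conjTranspose_mul, hG.eq] at this
    exact this.symm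
  refine (h.commute.mul_left ?_).mul_left hV'
  change _ * _ = _ * _
  rw [totalHamiltonian, mul_add, add_mul, ← Matrix.mul_kronecker_mul, ← Matrix.mul_kronecker_mul,
    ← Matrix.mul_kronecker_mul, ← Matrix.mul_kronecker_mul,
    ketbra_mul_eq_zero h.isHermitian h.zero_energy, mul_ketbra_eq_zero h.zero_energy, hσ.eq]
  simp

lemma commute_kronecker_totalHamiltonian {ρ : Matrix X X ℂ} (hγ : Commute γ HE)
    (hρ : Commute ρ HX) : Commute (γ ⊗ₖ ρ) (totalHamiltonian HE HX) := by
  change _ * _ = _ * _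
  rw [totalHamiltonian, mul_add, add_mul, ← Matrix.mul_kronecker_mul, ← Matrix.mul_kronecker_mul,
    ← Matrix.mul_kronecker_mul, ← Matrix.mul_kronecker_mul, hγ.eq, hρ.eq]
  simp

/-- Accounting: the binomial tail costs ε/2, and decoding costs (6/5)(2ε + 4 · (ε/(2e)) · (5/4)e) =
27ε/5, where e is the exponential of minus the entropy. The total of 5.9ε stays below 6ε. -/
theorem exists_thermalOperation_of_dilation (hX : HX.IsHermitian) (β : ℝ)
    (hcov : IsTimeCovariant HX T) (h : IsCovariantDilation HX T HE e₀ V)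
    {σ : Matrix X X ℂ} (hσ : IsState σ) (hcomm : Commute σ HX) {ε : ℝ} (hε : 0 < ε) (hε1 : ε < 1) :
    ∃ (d : ℕ) (Φ : Matrix (X × Fin d) (X × Fin d) ℂ →ₗ[ℂ] Matrix (X × Fin d) (X × Fin d) ℂ)
      (τ τ' : BatteryState d),
      IsThermalOperation β (totalHamiltonian HX (0 : Matrix (Fin d) (Fin d) ℂ)) Φ ∧
      (∀ (R : Type*) [Fintype R] [DecidableEq R] (ψ : X × R → ℂ), IsPurification σ ψ →
        1 - 6 * ε ≤ fidelity (ampliate (effectiveWorkProcess Φ τ τ') R (ketbra ψ))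
          (ampliate T R (ketbra ψ))) ∧
      τ.charge - τ'.charge ≤
        -hypTestEntropy (1 - ε) (dilationOutput e₀ V σ)
            (gibbsState β HE ⊗ₖ traceLeft (dilationOutput e₀ V σ))
          + Real.log (partitionFunction β HE) + Real.log (2 / ε) := by
  have hr := isThermalReference_gibbsState β h.isHermitian h.unit h.zero_energy
  set Z := partitionFunction β HE with hZ
  have hZpos : 0 < Z := inv_pos.1 hr.z_pos
  set ρ := dilationOutput e₀ V σ with hρ
  set ω := gibbsState β HE ⊗ₖ traceLeft ρ with hω
  set e := Real.exp (-hypTestEntropy (1 - ε) ρ ω) with he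
  have hepos : 0 < e := Real.exp_pos _
  have hρ1 : ρ.trace = 1 := by rw [hρ, trace_dilationOutput h, hσ.2]
  obtain ⟨Q₀, hQ₀, hQ₀1, hQ₀ρ, hQ₀ω⟩ := exists_test_lt (η := 1 - ε) (by linarith) (by linarith) hρ1
    ω (c := 5 / 4) (by norm_num)
  obtain ⟨Q, hQ, hQ1, hQc, htr⟩ := exists_commuting_test
    (isHermitian_totalHamiltonian h.isHermitian hX) hQ₀ hQ₀1
  -- Covariance maps the stationary σ to a stationary state.
  have hTσ : Commute (traceLeft ρ) HX := by
    have := hcov.map_commutator σ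
    rw [hcomm.eq, sub_self, map_zero, h.dilates σ] at this
    exact (sub_eq_zero.1 this.symm).symm
  rw [← htr ρ (commute_dilationOutput hX h hcomm)] at hQ₀ρ
  rw [← htr ω (commute_kronecker_totalHamiltonian hr.comm hTσ), ← he] at hQ₀ω
  -- M exceeds ε/(2e) strictly, which leaves room for c > 1 in the work cost, while the number M − 1
  -- of competing sites stays at most ε/(2e).
  set M : ℕ := ⌊ε / (2 * e)⌋₊ + 1 with hMdef
  have hM1 : (M : ℝ) - 1 ≤ ε / (2 * e) := by
    have := Nat.floor_le (show 0 ≤ ε / (2 * e) by positivity)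
    rw [hMdef]; push_cast; linarith
  have hM2 : ε / (2 * e) < M := by
    rw [hMdef]; push_cast; exact Nat.lt_floor_add_one _
  have hMge : (1 : ℝ) ≤ M := by rw [hMdef]; push_cast; linarith [Nat.cast_nonneg (α := ℝ) ⌊ε / (2 * e)⌋₊]
  -- The first bound on c limits the loss of fidelity, the second the work cost.
  have hc : 1 < min (6 / 5 : ℝ) (2 * e * M / ε) := by
    refine lt_min (by norm_num) ?_
    rw [div_lt_iff₀ (by positivity)] at hM2
    rw [lt_div_iff₀ hε]
    linarith
  set c := min (6 / 5 : ℝ) (2 * e * M / ε) with hcdef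
  obtain ⟨L, n, hL, hn, hLn, htail⟩ := exists_binomial_tail_le hr.z_pos hr.z_le_one hc
    (show 0 < ε / 2 by linarith) (M := M) (by rw [hMdef]; omega)
  obtain ⟨d, Φ, τ, τ', hth, hcharge, hfid⟩ := exists_protocol (L := L) (M := M) (n := n) hX β h hr
    hQ hQ1 hQc hσ hL (by rw [hMdef]; omega) hn
  have hnpos : (0 : ℝ) < n := by exact_mod_cast hn
  have hLpos : (0 : ℝ) < L := by exact_mod_cast hL
  have hMpos : (0 : ℝ) < M := by linarith
  refine ⟨d, Φ, τ, τ', hth, ?_, ?_⟩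
  · intro R _ _ ψ hψ
    refine le_trans ?_ (hfid R ψ hψ)
    have hsum : (∑ J : Finset (Fin L × Fin M), if n ≤ J.card then
          Z⁻¹ ^ J.card * (1 - Z⁻¹) ^ (Fintype.card (Fin L × Fin M) - J.card) else 0) ≥
        1 - ε / 2 := by
      have h1 := Fintype.sum_pow_mul_eq_add_pow (Fin L × Fin M) Z⁻¹ (1 - Z⁻¹)
      rw [add_sub_cancel, one_pow] at h1
      have h2 : ∀ J : Finset (Fin L × Fin M), (if n ≤ J.card then
          Z⁻¹ ^ J.card * (1 - Z⁻¹) ^ (Fintype.card (Fin L × Fin M) - J.card) else 0) =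
          Z⁻¹ ^ J.card * (1 - Z⁻¹) ^ (Fintype.card (Fin L × Fin M) - J.card) -
          if J.card < n then
          Z⁻¹ ^ J.card * (1 - Z⁻¹) ^ (Fintype.card (Fin L × Fin M) - J.card) else 0 := by
        intro J
        by_cases hJ : n ≤ J.card
        · simp [hJ, not_lt.2 hJ]
        · simp [hJ, not_le.1 hJ]
      rw [Finset.sum_congr rfl fun J _ => h2 J, Finset.sum_sub_distrib, h1]
      linarith
    have herr : 2 * (1 - (Q * ρ).trace.re) + 4 * ((M : ℝ) - 1) * (Q * ω).trace.re ≤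
        9 / 2 * ε := by
      have h1 : ((M : ℝ) - 1) * (Q * ω).trace.re ≤ ε / (2 * e) * (5 / 4 * e) := by
        calc ((M : ℝ) - 1) * (Q * ω).trace.re ≤ ((M : ℝ) - 1) * (5 / 4 * e) :=
              mul_le_mul_of_nonneg_left hQ₀ω.le (by linarith)
          _ ≤ _ := mul_le_mul_of_nonneg_right hM1 (by positivity)
      have h2 : ε / (2 * e) * (5 / 4 * e) = 5 / 8 * ε := by field_simp; norm_num
      linarith
    have hx : (n : ℝ)⁻¹ * (L * M * Z⁻¹) ≤ 6 / 5 := by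
      rw [inv_mul_le_iff₀ hnpos]
      calc (L * M : ℝ) * Z⁻¹ ≤ c * n := hLn
        _ ≤ 6 / 5 * n := mul_le_mul_of_nonneg_right (min_le_left _ _) hnpos.le
        _ = _ := mul_comm _ _
    have hx0 : 0 ≤ (n : ℝ)⁻¹ * (L * M * Z⁻¹) := by positivity
    have : (n : ℝ)⁻¹ * (L * M * Z⁻¹ * (2 * (1 - (Q * ρ).trace.re) +
        4 * ((M : ℝ) - 1) * (Q * ω).trace.re)) ≤ 27 / 5 * ε := by
      rw [← mul_assoc]
      calc _ ≤ (n : ℝ)⁻¹ * (L * M * Z⁻¹) * (9 / 2 * ε) := mul_le_mul_of_nonneg_left herr hx0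
        _ ≤ 6 / 5 * (9 / 2 * ε) := mul_le_mul_of_nonneg_right hx (by positivity)
        _ = _ := by ring
    linarith
  · rw [hcharge]
    have h1 : -hypTestEntropy (1 - ε) ρ ω = Real.log e := by rw [he, Real.log_exp]
    rw [h1, ← Real.log_mul hepos.ne' hZpos.ne', ← Real.log_mul (by positivity) (by positivity),
      ← Real.log_div hLpos.ne' hnpos.ne']
    refine Real.log_le_log (by positivity) ?_
    rw [div_le_iff₀ hnpos]
    -- From LM/Z ≤ cn with c ≤ 2eM/ε, the factor M cancels and L/n ≤ 2eZ/ε remains.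
    have h2 : (L * M : ℝ) * Z⁻¹ ≤ 2 * e * M / ε * n :=
      hLn.trans (mul_le_mul_of_nonneg_right (min_le_right _ _) hnpos.le)
    rw [← div_eq_mul_inv, div_le_iff₀ hZpos] at h2
    have h3 : 2 * e * M / ε * n * Z = (e * Z * (2 / ε) * n) * M := by ring
    rw [h3] at h2
    exact le_of_mul_le_mul_right h2 hMpos

end Main

end QThermo

end

theorem corollaryx {X : Type*} [Fintype X] [DecidableEq X]
    (HX : Matrix X X ℂ) (hHX : HX.IsHermitian) (β : ℝ) (hβ : 0 ≤ β)
    (T : Matrix X X ℂ →ₗ[ℂ] Matrix X X ℂ)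
    (hcp : QThermo.IsCompletelyPositive T) (htp : QThermo.IsTracePreserving T)
    (hcov : QThermo.IsTimeCovariant HX T)
    (σ : Matrix X X ℂ) (hσ : QThermo.IsState σ) (hcomm : Commute σ HX)
    (ε : ℝ) (hε : 0 < ε) (hε1 : ε < 1) :
    (∃ (k : ℕ) (HE : Matrix (Fin k) (Fin k) ℂ) (e₀ : Fin k → ℂ)
      (V : Matrix (Fin k × X) (Fin k × X) ℂ), QThermo.IsCovariantDilation HX T HE e₀ V) ∧
    ∀ (E : Type*) [Fintype E] [DecidableEq E] (HE : Matrix E E ℂ) (e₀ : E → ℂ)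
      (V : Matrix (E × X) (E × X) ℂ), QThermo.IsCovariantDilation HX T HE e₀ V →
      ∃ (d : ℕ)
        (Φ : Matrix (X × Fin d) (X × Fin d) ℂ →ₗ[ℂ] Matrix (X × Fin d) (X × Fin d) ℂ)
        (τ τ' : QThermo.BatteryState d),
        QThermo.IsThermalOperation β
          (QThermo.totalHamiltonian HX (0 : Matrix (Fin d) (Fin d) ℂ)) Φ ∧
        (∀ (R : Type*) [Fintype R] [DecidableEq R] (ψ : X × R → ℂ),
          QThermo.IsPurification σ ψ →
          1 - 6 * ε ≤ QThermo.fidelity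
            (QThermo.ampliate (QThermo.effectiveWorkProcess Φ τ τ') R (QThermo.ketbra ψ))
            (QThermo.ampliate T R (QThermo.ketbra ψ))) ∧
        τ.charge - τ'.charge ≤
          -QThermo.hypTestEntropy (1 - ε) (QThermo.dilationOutput e₀ V σ)
              (QThermo.gibbsState β HE ⊗ₖ
                QThermo.traceLeft (QThermo.dilationOutput e₀ V σ))
            + Real.log (QThermo.partitionFunction β HE) + Real.log (2 / ε) :=
  ⟨QThermo.exists_isCovariantDilation hHX hcp htp hcov, fun _ _ _ _ _ _ h =>
    QThermo.exists_thermalOperation_of_dilation hHX β hcov h hσ hcomm hε hε1⟩
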